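/- Notation. For $\sigma,\rho>0$ and $(t,x)\in\mathbb R\times\mathbb R^d$ let $Q_{\sigma,\rho}(t,x)=(t-\sigma/2,t+\sigma/2)\times\prod_{i=1}^d(x_i-\rho/2,x_i+\rho/2)$, $Q_{\sigma,\rho}=Q_{\sigma,\rho}(0,0)$ and $Q_1=(-1/2,1/2)^d$; $|\cdot|$ is the Euclidean norm, $\fint_E$ denotes the average over $E$, and $Du$ denotes the distributional gradient in the space variable $x$. Let $d\ge 1$, $p>1$, $r>1+d/p$, $r_1\in(1+d/p,r)$ and $\bar C>0$. There exist constants $\lambda_0\ge 1$, $\kappa\ge 1$, $c_1\ge 2$, $c_2\ge 5c_1$ and $\hat C>0$, depending only on $d,p,r_1,r,\bar C$, with the following property. Let $u,f:[-1/2,1/2]\times Q_1\to\mathbb R$ be continuous, $f\ge 0$, and suppose that $$-\partial_t u+\frac1{\bar C}|Du|^p\le f(t,x)\quad\text{and}\quad -\partial_t u+\bar C|Du|^p\ge-\bar C\qquad\text{in } Q_{1,1}=(-1/2,1/2)\times Q_1$$ in the viscosity sense. Then $Du$ is a function in $L^p_{loc}(Q_{1,1})$ and, for all $\lambda\ge\lambda_0$,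 $h>0$ and $(t_0,x_0)$, setting $\sigma=\kappa\lambda^{1-p}$ and $$Q=Q_{\sigma h,h}(t_0,x_0),\quad Q'=Q_{c_1\sigma h,c_1h}(t_0,x_0),\quad Q''=Q_{c_2\sigma h,c_2h}(t_0,x_0),$$ if $Q''\subset Q_{1,1}$ and $$\lambda^p\le \fint_Q\big(|Du|^p+f^{r_1}\big)\le c_2^{d+1}\fint_{Q''}\big(|Du|^p+f^{r_1}\big)\le c_2^{d+1}\lambda^p,$$ then $$\fint_{Q''}|Du|^p\le\hat C\Big(\fint_{Q'}|Du|\Big)^p+\hat C\fint_{Q'}\big(1+f^{r_1}\big).$$ -/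

import Mathlib

open MeasureTheory Set
open scoped ContDiff

noncomputable section

/-- The open cube `x + (-ρ/2, ρ/2)^d` in `ℝ^d`. -/
def cube {d : ℕ} (ρ : ℝ) (x : EuclideanSpace ℝ (Fin d)) : Set (EuclideanSpace ℝ (Fin d)) :=
  {y | ∀ i, y i ∈ Ioo (x i - ρ / 2) (x i + ρ / 2)}

/-- The open space-time cylinder `(t - σ/2, t + σ/2) × ∏ᵢ (xᵢ - ρ/2, xᵢ + ρ/2)`
centred at `z = (t, x)`. -/
def cyl {d : ℕ} (σ ρ : ℝ) (z : ℝ × EuclideanSpace ℝ (Fin d)) :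
    Set (ℝ × EuclideanSpace ℝ (Fin d)) :=
  Ioo (z.1 - σ / 2) (z.1 + σ / 2) ×ˢ cube ρ z.2

/-- The classical time derivative `∂ₜ φ (t, x)`. -/
def timeDeriv {d : ℕ} (φ : ℝ × EuclideanSpace ℝ (Fin d) → ℝ)
    (z : ℝ × EuclideanSpace ℝ (Fin d)) : ℝ :=
  deriv (fun t => φ (t, z.2)) z.1

/-- The classical gradient in the space variable, `Dφ (t, x)`. -/
def spaceGrad {d : ℕ} (φ : ℝ × EuclideanSpace ℝ (Fin d) → ℝ)
    (z : ℝ × EuclideanSpace ℝ (Fin d)) : EuclideanSpace ℝ (Fin d) :=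
  gradient (fun x => φ (z.1, x)) z.2

/-- `-∂ₜ u + (1/C) |Du|^p ≤ f` in `Ω` in the viscosity sense
(touching from above by `C¹` test functions, up to constants). -/
def IsViscositySub {d : ℕ} (p C : ℝ) (f : ℝ × EuclideanSpace ℝ (Fin d) → ℝ)
    (Ω : Set (ℝ × EuclideanSpace ℝ (Fin d))) (u : ℝ × EuclideanSpace ℝ (Fin d) → ℝ) : Prop :=
  ∀ φ : ℝ × EuclideanSpace ℝ (Fin d) → ℝ, ContDiff ℝ 1 φ →
    ∀ z ∈ Ω, IsLocalMax (fun w => u w - φ w) z →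
      -timeDeriv φ z + 1 / C * ‖spaceGrad φ z‖ ^ p ≤ f z

/-- `-∂ₜ u + C |Du|^p ≥ -C` in `Ω` in the viscosity sense
(touching from below by `C¹` test functions, up to constants). -/
def IsViscositySuper {d : ℕ} (p C : ℝ)
    (Ω : Set (ℝ × EuclideanSpace ℝ (Fin d))) (u : ℝ × EuclideanSpace ℝ (Fin d) → ℝ) : Prop :=
  ∀ φ : ℝ × EuclideanSpace ℝ (Fin d) → ℝ, ContDiff ℝ 1 φ →
    ∀ z ∈ Ω, IsLocalMin (fun w => u w - φ w) z →
      -C ≤ -timeDeriv φ z + C * ‖spaceGrad φ z‖ ^ p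

/-- `G` is the distributional gradient of `u` in the space variable on the open set `Ω`, and it is
a locally integrable function there. -/
def IsWeakSpaceGrad {d : ℕ} (Ω : Set (ℝ × EuclideanSpace ℝ (Fin d)))
    (u : ℝ × EuclideanSpace ℝ (Fin d) → ℝ)
    (G : ℝ × EuclideanSpace ℝ (Fin d) → EuclideanSpace ℝ (Fin d)) : Prop :=
  LocallyIntegrableOn G Ω ∧
  ∀ φ : ℝ × EuclideanSpace ℝ (Fin d) → ℝ, ContDiff ℝ ∞ φ → HasCompactSupport φ →
    tsupport φ ⊆ Ω → ∀ i : Fin d,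
      ∫ z in Ω, u z * spaceGrad φ z i = -∫ z in Ω, G z i * φ z

end

/-! ### Viscosity inequalities with local test functions, and Young's inequality. -/

section Viscosity
open Filter Topology Metric

variable {d : ℕ}

local notation "E" => EuclideanSpace ℝ (Fin d)

/-! The argument is by contradiction after rescaling. Suppose the inequality fails with K =
max(ε^(-p), ε^(-1)). The average of |Du|^p over Q'' is at most λ^p, so the average of |Du| over Q'
is at most ελ and that of 1 + f^r₁ over Q' at most ελ^p. The function v(s, y) = u(t₀ + λ^(1-p) h s,
x₀ + h y) / (λh) then solves the same pair of inequalities on fixed cylinders, with source λ^(-p) f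
and constant Cλ^(-p). Its gradient is small in L¹ and bounded in L^p. It is enough to show that Dv
is small in L^p on the unit cylinder: then the average over Q is below λ^p, against the hypothesis
(`exists_rescaled_const`).

Testing the subsolution inequality with a cutoff η gives ∫ |Dv|^p η ≤ C (∫ g η - ∫ (v - v(0)) ∂ₜη),
where g is the rescaled source. So it suffices that v has small oscillation (`exists_energy_const`,
`exists_oscillation_const`). The oscillation estimate has two halves.

(a) A subsolution satisfies u(a, γ(a)) ≤ u(b, γ(b)) + ∫ (c₀ |γ'|^q + g) along curves
(`IsViscositySub.path_le`). Two fans of curves are used, one opening from (t, x) and one closing at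
(t + 3τ, y), of width δ s^α. Averaging over the direction turns the integrals of the source along
curves into a space-time integral of g^r. This works when 1/p < α < (r - 1)/d, an interval which is
nonempty exactly because r > 1 + d/p. The spatial averages reached by the two fans differ by at most
the L¹ norm of the gradient. The outcome is v(t, x) ≤ v(t + 3τ, y) + a τ^(1-q) with a as small as
desired (`exists_time_shift_const`).

(b) Conversely, late values are bounded by earlier ones through a barrier for the supersolution.
Estimate (a) prevents the barrier from touching on the lateral boundary (`exists_late_le`).

The gradient itself comes from sup-convolutions. They are Lipschitz and subsolutions almost
everywhere, and the same cutoff test bounds their gradients in L^p_loc. A Komlós-type selection of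
nearly minimal elements in decreasing midpoint-convex sets gives a limit converging in L¹ and almost
everywhere on compact sets, and Fatou's lemma preserves the inequality containing |Du|^p
(`IsViscositySub.exists_distribGrad`). -/

theorem timeDeriv_congr {φ ψ : ℝ × E → ℝ} {z : ℝ × E} (h : φ =ᶠ[𝓝 z] ψ) :
    timeDeriv φ z = timeDeriv ψ z := by
  have h' : ∀ᶠ t in 𝓝 z.1, φ (t, z.2) = ψ (t, z.2) :=
    (Continuous.tendsto (f := fun t : ℝ => (t, z.2)) (by fun_prop) z.1).eventually h
  exact Filter.EventuallyEq.deriv_eq h'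

theorem spaceGrad_congr {φ ψ : ℝ × E → ℝ} {z : ℝ × E} (h : φ =ᶠ[𝓝 z] ψ) :
    spaceGrad φ z = spaceGrad ψ z := by
  have h' : ∀ᶠ x in 𝓝 z.2, φ (z.1, x) = ψ (z.1, x) :=
    (Continuous.tendsto (f := fun x : E => (z.1, x)) (by fun_prop) z.2).eventually h
  unfold spaceGrad gradient
  rw [Filter.EventuallyEq.fderiv_eq h']

/-- A function which is `C¹` at a point coincides near this point with a `C¹` function. -/
theorem exists_contDiff_eventuallyEq {F : Type*} [NormedAddCommGroup F] [NormedSpace ℝ F]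
    [FiniteDimensional ℝ F] {φ : F → ℝ} {z : F} (h : ContDiffAt ℝ 1 φ z) :
    ∃ ψ : F → ℝ, ContDiff ℝ 1 ψ ∧ ψ =ᶠ[𝓝 z] φ := by
  have h1 : ∀ᶠ w in 𝓝 z, ContDiffAt ℝ 1 φ w := h.eventually (by simp)
  obtain ⟨R, hR, hball⟩ := Metric.eventually_nhds_iff_ball.1 h1
  let χ : ContDiffBump z := ⟨R / 4, R / 2, by positivity, by linarith⟩
  have hχ : ContDiff ℝ 1 χ := χ.contDiff
  refine ⟨fun w => χ w * φ w, ?_, ?_⟩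
  · rw [contDiff_iff_contDiffAt]
    intro w
    by_cases hw : w ∈ ball z R
    · exact hχ.contDiffAt.mul (hball w hw)
    · have hw' : w ∈ (closedBall z (R / 2))ᶜ := by
        simp only [mem_ball, not_lt, mem_compl_iff, mem_closedBall, not_le] at hw ⊢
        linarith
      have : (fun w => χ w * φ w) =ᶠ[𝓝 w] fun _ => 0 := by
        filter_upwards [isClosed_closedBall.isOpen_compl.mem_nhds hw'] with y hy
        have : χ y = 0 := by
          apply χ.zero_of_le_dist
          simp only [mem_compl_iff, mem_closedBall, not_le] at hy
          exact hy.le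
        simp [this]
      exact contDiffAt_const.congr_of_eventuallyEq this
  · filter_upwards [χ.eventuallyEq_one] with w hw
    simp [hw]

theorem isLocalMax_congr_right {F : Type*} [TopologicalSpace F] {u φ ψ : F → ℝ} {z : F}
    (h : IsLocalMax (fun w => u w - φ w) z) (hψ : ψ =ᶠ[𝓝 z] φ) :
    IsLocalMax (fun w => u w - ψ w) z := by
  have hz := hψ.self_of_nhds
  filter_upwards [h, hψ] with w hw hw'
  simpa [hw', hz] using hw

theorem isLocalMin_congr_right {F : Type*} [TopologicalSpace F] {u φ ψ : F → ℝ} {z : F}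
    (h : IsLocalMin (fun w => u w - φ w) z) (hψ : ψ =ᶠ[𝓝 z] φ) :
    IsLocalMin (fun w => u w - ψ w) z := by
  have hz := hψ.self_of_nhds
  filter_upwards [h, hψ] with w hw hw'
  simpa [hw', hz] using hw

/-- The viscosity condition is local, so a test function need only be C¹ near the touching point.
The test functions below, built from curves and from negative powers of time, are regular only
there. -/
theorem IsViscositySub.le_of_contDiffAt {p C : ℝ} {f u : ℝ × E → ℝ} {Ω : Set (ℝ × E)}
    (hu : IsViscositySub p C f Ω u) {φ : ℝ × E → ℝ} {z : ℝ × E} (hφ : ContDiffAt ℝ 1 φ z)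
    (hz : z ∈ Ω) (hmax : IsLocalMax (fun w => u w - φ w) z) :
    -timeDeriv φ z + 1 / C * ‖spaceGrad φ z‖ ^ p ≤ f z := by
  obtain ⟨ψ, hψ, hψφ⟩ := exists_contDiff_eventuallyEq hφ
  rw [← timeDeriv_congr hψφ, ← spaceGrad_congr hψφ]
  exact hu ψ hψ z hz (isLocalMax_congr_right hmax hψφ)

/-- `-∂ₜ u + C |Du|^p ≥ -e` in `Ω` in the viscosity sense. -/
def IsViscositySuperWith (p C e : ℝ) (Ω : Set (ℝ × E)) (u : ℝ × E → ℝ) : Prop :=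
  ∀ φ : ℝ × E → ℝ, ContDiff ℝ 1 φ → ∀ z ∈ Ω, IsLocalMin (fun w => u w - φ w) z →
    -e ≤ -timeDeriv φ z + C * ‖spaceGrad φ z‖ ^ p

theorem IsViscositySuperWith.le_of_contDiffAt {p C e : ℝ} {u : ℝ × E → ℝ} {Ω : Set (ℝ × E)}
    (hu : IsViscositySuperWith p C e Ω u) {φ : ℝ × E → ℝ} {z : ℝ × E} (hφ : ContDiffAt ℝ 1 φ z)
    (hz : z ∈ Ω) (hmin : IsLocalMin (fun w => u w - φ w) z) :
    -e ≤ -timeDeriv φ z + C * ‖spaceGrad φ z‖ ^ p := by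
  obtain ⟨ψ, hψ, hψφ⟩ := exists_contDiff_eventuallyEq hφ
  rw [← timeDeriv_congr hψφ, ← spaceGrad_congr hψφ]
  exact hu ψ hψ z hz (isLocalMin_congr_right hmin hψφ)

/-- Young's inequality for (k a)(b / k), with k normalised by k^p / p = 1/C so that the first term
is exactly the Hamiltonian. The constant c then bounds its Legendre transform, the cost of moving
with speed b. -/
theorem exists_young_const {p q C : ℝ} (hpq : p.HolderConjugate q) (hC : 0 < C) :
    ∃ c : ℝ, 0 < c ∧ ∀ a b : ℝ, 0 ≤ a → 0 ≤ b → a * b ≤ 1 / C * a ^ p + c * b ^ q := by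
  have hp := hpq.pos
  have hq := hpq.symm.pos
  set k : ℝ := (p / C) ^ (1 / p) with hk
  have hk0 : 0 < k := by positivity
  refine ⟨(1 / k) ^ q / q, by positivity, fun a b ha hb => ?_⟩
  have h := Real.young_inequality_of_nonneg (a := k * a) (b := (1 / k) * b)
    (by positivity) (by positivity) hpq
  have hkp : k ^ p = p / C := by
    rw [hk, ← Real.rpow_mul (by positivity), one_div_mul_cancel hp.ne', Real.rpow_one]
  rw [Real.mul_rpow hk0.le ha, Real.mul_rpow (by positivity) hb, hkp] at h
  calc a * b = k * a * (1 / k * b) := by field_simp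
    _ ≤ _ := h
    _ = _ := by field_simp

theorem hasGradientAt_norm_sub_sq (a : ℝ) (y x : E) :
    HasGradientAt (fun x : E => a * ‖x - y‖ ^ 2) ((2 * a) • (x - y)) x := by
  rw [hasGradientAt_iff_hasFDerivAt]
  have h := ((hasFDerivAt_id x).sub_const y).norm_sq.const_mul a
  refine h.congr_fderiv ?_
  ext v
  simp
  ring

end Viscosity

/-! ### The dynamic programming inequality along curves. -/

section PathInequality
open Filter Topology Metric

variable {d : ℕ}

local notation "E" => EuclideanSpace ℝ (Fin d)

/-- A continuous function on an open neighbourhood of a compact curve is uniformly close, in a small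
tube around the curve, to its values on the curve. -/
theorem exists_tube {u : ℝ × E → ℝ} {Ω : Set (ℝ × E)} (hΩ : IsOpen Ω) (hu : ContinuousOn u Ω)
    {γ : ℝ → E} {a b : ℝ} (hγ : ContinuousOn γ (Icc a b))
    (hγΩ : ∀ s ∈ Icc a b, (s, γ s) ∈ Ω) {ε : ℝ} (hε : 0 < ε) :
    ∃ R > 0, (∀ s ∈ Icc a b, ∀ v : E, ‖v‖ ≤ R → (s, γ s + v) ∈ Ω) ∧
      ∀ s ∈ Icc a b, ∀ v : E, ‖v‖ ≤ R → |u (s, γ s + v) - u (s, γ s)| ≤ ε := by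
  have hΓ : IsCompact ((fun s => (s, γ s)) '' Icc a b) :=
    isCompact_Icc.image_of_continuousOn (continuousOn_id.prodMk hγ)
  obtain ⟨δ, hδ, hδΩ⟩ := hΓ.exists_cthickening_subset_open hΩ (by
    rintro _ ⟨s, hs, rfl⟩; exact hγΩ s hs)
  have hmem : ∀ s ∈ Icc a b, ∀ v : E, ‖v‖ ≤ δ → (s, γ s + v) ∈ Ω := by
    intro s hs v hv
    apply hδΩ
    refine mem_cthickening_of_dist_le _ (s, γ s) _ _ (mem_image_of_mem _ hs) ?_
    simpa [Prod.dist_eq] using hv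
  have hcont : ContinuousOn (fun w : ℝ × E => u (w.1, γ w.1 + w.2))
      (Icc a b ×ˢ closedBall (0 : E) δ) := by
    refine hu.comp (continuousOn_fst.prodMk ((hγ.comp continuousOn_fst ?_).add continuousOn_snd)) ?_
    · intro w hw; exact hw.1
    · intro w hw
      exact hmem _ hw.1 _ (by simpa using hw.2)
  have hcomp : IsCompact (Icc a b ×ˢ closedBall (0 : E) δ) :=
    isCompact_Icc.prod (isCompact_closedBall _ _)
  obtain ⟨R, hR, hRu⟩ := Metric.uniformContinuousOn_iff.1
    (hcomp.uniformContinuousOn_of_continuous hcont) ε hε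
  refine ⟨min δ (R / 2), by positivity, fun s hs v hv => hmem s hs v (hv.trans (min_le_left _ _)),
    fun s hs v hv => ?_⟩
  have h := hRu (s, v) ⟨hs, by simpa using hv.trans (min_le_left _ _)⟩ (s, 0)
    ⟨hs, by simpa using hδ.le⟩ (by
      simp only [Prod.dist_eq, dist_self, dist_zero_right]
      rw [max_lt_iff]
      exact ⟨hR, by linarith [hv.trans (min_le_right _ _)]⟩)
  simpa [Real.dist_eq] using h.le

/-- Along a `C¹` curve a viscosity subsolution satisfies the dynamic programming inequality. -/
theorem IsViscositySub.path_le {p q C c₀ : ℝ}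
    (hc₀ : ∀ a b : ℝ, 0 ≤ a → 0 ≤ b → a * b ≤ 1 / C * a ^ p + c₀ * b ^ q)
    {g u : ℝ × E → ℝ} {Ω : Set (ℝ × E)} (hΩ : IsOpen Ω) (hu : ContinuousOn u Ω)
    (hg : ContinuousOn g Ω) (hsub : IsViscositySub p C g Ω u)
    {γ γ' : ℝ → E} {k : ℝ → ℝ} {a b : ℝ} (hab : a < b)
    (hγ : ∀ s ∈ Icc a b, ContDiffAt ℝ 1 γ s) (hγ' : ∀ s ∈ Icc a b, HasDerivAt γ (γ' s) s)
    (hγΩ : ∀ s ∈ Icc a b, (s, γ s) ∈ Ω) (hk : ContinuousOn k (Icc a b))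
    (hkγ : ∀ s ∈ Icc a b, c₀ * ‖γ' s‖ ^ q + g (s, γ s) ≤ k s) :
    u (a, γ a) ≤ u (b, γ b) + ∫ s in a..b, k s := by
  -- If the inequality fails by 4m, the function u(s, γ(s) + v), penalised in v and in s, has an
  -- interior maximum in a thin tube around the curve. The penalty is a test function there, and
  -- Young's inequality contradicts the subsolution property by a margin η/2.
  by_contra! hlt
  have hγc : ContinuousOn γ (Icc a b) := fun s hs => (hγ s hs).continuousAt.continuousWithinAt
  -- the primitive of `k`
  set kk : ℝ → ℝ := IccExtend hab.le ((Icc a b).domRestrict k) with hkk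
  have hkkc : Continuous kk := (continuousOn_iff_continuous_domRestrict.1 hk).Icc_extend'
  have hkkeq : ∀ s ∈ Icc a b, kk s = k s := fun s hs => by
    rw [hkk, IccExtend_of_mem _ _ hs]; rfl
  set K : ℝ → ℝ := fun s => ∫ x in a..s, kk x with hK
  have hKd : ∀ s, HasDerivAt K (kk s) s := fun s =>
    intervalIntegral.integral_hasDerivAt_right (hkkc.intervalIntegrable _ _)
      hkkc.stronglyMeasurable.stronglyMeasurableAtFilter hkkc.continuousAt
  have hKC : ContDiff ℝ 1 K := by
    rw [contDiff_one_iff_deriv]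
    refine ⟨fun s => (hKd s).differentiableAt, ?_⟩
    rwa [show deriv K = kk from funext fun s => (hKd s).deriv]
  have hKa : K a = 0 := by simp [hK]
  have hKb : K b = ∫ s in a..b, k s := by
    refine intervalIntegral.integral_congr fun s hs => hkkeq s ?_
    rwa [uIcc_of_le hab.le] at hs
  rw [← hKb] at hlt
  obtain ⟨m, hm, hm0⟩ : ∃ m, u (a, γ a) = u (b, γ b) + K b + 4 * m ∧ 0 < m :=
    ⟨(u (a, γ a) - (u (b, γ b) + K b)) / 4, by ring, by linarith⟩
  set η : ℝ := m / (b - a) with hη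
  have hba : 0 < b - a := by linarith
  have hη0 : 0 < η := by positivity
  have hηba : η * (b - a) = m := by rw [hη]; field_simp
  -- an interior time at which the violation persists
  obtain ⟨a₁, ha₁, hha₁⟩ : ∃ a₁ ∈ Ioo a b, u (a, γ a) - m ≤ u (a₁, γ a₁) + K a₁ := by
    have hc : ContinuousOn (fun s => u (s, γ s) + K s) (Icc a b) :=
      (hu.comp (continuousOn_id.prodMk hγc) hγΩ).add hKC.continuous.continuousOn
    have h1 : ∀ᶠ s in 𝓝[Icc a b] a, u (a, γ a) - m < u (s, γ s) + K s := by
      have := (hc a (left_mem_Icc.2 hab.le)).tendsto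
      refine this.eventually (lt_mem_nhds ?_)
      simp only [hKa]; linarith
    have h2 : ∀ᶠ s in 𝓝[Ioo a b] a, u (a, γ a) - m < u (s, γ s) + K s :=
      h1.filter_mono (nhdsWithin_mono _ Ioo_subset_Icc_self)
    have : (𝓝[Ioo a b] a).NeBot := by
      rw [← mem_closure_iff_nhdsWithin_neBot, closure_Ioo hab.ne]
      exact left_mem_Icc.2 hab.le
    obtain ⟨s, hs, hs'⟩ := (h2.and self_mem_nhdsWithin).exists
    exact ⟨s, hs', hs.le⟩
  obtain ⟨R₁, hR₁, hΩ₁, hu₁⟩ := exists_tube hΩ hu hγc hγΩ hm0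
  obtain ⟨R₂, hR₂, hΩ₂, hg₂⟩ := exists_tube hΩ hg hγc hγΩ (half_pos hη0)
  set R := min R₁ R₂ with hR
  have hR0 : 0 < R := lt_min hR₁ hR₂
  -- bound on the curve
  obtain ⟨B, hB⟩ := (isCompact_Icc (a := a) (b := b)).exists_bound_of_continuousOn
    (f := fun s => u (s, γ s)) (hu.comp (continuousOn_id.prodMk hγc) hγΩ)
  simp only [Real.norm_eq_abs] at hB
  obtain ⟨BK, hBK⟩ := (isCompact_Icc (a := a) (b := b)).exists_bound_of_continuousOn
    (f := K) hKC.continuous.continuousOn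
  simp only [Real.norm_eq_abs] at hBK
  set e₁ := expNegInvGlue (a₁ - a) with he₁
  have he₁0 : 0 < e₁ := expNegInvGlue.pos_of_pos (by linarith [ha₁.1])
  have hB0 : 0 ≤ B := (abs_nonneg _).trans (hB a (left_mem_Icc.2 hab.le))
  have hBK0 : 0 ≤ BK := (abs_nonneg _).trans (hBK a (left_mem_Icc.2 hab.le))
  -- N is large enough to exclude a maximum at the initial time, and n below is such that the
  -- quadratic penalty on the wall |v| = R is 2m, more than the oscillation m of u across the tube.
  obtain ⟨N, hN, hN0⟩ : ∃ N, N * e₁ = 2 * B + 2 * BK + 2 * m ∧ 0 < N :=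
    ⟨(2 * B + 2 * BK + 2 * m) / e₁, by field_simp, by positivity⟩
  obtain ⟨n, hn, hn0⟩ : ∃ n, n * R ^ 2 = 2 * m ∧ 0 < n :=
    ⟨(2 * m) / R ^ 2, by field_simp, by positivity⟩
  -- The term -K compensates the running cost and -ηs makes the violation strict at total expense m.
  -- The last term is smooth, vanishes after the time a₁ and is nonincreasing in s, so it keeps the
  -- maximum away from s = a without damaging the sign of the derivative.
  set P : ℝ → ℝ := fun s => -K s - η * s + N * expNegInvGlue (a₁ - s) with hP
  have hPC : ContDiff ℝ 1 P := by
    have h3 : ContDiff ℝ 1 fun s => expNegInvGlue (a₁ - s) :=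
      expNegInvGlue.contDiff.comp (contDiff_const.sub contDiff_id)
    exact (hKC.neg.sub (contDiff_const.mul contDiff_id)).add (contDiff_const.mul h3)
  have hPd : ∀ s, ∃ D, HasDerivAt P D s ∧ D ≤ -kk s - η := by
    intro s
    have h3 : HasDerivAt expNegInvGlue (deriv expNegInvGlue (a₁ - s)) (a₁ - s) :=
      ((expNegInvGlue.contDiff (n := 1)).differentiable (by simp) _).hasDerivAt
    have h4 := h3.comp s ((hasDerivAt_id s).const_sub a₁)
    refine ⟨_, ((hKd s).neg.sub ((hasDerivAt_id s).const_mul η)).add (h4.const_mul N), ?_⟩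
    have : 0 ≤ N * deriv expNegInvGlue (a₁ - s) :=
      mul_nonneg hN0.le expNegInvGlue.monotone.deriv_nonneg
    simp only [mul_one]
    linarith
  set F : ℝ × E → ℝ := fun w => u (w.1, γ w.1 + w.2) - n * ‖w.2‖ ^ 2 - P w.1 with hF
  have hFc : ContinuousOn F (Icc a b ×ˢ closedBall (0 : E) R) := by
    refine ContinuousOn.sub (ContinuousOn.sub ?_ (by fun_prop))
      (hPC.continuous.comp continuous_fst).continuousOn
    refine hu.comp (continuousOn_fst.prodMk ((hγc.comp continuousOn_fst ?_).add continuousOn_snd)) ?_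
    · intro w hw; exact hw.1
    · intro w hw
      refine hΩ₁ _ hw.1 _ ?_
      have : ‖w.2‖ ≤ R := by simpa using hw.2
      exact this.trans (min_le_left _ _)
  obtain ⟨⟨s, v⟩, ⟨hs, hv⟩, hmax⟩ :=
    (isCompact_Icc.prod (isCompact_closedBall (0 : E) R)).exists_isMaxOn
      ⟨(a₁, 0), Ioo_subset_Icc_self ha₁, by simp [hR0.le]⟩ hFc
  simp only at hs hv
  have hvR : ‖v‖ ≤ R := by simpa using hv
  have hmax' : ∀ s' ∈ Icc a b, ∀ v' : E, ‖v'‖ ≤ R → F (s', v') ≤ F (s, v) := fun s' hs' v' hv' =>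
    hmax ⟨hs', by simpa using hv'⟩
  have hus := abs_le.1 (hu₁ s hs v (hvR.trans (min_le_left _ _)))
  -- the maximum is not attained on the boundary
  have hvR' : ‖v‖ < R := by
    refine lt_of_le_of_ne hvR fun hcon => ?_
    have h := hmax' s hs 0 (by simp [hR0.le])
    simp only [hF, hcon, norm_zero, add_zero] at h
    have : (0 : ℝ) ^ 2 = 0 := by norm_num
    rw [this] at h
    linarith
  have h1 := hmax' a₁ (Ioo_subset_Icc_self ha₁) 0 (by simp [hR0.le])
  have hFa₁ : F (a₁, 0) = u (a₁, γ a₁) + K a₁ + η * a₁ := by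
    simp [hF, hP]; ring
  have hFle : F (s, v) ≤ u (s, γ s) + m - P s := by
    have : 0 ≤ n * ‖v‖ ^ 2 := by positivity
    simp only [hF]; linarith
  have hsa : s ≠ a := by
    rintro rfl
    have h3 := abs_le.1 (hB s hs)
    have h4 := abs_le.1 (hB a₁ (Ioo_subset_Icc_self ha₁))
    have h5 := abs_le.1 (hBK a₁ (Ioo_subset_Icc_self ha₁))
    have h6 : η * s ≤ η * a₁ := mul_le_mul_of_nonneg_left ha₁.1.le hη0.le
    have h7 : P s = -η * s + N * e₁ := by simp [hP, hKa, he₁]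
    rw [hFa₁] at h1
    rw [h7] at hFle
    linarith
  have hsb : s ≠ b := by
    rintro rfl
    have h7 : P s = -K s - η * s := by
      simp [hP, expNegInvGlue.zero_of_nonpos (show a₁ - s ≤ 0 by linarith [ha₁.2])]
    rw [hFa₁] at h1
    rw [h7] at hFle
    have h6 : η * a ≤ η * a₁ := mul_le_mul_of_nonneg_left ha₁.1.le hη0.le
    have : η * s - η * a = m := by rw [← hηba]; ring
    linarith
  have hsI : s ∈ Ioo a b := ⟨lt_of_le_of_ne hs.1 hsa.symm, lt_of_le_of_ne hs.2 hsb⟩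
  -- the test function
  set φ : ℝ × E → ℝ := fun w => n * ‖w.2 - γ w.1‖ ^ 2 + P w.1 with hφ
  set z : ℝ × E := (s, γ s + v) with hz
  have hφC : ContDiffAt ℝ 1 φ z := by
    have h3 : ContDiffAt ℝ 1 (fun w : ℝ × E => γ w.1) z :=
      ContDiffAt.comp z (hγ s hs) contDiffAt_fst
    exact (contDiffAt_const.mul ((contDiffAt_snd.sub h3).norm_sq ℝ)).add
      (hPC.contDiffAt.comp z contDiffAt_fst)
  have hloc : IsLocalMax (fun w => u w - φ w) z := by
    have hc : ContinuousAt (fun w : ℝ × E => w.2 - γ w.1) z :=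
      continuousAt_snd.sub (ContinuousAt.comp (f := Prod.fst) (g := γ) (x := z)
        (hγ s hs).continuousAt continuousAt_fst)
    have h3 : ∀ᶠ w in 𝓝 z, w.2 - γ w.1 ∈ ball (0 : E) R :=
      hc.tendsto.eventually (isOpen_ball.mem_nhds (by simpa [hz] using hvR'))
    have h4 : ∀ᶠ w in 𝓝 z, w.1 ∈ Ioo a b :=
      continuousAt_fst.tendsto.eventually (isOpen_Ioo.mem_nhds hsI)
    filter_upwards [h3, h4] with w hw hw'
    have h := hmax' w.1 (Ioo_subset_Icc_self hw') (w.2 - γ w.1) (by simpa using (mem_ball.1 hw).le)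
    simp only [hF, hφ, hz, add_sub_cancel, add_sub_cancel_left, Prod.mk.eta] at h ⊢
    linarith
  obtain ⟨D, hD, hDle⟩ := hPd s
  have ht : timeDeriv φ z = n * (2 * inner ℝ v (-γ' s)) + D := by
    have h3 : HasDerivAt (fun t => γ s + v - γ t) (-γ' s) s := (hγ' s hs).const_sub _
    have h4 := ((h3.norm_sq).const_mul n).add hD
    simp only [add_sub_cancel_left] at h4
    exact h4.deriv
  have hx : spaceGrad φ z = (2 * n) • v := by
    have h3 := hasGradientAt_norm_sub_sq n (γ s) (γ s + v)
    rw [add_sub_cancel_left, hasGradientAt_iff_hasFDerivAt] at h3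
    have h4 := h3.add_const (P s)
    exact (hasGradientAt_iff_hasFDerivAt.2 h4).gradient
  have hineq := hsub.le_of_contDiffAt hφC (hΩ₁ s hs v (hvR.trans (min_le_left _ _))) hloc
  rw [ht, hx] at hineq
  have hgs := abs_le.1 (hg₂ s hs v (hvR.trans (min_le_right _ _)))
  -- The drift term created by the moving centre γ(s) is absorbed by the Hamiltonian at the price c₀
  -- |γ'|^q, which is part of k. What is left reads η ≤ η/2.
  have h3 := hc₀ ‖(2 * n) • v‖ ‖γ' s‖ (norm_nonneg _) (norm_nonneg _)
  have h4 : n * (2 * inner ℝ v (-γ' s)) ≤ ‖(2 * n) • v‖ * ‖γ' s‖ := by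
    calc n * (2 * inner ℝ v (-γ' s)) = inner ℝ ((2 * n) • v) (-γ' s) := by
          rw [real_inner_smul_left]; ring
      _ ≤ ‖(2 * n) • v‖ * ‖-γ' s‖ := real_inner_le_norm _ _
      _ = _ := by rw [norm_neg]
  have h5 := hkγ s hs
  rw [← hkkeq s hs] at h5
  linarith

/-- The dynamic programming inequality along a curve which is `C¹` only in the interior of the time
interval. -/
theorem IsViscositySub.path_le_of_Ioo {p q C c₀ : ℝ}
    (hc₀ : ∀ a b : ℝ, 0 ≤ a → 0 ≤ b → a * b ≤ 1 / C * a ^ p + c₀ * b ^ q)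
    {g u : ℝ × E → ℝ} {Ω : Set (ℝ × E)} (hΩ : IsOpen Ω) (hu : ContinuousOn u Ω)
    (hg : ContinuousOn g Ω) (hsub : IsViscositySub p C g Ω u)
    {γ γ' : ℝ → E} {k : ℝ → ℝ} {a b : ℝ} (hab : a < b) (hγc : ContinuousOn γ (Icc a b))
    (hγ : ∀ s ∈ Ioo a b, ContDiffAt ℝ 1 γ s) (hγ' : ∀ s ∈ Ioo a b, HasDerivAt γ (γ' s) s)
    (hγΩ : ∀ s ∈ Icc a b, (s, γ s) ∈ Ω) (hk : ContinuousOn k (Ioo a b))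
    (hki : IntervalIntegrable k volume a b)
    (hkγ : ∀ s ∈ Ioo a b, c₀ * ‖γ' s‖ ^ q + g (s, γ s) ≤ k s) :
    u (a, γ a) ≤ u (b, γ b) + ∫ s in a..b, k s := by
  have hU : ContinuousOn (fun s => u (s, γ s)) (Icc a b) :=
    hu.comp (continuousOn_id.prodMk hγc) hγΩ
  have hkI : IntegrableOn k (uIcc a b) := by
    rw [uIcc_of_le hab.le, integrableOn_Icc_iff_integrableOn_Ioc]
    exact (intervalIntegrable_iff_integrableOn_Ioc_of_le hab.le).1 hki
  have hKc : ContinuousOn (fun s => u (s, γ s) + ∫ x in a..s, k x) (Icc a b) := by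
    have := intervalIntegral.continuousOn_primitive_interval (a := a) (b := b) hkI
    rw [uIcc_of_le hab.le] at this
    exact hU.add this
  -- The inequality on compact subintervals says that u(s, γ(s)) plus the accumulated cost is
  -- nondecreasing. Continuity extends this to the endpoints, where γ' may be singular, as at the
  -- tip of a cone.
  have key : MonotoneOn (fun s => u (s, γ s) + ∫ x in a..s, k x) (Ioo a b) := by
    intro s hs t ht hst
    rcases hst.eq_or_lt with rfl | hst
    · exact le_rfl
    have hsub' : Icc s t ⊆ Ioo a b := fun x hx => ⟨hs.1.trans_le hx.1, hx.2.trans_lt ht.2⟩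
    have h := hsub.path_le hc₀ hΩ hu hg hst (fun x hx => hγ x (hsub' hx))
      (fun x hx => hγ' x (hsub' hx)) (fun x hx => hγΩ x (Ioo_subset_Icc_self (hsub' hx)))
      (hk.mono hsub') (fun x hx => hkγ x (hsub' hx))
    have i1 : IntervalIntegrable k volume a s := hki.mono_set (by
      rw [uIcc_of_le hs.1.le, uIcc_of_le hab.le]; exact Icc_subset_Icc_right hs.2.le)
    have i2 : IntervalIntegrable k volume s t := hki.mono_set (by
      rw [uIcc_of_le hst.le, uIcc_of_le hab.le]; exact Icc_subset_Icc hs.1.le ht.2.le)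
    have := intervalIntegral.integral_add_adjacent_intervals i1 i2
    simp only
    linarith
  set F : ℝ → ℝ := fun s => u (s, γ s) + ∫ x in a..s, k x with hF
  set m := (a + b) / 2 with hm
  have ham : a < m := by rw [hm]; linarith
  have hmb : m < b := by rw [hm]; linarith
  have h1 : F a ≤ F m := by
    refine ContinuousWithinAt.closure_le (s := Ioo a m) (f := F) (g := fun _ => F m) ?_ ?_
      continuousWithinAt_const fun y hy => key ⟨hy.1, hy.2.trans hmb⟩ ⟨ham, hmb⟩ hy.2.le
    · rw [closure_Ioo ham.ne]; exact left_mem_Icc.2 ham.le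
    · exact (hKc a (left_mem_Icc.2 hab.le)).mono fun y hy => ⟨hy.1.le, (hy.2.trans hmb).le⟩
  have h2 : F m ≤ F b := by
    refine ContinuousWithinAt.closure_le (s := Ioo m b) (f := fun _ => F m) (g := F) ?_
      continuousWithinAt_const ?_ fun y hy => key ⟨ham, hmb⟩ ⟨ham.trans hy.1, hy.2⟩ hy.1.le
    · rw [closure_Ioo hmb.ne]; exact right_mem_Icc.2 hmb.le
    · exact (hKc b (right_mem_Icc.2 hab.le)).mono fun y hy => ⟨(ham.trans hy.1).le, hy.2.le⟩
  have h3 : F a = u (a, γ a) := by simp [hF]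
  rw [← h3]
  exact h1.trans h2

end PathInequality

/-! ### Paths with variable width, and affine changes of variables. -/

section ConePaths
open Filter Topology Metric

variable {d : ℕ}

local notation "E" => EuclideanSpace ℝ (Fin d)

/-- Split at the threshold M: above it, x^(1-r) ≤ M^(1-r). The free threshold lets a first power be
traded for an r-th power with any desired weight. -/
theorem le_add_rpow_mul {r M x : ℝ} (hr : 1 < r) (hM : 0 < M) (hx : 0 ≤ x) :
    x ≤ M + M ^ (1 - r) * x ^ r := by
  rcases le_total x M with h | h
  · have : 0 ≤ M ^ (1 - r) * x ^ r := by positivity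
    linarith
  · have hx0 : 0 < x := hM.trans_le h
    have h1 : x ^ (1 - r) ≤ M ^ (1 - r) :=
      Real.rpow_le_rpow_of_nonpos hM h (by linarith)
    have h2 : x = x ^ (1 - r) * x ^ r := by
      rw [← Real.rpow_add hx0]; simp
    have h3 : x ^ (1 - r) * x ^ r ≤ M ^ (1 - r) * x ^ r := by gcongr
    linarith

/-- The dynamic programming inequality along `s ↦ x + w(s) v`, where the right-hand side is
estimated by its `r`-th power with the weight `w ^ d`. -/
theorem IsViscositySub.path_width_le {p q C c₀ r Λ : ℝ} (hq : 0 < q) (hc₀0 : 0 < c₀)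
    (hc₀ : ∀ a b : ℝ, 0 ≤ a → 0 ≤ b → a * b ≤ 1 / C * a ^ p + c₀ * b ^ q)
    (hr : 1 < r) (hΛ : 0 < Λ)
    {g u : ℝ × E → ℝ} {Ω : Set (ℝ × E)} (hΩ : IsOpen Ω) (hu : ContinuousOn u Ω)
    (hg : ContinuousOn g Ω) (hg0 : ∀ z ∈ Ω, 0 ≤ g z) (hsub : IsViscositySub p C g Ω u)
    {w w' : ℝ → ℝ} {a b : ℝ} (hab : a < b) {x v : E} (hv : ‖v‖ ≤ 1)
    (hw : ContinuousOn w (Icc a b)) (hw0 : ∀ s ∈ Ioo a b, 0 < w s)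
    (hwC : ∀ s ∈ Ioo a b, ContDiffAt ℝ 1 w s) (hwd : ∀ s ∈ Ioo a b, HasDerivAt w (w' s) s)
    (hw'c : ContinuousOn w' (Ioo a b)) (hwΩ : ∀ s ∈ Icc a b, (s, x + w s • v) ∈ Ω)
    (hi₁ : IntervalIntegrable (fun s => |w' s| ^ q) volume a b)
    (hi₂ : IntervalIntegrable (fun s => w s ^ (-(d / (r - 1)))) volume a b) :
    u (a, x + w a • v) ≤ u (b, x + w b • v) +
      (c₀ * (∫ s in a..b, |w' s| ^ q) + Λ * ∫ s in a..b, w s ^ (-(d / (r - 1)))) +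
      Λ ^ (1 - r) * ∫ s in a..b, w s ^ d * g (s, x + w s • v) ^ r := by
  have hγc : ContinuousOn (fun s => x + w s • v) (Icc a b) :=
    continuousOn_const.add (hw.smul continuousOn_const)
  have hgc : ContinuousOn (fun s => w s ^ d * g (s, x + w s • v) ^ r) (Icc a b) := by
    refine (hw.pow d).mul ((hg.comp (continuousOn_id.prodMk hγc) hwΩ).rpow_const ?_)
    intro s hs; right; linarith
  have hi₃ : IntervalIntegrable (fun s => w s ^ d * g (s, x + w s • v) ^ r) volume a b := by
    apply ContinuousOn.intervalIntegrable; rwa [uIcc_of_le hab.le]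
  set k : ℝ → ℝ := fun s => c₀ * |w' s| ^ q + Λ * w s ^ (-(d / (r - 1))) +
    Λ ^ (1 - r) * (w s ^ d * g (s, x + w s • v) ^ r) with hk
  have hint : ∫ s in a..b, k s = (c₀ * (∫ s in a..b, |w' s| ^ q) +
      Λ * ∫ s in a..b, w s ^ (-(d / (r - 1)))) +
      Λ ^ (1 - r) * ∫ s in a..b, w s ^ d * g (s, x + w s • v) ^ r := by
    rw [hk, intervalIntegral.integral_add ((hi₁.const_mul _).add (hi₂.const_mul _))
      (hi₃.const_mul _), intervalIntegral.integral_add (hi₁.const_mul _) (hi₂.const_mul _)]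
    simp only [intervalIntegral.integral_const_mul]
  rw [add_assoc, ← hint]
  refine hsub.path_le_of_Ioo hc₀ hΩ hu hg (γ := fun s => x + w s • v)
    (γ' := fun s => w' s • v) hab hγc ?_ ?_ hwΩ ?_ ?_ ?_
  · intro s hs
    exact contDiffAt_const.add ((hwC s hs).smul contDiffAt_const)
  · intro s hs
    exact ((hwd s hs).smul_const v).const_add x
  · refine ContinuousOn.add (ContinuousOn.add ?_ ?_) ?_
    · exact continuousOn_const.mul (hw'c.abs.rpow_const fun s _ => Or.inr hq.le)
    · exact continuousOn_const.mul ((hw.mono Ioo_subset_Icc_self).rpow_const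
        fun s hs => Or.inl (hw0 s hs).ne')
    · exact continuousOn_const.mul (hgc.mono Ioo_subset_Icc_self)
  · exact ((hi₁.const_mul _).add (hi₂.const_mul _)).add (hi₃.const_mul _)
  · intro s hs
    have hw0s := hw0 s hs
    have hgs := hg0 _ (hwΩ s (Ioo_subset_Icc_self hs))
    have h1 : ‖w' s • v‖ ^ q ≤ |w' s| ^ q := by
      refine Real.rpow_le_rpow (norm_nonneg _) ?_ hq.le
      rw [norm_smul, Real.norm_eq_abs]
      exact mul_le_of_le_one_right (abs_nonneg _) hv
    -- The threshold Λ w^(-d/(r-1)) is the one for which M^(1-r) = Λ^(1-r) w^d. The factor w^d is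
    -- the Jacobian of v ↦ x + w v, which an average over the directions v will use up.
    have h2 := le_add_rpow_mul hr (M := Λ * w s ^ (-(d / (r - 1)))) (by positivity) hgs
    have h3 : (Λ * w s ^ (-((d : ℝ) / (r - 1)))) ^ (1 - r) = Λ ^ (1 - r) * w s ^ d := by
      rw [Real.mul_rpow hΛ.le (by positivity), ← Real.rpow_mul hw0s.le, ← Real.rpow_natCast]
      congr 2
      have : r - 1 ≠ 0 := by linarith
      field_simp
      ring
    rw [h3, mul_assoc] at h2
    have h4 : c₀ * ‖w' s • v‖ ^ q ≤ c₀ * |w' s| ^ q := by gcongr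
    simp only [hk]
    linarith

/-- Affine parabolic change of variables. -/
theorem map_affine_volume (t : ℝ) (x : E) {τ δ : ℝ} (hτ : 0 < τ) (hδ : 0 < δ) :
    Measure.map (fun z : ℝ × E => (t + τ * z.1, x + δ • z.2)) volume =
      ENNReal.ofReal ((τ * δ ^ d)⁻¹) • (volume : Measure (ℝ × E)) := by
  have h1 : Measure.map (fun s : ℝ => t + τ * s) volume = ENNReal.ofReal τ⁻¹ • volume := by
    have : (fun s : ℝ => t + τ * s) = (fun s => t + s) ∘ fun s => τ * s := rfl
    rw [this, ← Measure.map_map (by fun_prop) (by fun_prop), Real.map_volume_mul_left hτ.ne',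
      Measure.map_smul, map_add_left_eq_self, abs_of_pos (by positivity)]
  have h2 : Measure.map (fun y : E => x + δ • y) volume = ENNReal.ofReal ((δ ^ d)⁻¹) • volume := by
    have : (fun y : E => x + δ • y) = (fun y => x + y) ∘ fun y => δ • y := rfl
    rw [this, ← Measure.map_map (by fun_prop) (by fun_prop), Measure.map_addHaar_smul _ hδ.ne',
      Measure.map_smul, map_add_left_eq_self, abs_of_pos (by positivity)]
    simp
  have h3 : (fun z : ℝ × E => (t + τ * z.1, x + δ • z.2)) =
      Prod.map (fun s : ℝ => t + τ * s) (fun y : E => x + δ • y) := rfl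
  rw [h3, Measure.volume_eq_prod, ← Measure.map_prod_map _ _ (by fun_prop) (by fun_prop), h1, h2,
    Measure.prod_smul_left, Measure.prod_smul_right, smul_smul, mul_inv,
    ENNReal.ofReal_mul (by positivity)]

/-- The affine parabolic change of variables as a homeomorphism. -/
noncomputable def affineHomeo (t : ℝ) (x : E) {τ δ : ℝ} (hτ : 0 < τ) (hδ : 0 < δ) :
    (ℝ × E) ≃ₜ (ℝ × E) where
  toFun z := (t + τ * z.1, x + δ • z.2)
  invFun z := (τ⁻¹ * (z.1 - t), δ⁻¹ • (z.2 - x))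
  left_inv z := by
    ext1
    · simp [hτ.ne']
    · simp [hδ.ne']
  right_inv z := by
    ext1
    · simp [hτ.ne']
    · simp [hδ.ne']
  continuous_toFun := by fun_prop
  continuous_invFun := by fun_prop

theorem integral_comp_affine {F : Type*} [NormedAddCommGroup F] [NormedSpace ℝ F] (f : ℝ × E → F)
    (t : ℝ) (x : E) {τ δ : ℝ} (hτ : 0 < τ) (hδ : 0 < δ) :
    ∫ z : ℝ × E, f (t + τ * z.1, x + δ • z.2) = (τ * δ ^ d)⁻¹ • ∫ z, f z := by
  have h := (affineHomeo t x hτ hδ).measurableEmbedding.integral_map (μ := volume) f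
  have h' : (affineHomeo t x hτ hδ : ℝ × E → ℝ × E) =
    fun z => (t + τ * z.1, x + δ • z.2) := rfl
  rw [h', map_affine_volume t x hτ hδ, integral_smul_measure,
    ENNReal.toReal_ofReal (by positivity)] at h
  exact h.symm

theorem setIntegral_comp_affine {F : Type*} [NormedAddCommGroup F] [NormedSpace ℝ F]
    (f : ℝ × E → F) (t : ℝ) (x : E) {τ δ : ℝ} (hτ : 0 < τ) (hδ : 0 < δ) {s : Set (ℝ × E)}
    (hs : MeasurableSet s) :
    ∫ z in (fun z : ℝ × E => (t + τ * z.1, x + δ • z.2)) ⁻¹' s, f (t + τ * z.1, x + δ • z.2) =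
      (τ * δ ^ d)⁻¹ • ∫ z in s, f z := by
  rw [← integral_indicator hs, ← integral_comp_affine _ t x hτ hδ, ← integral_indicator]
  · rfl
  · exact hs.preimage (by fun_prop)

end ConePaths

/-! ### Cones of paths and averages over their directions. -/

section Cones
open Filter Topology Metric

variable {d : ℕ}

local notation "E" => EuclideanSpace ℝ (Fin d)

/-- `c s + e` runs affinely through the unit interval, in one direction or the other, while `s` runs
through `[a, b]`. -/
def IsUnitParam (a b τ c e : ℝ) : Prop :=
  (c = τ⁻¹ ∧ c * a + e = 0 ∧ c * b + e = 1) ∨ (c = -τ⁻¹ ∧ c * a + e = 1 ∧ c * b + e = 0)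

theorem IsUnitParam.forward (t : ℝ) {τ : ℝ} (hτ : 0 < τ) :
    IsUnitParam t (t + τ) τ τ⁻¹ (-(τ⁻¹ * t)) := by
  refine Or.inl ⟨rfl, by ring, ?_⟩
  have := hτ.ne'
  field_simp; ring

theorem IsUnitParam.backward (t : ℝ) {τ : ℝ} (hτ : 0 < τ) :
    IsUnitParam (t - τ) t τ (-τ⁻¹) (τ⁻¹ * t) := by
  refine Or.inr ⟨rfl, ?_, by ring⟩
  have := hτ.ne'
  field_simp; ring

theorem IsUnitParam.abs_eq {a b τ c e : ℝ} (h : IsUnitParam a b τ c e) (hτ : 0 < τ) :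
    |c| = τ⁻¹ := by
  have : 0 < τ⁻¹ := by positivity
  rcases h with ⟨rfl, -, -⟩ | ⟨rfl, -, -⟩
  · exact abs_of_pos this
  · rw [abs_neg, abs_of_pos this]

theorem IsUnitParam.mem_Ioo {a b τ c e : ℝ} (h : IsUnitParam a b τ c e) (hτ : 0 < τ) {s : ℝ}
    (hs : s ∈ Ioo a b) : c * s + e ∈ Ioo (0 : ℝ) 1 := by
  have hpos : 0 < τ⁻¹ := by positivity
  rcases h with ⟨rfl, h1, h2⟩ | ⟨rfl, h1, h2⟩
  · have h3 := mul_lt_mul_of_pos_left hs.1 hpos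
    have h4 := mul_lt_mul_of_pos_left hs.2 hpos
    constructor <;> linarith
  · have h3 := mul_lt_mul_of_pos_left hs.1 hpos
    have h4 := mul_lt_mul_of_pos_left hs.2 hpos
    constructor <;> linarith

theorem IsUnitParam.mem_Icc {a b τ c e : ℝ} (h : IsUnitParam a b τ c e) (hτ : 0 < τ) {s : ℝ}
    (hs : s ∈ Icc a b) : c * s + e ∈ Icc (0 : ℝ) 1 := by
  have hpos : 0 < τ⁻¹ := by positivity
  rcases h with ⟨rfl, h1, h2⟩ | ⟨rfl, h1, h2⟩
  · have h3 := mul_le_mul_of_nonneg_left hs.1 hpos.le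
    have h4 := mul_le_mul_of_nonneg_left hs.2 hpos.le
    constructor <;> linarith
  · have h3 := mul_le_mul_of_nonneg_left hs.1 hpos.le
    have h4 := mul_le_mul_of_nonneg_left hs.2 hpos.le
    constructor <;> linarith

theorem IsUnitParam.integral_rpow {a b τ c e β : ℝ} (h : IsUnitParam a b τ c e) (hτ : 0 < τ)
    (hβ : -1 < β) :
    IntervalIntegrable (fun s => (c * s + e) ^ β) volume a b ∧
      ∫ s in a..b, (c * s + e) ^ β = τ / (β + 1) := by
  have hi : IntervalIntegrable (fun x : ℝ => x ^ β) volume (c * a + e) (c * b + e) :=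
    intervalIntegral.intervalIntegrable_rpow' hβ
  have hc : c ≠ 0 := by
    rw [← abs_pos, h.abs_eq hτ]; positivity
  constructor
  · have h1 : IntervalIntegrable (fun x : ℝ => (x + e) ^ β) volume (c * a) (c * b) := by
      simpa using hi.comp_add_right e
    have h2 := h1.comp_mul_left (c := c)
    simpa [hc] using h2
  · rw [intervalIntegral.integral_comp_mul_add (fun x => x ^ β) hc]
    have h01 : ∫ x in (0 : ℝ)..1, x ^ β = 1 / (β + 1) := by
      rw [_root_.integral_rpow (Or.inl hβ)]
      simp [Real.zero_rpow (show β + 1 ≠ 0 by linarith)]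
    rcases h with ⟨rfl, h1, h2⟩ | ⟨rfl, h1, h2⟩
    · rw [h1, h2, h01]; simp [div_eq_mul_inv]
    · rw [h1, h2, intervalIntegral.integral_symm, h01]
      simp [div_eq_mul_inv]

/-- The dynamic programming inequality along a path opening up (or closing) like a power. -/
theorem IsViscositySub.cone_le {p q C c₀ r Λ α : ℝ} (hq : 0 < q) (hc₀0 : 0 < c₀)
    (hc₀ : ∀ a b : ℝ, 0 ≤ a → 0 ≤ b → a * b ≤ 1 / C * a ^ p + c₀ * b ^ q)
    (hr : 1 < r) (hΛ : 0 < Λ) (hα : 0 < α) (hα₁ : -1 < (α - 1) * q)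
    (hα₂ : -1 < α * (-(d / (r - 1))))
    {g u : ℝ × E → ℝ} {Ω : Set (ℝ × E)} (hΩ : IsOpen Ω) (hu : ContinuousOn u Ω)
    (hg : ContinuousOn g Ω) (hg0 : ∀ z ∈ Ω, 0 ≤ g z) (hsub : IsViscositySub p C g Ω u)
    {a b τ c e δ : ℝ} (hτ : 0 < τ) (hδ : 0 < δ) (hab : a < b) (hce : IsUnitParam a b τ c e)
    {x v : E} (hv : ‖v‖ ≤ 1)
    (hbox : Icc a b ×ˢ closedBall x δ ⊆ Ω) :
    u (a, x + (δ * (c * a + e) ^ α) • v) ≤ u (b, x + (δ * (c * b + e) ^ α) • v) +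
      (c₀ * (α ^ q / ((α - 1) * q + 1)) * δ ^ q * τ ^ (1 - q) +
        Λ * δ ^ (-(d / (r - 1))) * (τ / (α * (-(d / (r - 1))) + 1))) +
      Λ ^ (1 - r) * ∫ s in a..b, (δ * (c * s + e) ^ α) ^ d *
        g (s, x + (δ * (c * s + e) ^ α) • v) ^ r := by
  have hc := hce.abs_eq hτ
  -- Both hypotheses on α express integrability at the tip: of the kinetic term, which requires α >
  -- 1/p, and of the negative power of the width, which requires α d < r - 1.
  obtain ⟨hi₁, he₁⟩ := hce.integral_rpow hτ hα₁
  obtain ⟨hi₂, he₂⟩ := hce.integral_rpow hτ hα₂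
  have hIoo : ∀ s ∈ Ioo a b, 0 < c * s + e := fun s hs => (hce.mem_Ioo hτ hs).1
  have hf₁ : EqOn (fun s => |δ * (α * c * (c * s + e) ^ (α - 1))| ^ q)
      (fun s => (δ * (α * τ⁻¹)) ^ q * (c * s + e) ^ ((α - 1) * q)) (Ioo a b) := by
    intro s hs
    have := hIoo s hs
    simp only [abs_mul, hc, abs_of_pos hδ, abs_of_pos hα]
    rw [abs_of_pos (by positivity), ← mul_assoc, Real.mul_rpow (by positivity) (by positivity),
      ← Real.rpow_mul this.le]
  have hf₂ : EqOn (fun s => (δ * (c * s + e) ^ α) ^ (-(d / (r - 1))))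
      (fun s => δ ^ (-(d / (r - 1))) * (c * s + e) ^ (α * (-(d / (r - 1))))) (Ioo a b) := by
    intro s hs
    have := hIoo s hs
    simp only
    rw [Real.mul_rpow (by positivity) (by positivity), ← Real.rpow_mul this.le]
  have hae : ∀ {f₁ f₂ : ℝ → ℝ}, EqOn f₁ f₂ (Ioo a b) → IntervalIntegrable f₂ volume a b →
      IntervalIntegrable f₁ volume a b ∧ ∫ s in a..b, f₁ s = ∫ s in a..b, f₂ s := by
    intro f₁ f₂ h h2
    rw [intervalIntegrable_iff_integrableOn_Ioo_of_le hab.le] at h2 ⊢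
    refine ⟨h2.congr_fun h.symm measurableSet_Ioo, ?_⟩
    rw [intervalIntegral.integral_of_le hab.le, intervalIntegral.integral_of_le hab.le,
      integral_Ioc_eq_integral_Ioo, integral_Ioc_eq_integral_Ioo]
    exact setIntegral_congr_fun measurableSet_Ioo h
  obtain ⟨hi₁', he₁'⟩ := hae hf₁ (hi₁.const_mul _)
  obtain ⟨hi₂', he₂'⟩ := hae hf₂ (hi₂.const_mul _)
  have hlin : ∀ s, HasDerivAt (fun s => c * s + e) c s := fun s => by
    simpa using ((hasDerivAt_id s).const_mul c).add_const e
  have h := hsub.path_width_le (w := fun s => δ * (c * s + e) ^ α)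
    (w' := fun s => δ * (α * c * (c * s + e) ^ (α - 1))) (x := x)
    hq hc₀0 hc₀ hr hΛ hΩ hu hg hg0 hab hv ?_ ?_ ?_ ?_ ?_ ?_ hi₁' hi₂'
  · rw [he₁', he₂', intervalIntegral.integral_const_mul, intervalIntegral.integral_const_mul,
      he₁, he₂] at h
    convert h using 4
    · rw [Real.mul_rpow hδ.le (by positivity), Real.mul_rpow hα.le (by positivity),
        Real.rpow_sub hτ, Real.rpow_one, Real.inv_rpow hτ.le]
      field_simp
    · ring
  · refine continuousOn_const.mul (ContinuousOn.rpow_const (by fun_prop) ?_)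
    intro s hs; right; exact hα.le
  · intro s hs
    have := hIoo s hs
    positivity
  · intro s hs
    have hl : ContDiffAt ℝ 1 (fun s => c * s + e) s := by fun_prop
    exact contDiffAt_const.mul (hl.rpow_const_of_ne (hIoo s hs).ne')
  · intro s hs
    have := ((hlin s).rpow_const (p := α) (Or.inl (hIoo s hs).ne')).const_mul δ
    exact this.congr_deriv (by ring)
  · refine continuousOn_const.mul (continuousOn_const.mul (ContinuousOn.rpow_const (by fun_prop) ?_))
    intro s hs; left; exact (hIoo s hs).ne'
  · intro s hs
    refine hbox ⟨hs, ?_⟩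
    have h1 := hce.mem_Icc hτ hs
    have h2 : (c * s + e) ^ α ≤ 1 := Real.rpow_le_one h1.1 h1.2 hα.le
    have h3 : 0 ≤ (c * s + e) ^ α := Real.rpow_nonneg h1.1 _
    simp only [mem_closedBall, dist_self_add_left, norm_smul, norm_mul, Real.norm_eq_abs,
      abs_of_pos hδ, abs_of_nonneg h3]
    calc δ * (c * s + e) ^ α * ‖v‖ ≤ δ * 1 * 1 := by gcongr
      _ = δ := by ring

/-- The dynamic programming inequality for a resting path. -/
theorem IsViscositySub.static_le {p q C c₀ r Λ : ℝ} (hq : 0 < q) (hc₀0 : 0 < c₀)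
    (hc₀ : ∀ a b : ℝ, 0 ≤ a → 0 ≤ b → a * b ≤ 1 / C * a ^ p + c₀ * b ^ q)
    (hr : 1 < r) (hΛ : 0 < Λ)
    {g u : ℝ × E → ℝ} {Ω : Set (ℝ × E)} (hΩ : IsOpen Ω) (hu : ContinuousOn u Ω)
    (hg : ContinuousOn g Ω) (hg0 : ∀ z ∈ Ω, 0 ≤ g z) (hsub : IsViscositySub p C g Ω u)
    {a b a' b' δ : ℝ} (hδ : 0 < δ) (hab : a ≤ b) (haa : a' ≤ a) (hbb : b ≤ b')
    {x v : E} (hv : ‖v‖ ≤ 1) (hbox : Icc a' b' ×ˢ closedBall x δ ⊆ Ω) :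
    u (a, x + δ • v) ≤ u (b, x + δ • v) + Λ * δ ^ (-(d / (r - 1))) * (b' - a') +
      Λ ^ (1 - r) * ∫ s in a'..b', δ ^ d * g (s, x + δ • v) ^ r := by
  have hmem : ∀ s ∈ Icc a' b', (s, x + δ • v) ∈ Ω := by
    intro s hs
    refine hbox ⟨hs, ?_⟩
    simp only [mem_closedBall, dist_self_add_left, norm_smul, Real.norm_eq_abs, abs_of_pos hδ]
    exact mul_le_of_le_one_right hδ.le hv
  have hcont : ContinuousOn (fun s => δ ^ d * g (s, x + δ • v) ^ r) (Icc a' b') := by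
    refine continuousOn_const.mul ((hg.comp (by fun_prop) hmem).rpow_const ?_)
    intro s hs; right; linarith
  have hnn : ∀ s ∈ Icc a' b', 0 ≤ δ ^ d * g (s, x + δ • v) ^ r := fun s hs =>
    mul_nonneg (by positivity) (Real.rpow_nonneg (hg0 _ (hmem s hs)) _)
  have hab' : a' ≤ b' := haa.trans (hab.trans hbb)
  -- Enlarging the window to [a', b'] makes the source term independent of the times at which the
  -- resting path starts and stops.
  have hmono : ∫ s in a..b, δ ^ d * g (s, x + δ • v) ^ r ≤
      ∫ s in a'..b', δ ^ d * g (s, x + δ • v) ^ r := by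
    refine intervalIntegral.integral_mono_interval haa hab hbb ?_ ?_
    · filter_upwards [ae_restrict_mem measurableSet_Ioc] with s hs
      exact hnn s (Ioc_subset_Icc_self hs)
    · apply ContinuousOn.intervalIntegrable; rwa [uIcc_of_le hab']
  have h5 : 0 ≤ Λ ^ (1 - r) := by positivity
  have h6 : 0 ≤ Λ * δ ^ (-((d : ℝ) / (r - 1))) := by positivity
  rcases hab.eq_or_lt with rfl | hlt
  · have h1 : 0 ≤ ∫ s in a'..b', δ ^ d * g (s, x + δ • v) ^ r :=
      intervalIntegral.integral_nonneg hab' hnn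
    have h2 := mul_nonneg h6 (sub_nonneg.2 hab')
    have h3 := mul_nonneg h5 h1
    linarith
  · have h := hsub.path_width_le (w := fun _ => δ) (w' := fun _ => 0) (x := x) (a := a) (b := b)
      (v := v) hq hc₀0 hc₀ hr hΛ hΩ hu hg hg0 hlt hv continuousOn_const (fun _ _ => hδ)
      (fun _ _ => contDiffAt_const) (fun s _ => hasDerivAt_const s δ) continuousOn_const
      (fun s hs => hmem s ⟨haa.trans hs.1, hs.2.trans hbb⟩) (by simp) (by simp)
    simp only [abs_zero, Real.zero_rpow hq.ne', intervalIntegral.integral_const, smul_eq_mul,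
      mul_zero, zero_add] at h
    have h7 : Λ * ((b - a) * δ ^ (-((d : ℝ) / (r - 1)))) ≤
        Λ * δ ^ (-((d : ℝ) / (r - 1))) * (b' - a') := by
      rw [mul_assoc, mul_comm (b - a)]
      rw [← mul_assoc, ← mul_assoc]
      gcongr
    have h8 := mul_le_mul_of_nonneg_left hmono h5
    linarith

/-- Averages over the directions of the path are controlled by the full integral. -/
theorem integral_width_le [NeZero d] {h : ℝ × E → ℝ} {Ω : Set (ℝ × E)} (hΩ : IsOpen Ω)
    (hh : ContinuousOn h Ω) (hh0 : ∀ z ∈ Ω, 0 ≤ h z) (hhi : IntegrableOn h Ω)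
    {a b δ : ℝ} (hab : a ≤ b) {w : ℝ → ℝ} (hw : ContinuousOn w (Icc a b))
    (hw0 : ∀ s ∈ Icc a b, 0 ≤ w s) (hwδ : ∀ s ∈ Icc a b, w s ≤ δ) {x : E}
    (hbox : Icc a b ×ˢ closedBall x δ ⊆ Ω) :
    IntegrableOn (fun v : E => ∫ s in a..b, w s ^ d * h (s, x + w s • v)) (closedBall 0 1) ∧
      ∫ v in closedBall (0 : E) 1, (∫ s in a..b, w s ^ d * h (s, x + w s • v)) ≤
        ∫ z in Ω, h z := by
  have hmem : ∀ s ∈ Icc a b, ∀ v ∈ closedBall (0 : E) 1, (s, x + w s • v) ∈ Ω := by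
    intro s hs v hv
    refine hbox ⟨hs, ?_⟩
    have hv' : ‖v‖ ≤ 1 := by simpa using hv
    simp only [mem_closedBall, dist_self_add_left, norm_smul, Real.norm_eq_abs,
      abs_of_nonneg (hw0 s hs)]
    exact (mul_le_of_le_one_right (hw0 s hs) hv').trans (hwδ s hs)
  have hcont : ContinuousOn (fun z : E × ℝ => w z.2 ^ d * h (z.2, x + w z.2 • z.1))
      (closedBall (0 : E) 1 ×ˢ Icc a b) := by
    have hw2 : ContinuousOn (fun z : E × ℝ => w z.2) (closedBall (0 : E) 1 ×ˢ Icc a b) :=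
      hw.comp continuousOn_snd fun z hz => hz.2
    refine (hw2.pow d).mul (hh.comp (continuousOn_snd.prodMk (continuousOn_const.add
      (hw2.smul continuousOn_fst))) ?_)
    intro z hz
    exact hmem z.2 hz.2 z.1 hz.1
  have hint : Integrable (fun z : E × ℝ => w z.2 ^ d * h (z.2, x + w z.2 • z.1))
      ((volume.restrict (closedBall (0 : E) 1)).prod (volume.restrict (Icc a b))) := by
    rw [Measure.prod_restrict]
    exact hcont.integrableOn_compact ((isCompact_closedBall _ _).prod isCompact_Icc)
  have heq : ∀ v : E, ∫ s in a..b, w s ^ d * h (s, x + w s • v) =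
      ∫ s in Icc a b, w s ^ d * h (s, x + w s • v) := fun v => by
    rw [intervalIntegral.integral_of_le hab, integral_Icc_eq_integral_Ioc]
  simp only [heq]
  refine ⟨hint.integral_prod_left, ?_⟩
  rw [integral_integral_swap hint]
  set H : ℝ × E → ℝ := Ω.indicator h with hH
  have hHi : Integrable H := hhi.integrable_indicator hΩ.measurableSet
  have hH0 : ∀ z, 0 ≤ H z := fun z => indicator_nonneg hh0 z
  have hHi' : Integrable H ((volume : Measure ℝ).prod (volume : Measure E)) := hHi
  -- After exchanging the integrals, each time slice is a substitution y = x + w v whose Jacobian is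
  -- cancelled by w^d. At a tip, where w = 0, the factor w^d vanishes because d is nonzero.
  have hslice : ∀ s ∈ Icc a b, Integrable (fun y => H (s, y)) volume →
      ∫ v in closedBall (0 : E) 1, w s ^ d * h (s, x + w s • v) ≤ ∫ y, H (s, y) := by
    intro s hs hsi
    rcases (hw0 s hs).eq_or_lt with h0 | hpos
    · rw [← h0]
      simp only [zero_pow (NeZero.ne d), zero_mul, integral_zero]
      exact integral_nonneg fun y => hH0 _
    · have hcomp : Integrable (fun v : E => H (s, x + w s • v)) :=
        ((hsi.comp_add_left x).comp_smul hpos.ne')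
      have e1 : ∫ v in closedBall (0 : E) 1, w s ^ d * h (s, x + w s • v) =
          ∫ v in closedBall (0 : E) 1, w s ^ d * H (s, x + w s • v) := by
        refine setIntegral_congr_fun measurableSet_closedBall fun v hv => ?_
        simp only [hH, indicator_of_mem (hmem s hs v hv)]
      rw [e1]
      calc ∫ v in closedBall (0 : E) 1, w s ^ d * H (s, x + w s • v)
          ≤ ∫ v, w s ^ d * H (s, x + w s • v) :=
            setIntegral_le_integral (hcomp.const_mul _)
              (Eventually.of_forall fun v => mul_nonneg (by positivity) (hH0 _))
        _ = ∫ y, H (s, y) := by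
            rw [integral_const_mul]
            have := Measure.integral_comp_smul (volume : Measure E) (fun y => H (s, x + y)) (w s)
            rw [this, abs_of_pos (by positivity), finrank_euclideanSpace_fin, smul_eq_mul,
              ← mul_assoc, mul_inv_cancel₀ (by positivity), one_mul]
            exact integral_add_left_eq_self (fun y => H (s, y)) x
  calc ∫ s in Icc a b, ∫ v in closedBall (0 : E) 1, w s ^ d * h (s, x + w s • v)
      ≤ ∫ s in Icc a b, ∫ y, H (s, y) := by
        refine integral_mono_ae hint.integral_prod_right hHi'.integral_prod_left.integrableOn ?_
        filter_upwards [ae_restrict_mem measurableSet_Icc,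
          ae_restrict_of_ae hHi'.prod_right_ae] with s hs hs'
        exact hslice s hs hs'
    _ ≤ ∫ s, ∫ y, H (s, y) :=
        setIntegral_le_integral hHi'.integral_prod_left
          (Eventually.of_forall fun s => integral_nonneg fun y => hH0 _)
    _ = ∫ z, H z := (integral_prod H hHi').symm
    _ = ∫ z in Ω, h z := integral_indicator hΩ.measurableSet

end Cones

/-! ### Weak gradients and translates of averages. -/

section WeakGradient
open Filter Topology Metric

variable {d : ℕ}

local notation "E" => EuclideanSpace ℝ (Fin d)

theorem inner_spaceGrad {φ : ℝ × E → ℝ} {z : ℝ × E} (h : DifferentiableAt ℝ φ z) (e : E) :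
    inner ℝ (spaceGrad φ z) e = fderiv ℝ φ z (0, e) := by
  have h1 : HasFDerivAt (fun x : E => (z.1, x)) (ContinuousLinearMap.inr ℝ ℝ E) z.2 :=
    hasFDerivAt_prodMk_right z.1 z.2
  have h2 : HasFDerivAt (fun x : E => φ (z.1, x))
      ((fderiv ℝ φ z).comp (ContinuousLinearMap.inr ℝ ℝ E)) z.2 :=
    HasFDerivAt.comp z.2 (g := φ) (f := fun x : E => (z.1, x)) h.hasFDerivAt h1
  simp [spaceGrad, gradient, h2.fderiv]

theorem timeDeriv_eq_fderiv {φ : ℝ × E → ℝ} {z : ℝ × E} (h : DifferentiableAt ℝ φ z) :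
    timeDeriv φ z = fderiv ℝ φ z (1, 0) := by
  have h1 : HasDerivAt (fun t : ℝ => (t, z.2)) ((1 : ℝ), (0 : E)) z.1 :=
    (hasDerivAt_id z.1).prodMk (hasDerivAt_const z.1 z.2)
  exact (h.hasFDerivAt.comp_hasDerivAt z.1 h1).deriv

theorem spaceGrad_apply {φ : ℝ × E → ℝ} {z : ℝ × E} (h : DifferentiableAt ℝ φ z) (i : Fin d) :
    spaceGrad φ z i = fderiv ℝ φ z (0, EuclideanSpace.single i 1) := by
  rw [← inner_spaceGrad h]; simp [EuclideanSpace.inner_single_right]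

/-- Multiplying by a function supported in `Ω` makes a function continuous in `Ω` globally
continuous. -/
theorem ContinuousOn.continuous_mul_of_tsupport_subset {X : Type*} [TopologicalSpace X]
    {Ω : Set X} (hΩ : IsOpen Ω) {u φ : X → ℝ} (hu : ContinuousOn u Ω) (hφ : Continuous φ)
    (hφΩ : tsupport φ ⊆ Ω) : Continuous fun z => u z * φ z := by
  rw [continuous_iff_continuousAt]
  intro z
  by_cases hz : z ∈ Ω
  · exact (hu.continuousAt (hΩ.mem_nhds hz)).mul hφ.continuousAt
  · have hz' : z ∈ (tsupport φ)ᶜ := fun h => hz (hφΩ h)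
    have : (fun z => u z * φ z) =ᶠ[𝓝 z] fun _ => 0 := by
      filter_upwards [(isClosed_tsupport φ).isOpen_compl.mem_nhds hz'] with y hy
      simp [image_eq_zero_of_notMem_tsupport hy]
    exact continuousAt_const.congr this.symm

theorem ContinuousOn.integrable_mul_of_tsupport_subset {Ω : Set (ℝ × E)} (hΩ : IsOpen Ω)
    {u φ : ℝ × E → ℝ} (hu : ContinuousOn u Ω) (hφ : Continuous φ) (hφc : HasCompactSupport φ)
    (hφΩ : tsupport φ ⊆ Ω) : Integrable fun z => u z * φ z :=
  (hu.continuous_mul_of_tsupport_subset hΩ hφ hφΩ).integrable_of_hasCompactSupport hφc.mul_left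

theorem setIntegral_eq_integral_of_tsupport_subset {Ω : Set (ℝ × E)} {φ : ℝ × E → ℝ}
    (u : ℝ × E → ℝ) (hφΩ : tsupport φ ⊆ Ω) : ∫ z in Ω, u z * φ z = ∫ z, u z * φ z := by
  refine setIntegral_eq_integral_of_forall_compl_eq_zero fun z hz => ?_
  rw [image_eq_zero_of_notMem_tsupport fun h => hz (hφΩ h), mul_zero]

theorem _root_.MeasureTheory.LocallyIntegrableOn.integrable_mul_of_tsupport_subset {Ω : Set (ℝ × E)}
    {u φ : ℝ × E → ℝ} (hu : LocallyIntegrableOn u Ω) (hφ : Continuous φ)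
    (hφc : HasCompactSupport φ) (hφΩ : tsupport φ ⊆ Ω) : Integrable fun z => u z * φ z := by
  have h1 : IntegrableOn u (tsupport φ) := hu.integrableOn_compact_subset hφΩ hφc
  have h2 : IntegrableOn (fun z => u z * φ z) (tsupport φ) :=
    h1.mul_continuousOn hφ.continuousOn hφc
  rwa [integrableOn_iff_integrable_of_support_subset] at h2
  intro z hz
  by_contra hcon
  exact hz (by simp [image_eq_zero_of_notMem_tsupport hcon])

/-- The coordinate identities in the definition combine linearly into one for an arbitrary direction
e. -/
theorem IsWeakSpaceGrad.integral_fderiv_eq {Ω : Set (ℝ × E)} (hΩ : IsOpen Ω) {u : ℝ × E → ℝ}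
    (hu : ContinuousOn u Ω) {G : ℝ × E → E} (hG : IsWeakSpaceGrad Ω u G) {φ : ℝ × E → ℝ}
    (hφ : ContDiff ℝ ∞ φ) (hφc : HasCompactSupport φ) (hφΩ : tsupport φ ⊆ Ω) (e : E) :
    ∫ z in Ω, u z * fderiv ℝ φ z (0, e) = -∫ z in Ω, inner ℝ (G z) e * φ z := by
  have hdiff : Differentiable ℝ φ := hφ.differentiable (by simp)
  have hGi : ∀ i, LocallyIntegrableOn (fun z => G z i) Ω := fun i =>
    fun z hz => by
      obtain ⟨s, hs, hs'⟩ := hG.1 z hz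
      exact ⟨s, hs, (EuclideanSpace.proj (𝕜 := ℝ) i).integrable_comp hs'⟩
  have hcont : ∀ i, Continuous fun z => spaceGrad φ z i := by
    intro i
    simp only [fun z => spaceGrad_apply (hdiff z) i]
    exact (hφ.continuous_fderiv (by simp)).clm_apply continuous_const
  have hsupp : ∀ i, tsupport (fun z => spaceGrad φ z i) ⊆ tsupport φ := by
    intro i
    simp only [fun z => spaceGrad_apply (hdiff z) i]
    exact tsupport_fderiv_apply_subset ℝ _
  have h1 : ∀ z, u z * fderiv ℝ φ z (0, e) = ∑ i, e i * (u z * spaceGrad φ z i) := by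
    intro z
    rw [← inner_spaceGrad (hdiff z), PiLp.inner_apply, Finset.mul_sum]
    refine Finset.sum_congr rfl fun i _ => ?_
    simp; ring
  have h2 : ∀ z, inner ℝ (G z) e * φ z = ∑ i, e i * (G z i * φ z) := by
    intro z
    rw [PiLp.inner_apply, Finset.sum_mul]
    refine Finset.sum_congr rfl fun i _ => ?_
    simp; ring
  simp only [h1, h2]
  rw [integral_finsetSum, integral_finsetSum, ← Finset.sum_neg_distrib]
  · refine Finset.sum_congr rfl fun i _ => ?_
    rw [integral_const_mul, integral_const_mul, hG.2 φ hφ hφc hφΩ i]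
    ring
  · intro i _
    exact (((hGi i).integrable_mul_of_tsupport_subset hφ.continuous hφc hφΩ).const_mul _).integrableOn
  · intro i _
    refine ((hu.integrable_mul_of_tsupport_subset hΩ (hcont i) ?_ ((hsupp i).trans hφΩ)).const_mul
      _).integrableOn
    exact hφc.of_isClosed_subset (isClosed_tsupport _) (hsupp i)

/-- Spatial translates of smooth averages of `u` differ by at most the integral of the gradient. -/
theorem IsWeakSpaceGrad.abs_average_sub_le {Ω : Set (ℝ × E)} (hΩ : IsOpen Ω) {u : ℝ × E → ℝ}
    (hu : ContinuousOn u Ω) {G : ℝ × E → E} (hG : IsWeakSpaceGrad Ω u G) {Ψ : ℝ × E → ℝ}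
    (hΨ : ContDiff ℝ ∞ Ψ) (hΨc : HasCompactSupport Ψ) {M : ℝ} (hM : ∀ z, |Ψ z| ≤ M)
    {t τ δ : ℝ} (hτ : 0 < τ) (hδ : 0 < δ) {x y : E} {K : Set (ℝ × E)} (hK : IsCompact K)
    (hKΩ : K ⊆ Ω) (hKmem : ∀ ϑ ∈ Icc (0 : ℝ) 1, ∀ z ∈ tsupport Ψ,
      (t + τ * z.1, (x + ϑ • (y - x)) + δ • z.2) ∈ K) :
    |(∫ z : ℝ × E, u (t + τ * z.1, y + δ • z.2) * Ψ z) -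
      ∫ z : ℝ × E, u (t + τ * z.1, x + δ • z.2) * Ψ z| ≤
      (τ * δ ^ d)⁻¹ * (‖y - x‖ * M * ∫ z in K, ‖G z‖) := by
  have hM0 : 0 ≤ M := (abs_nonneg _).trans (hM 0)
  -- The base point moves along the segment from x to y. A change of variables transfers the
  -- translation to the kernel, giving φ ϑ. The derivative in ϑ of ∫ u φ ϑ is then ∫ ⟨G, y - x⟩ φ ϑ
  -- by the definition of G, and the mean value theorem finishes.
  set xx : ℝ → E := fun ϑ => x + ϑ • (y - x) with hxx
  set A : ℝ → ℝ × E → ℝ × E := fun ϑ z => (τ⁻¹ * (z.1 - t), δ⁻¹ • (z.2 - xx ϑ)) with hA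
  set φ : ℝ → ℝ × E → ℝ := fun ϑ z => Ψ (A ϑ z) with hφ
  have hAC : ∀ ϑ, ContDiff ℝ ∞ (A ϑ) := fun ϑ => by
    simp only [hA]; fun_prop
  have hφC : ∀ ϑ, ContDiff ℝ ∞ (φ ϑ) := fun ϑ => hΨ.comp (hAC ϑ)
  have hdiff : ∀ ϑ, Differentiable ℝ (φ ϑ) := fun ϑ => (hφC ϑ).differentiable (by simp)
  have hsub : ∀ ϑ ∈ Icc (0 : ℝ) 1, tsupport (φ ϑ) ⊆ K := by
    intro ϑ hϑ
    refine closure_minimal ?_ hK.isClosed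
    intro z hz
    have hz' : A ϑ z ∈ tsupport Ψ := subset_tsupport _ hz
    have := hKmem ϑ hϑ _ hz'
    simp only [hA] at this
    rw [smul_smul, mul_inv_cancel₀ hδ.ne', ← mul_assoc, mul_inv_cancel₀ hτ.ne'] at this
    simpa [hxx] using this
  have hφc : ∀ ϑ ∈ Icc (0 : ℝ) 1, HasCompactSupport (φ ϑ) := fun ϑ hϑ =>
    hK.of_isClosed_subset (isClosed_tsupport _) (hsub ϑ hϑ)
  have hφΩ : ∀ ϑ ∈ Icc (0 : ℝ) 1, tsupport (φ ϑ) ⊆ Ω := fun ϑ hϑ => (hsub ϑ hϑ).trans hKΩ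
  -- the derivative in the translation parameter
  have hAd : ∀ ϑ z, HasDerivAt (fun ϑ => A ϑ z) ((0 : ℝ), -(δ⁻¹ • (y - x))) ϑ := by
    intro ϑ z
    refine (hasDerivAt_const _ _).prodMk ?_
    have h1 : HasDerivAt xx (y - x) ϑ := by
      have h0 := ((hasDerivAt_id ϑ).smul_const (y - x)).const_add x
      rw [one_smul] at h0
      exact h0
    have := (h1.const_sub z.2).const_smul δ⁻¹
    rw [smul_neg] at this
    exact this
  have hΨd : Differentiable ℝ Ψ := hΨ.differentiable (by simp)
  have hφd : ∀ ϑ z, HasDerivAt (fun ϑ => φ ϑ z) (-fderiv ℝ (φ ϑ) z (0, y - x)) ϑ := by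
    intro ϑ z
    have h1 := (hΨd (A ϑ z)).hasFDerivAt.comp_hasDerivAt ϑ (hAd ϑ z)
    have h2 : HasFDerivAt (A ϑ) (((τ⁻¹ • ContinuousLinearMap.fst ℝ ℝ E)).prod
        (δ⁻¹ • ContinuousLinearMap.snd ℝ ℝ E)) z :=
      ((hasFDerivAt_fst.sub_const t).const_mul τ⁻¹).prodMk
        ((hasFDerivAt_snd.sub_const (xx ϑ)).const_smul δ⁻¹)
    have h3 := (hΨd (A ϑ z)).hasFDerivAt.comp z h2
    have h4 : fderiv ℝ (φ ϑ) z (0, y - x) = fderiv ℝ Ψ (A ϑ z) ((0 : ℝ), δ⁻¹ • (y - x)) := by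
      rw [show fderiv ℝ (φ ϑ) z = _ from h3.fderiv]
      simp
    rw [h4, ← map_neg, Prod.neg_mk, neg_zero]
    exact h1
  -- domination
  obtain ⟨M', hM'⟩ := (hΨ.continuous_fderiv (by simp)).bounded_above_of_compact_support
    (hΨc.fderiv (𝕜 := ℝ))
  obtain ⟨B, hB⟩ := hK.exists_bound_of_continuousOn (hu.mono hKΩ)
  have hM'0 : 0 ≤ M' := (norm_nonneg _).trans (hM' 0)
  have hfd : ∀ ϑ z, ‖fderiv ℝ (φ ϑ) z (0, y - x)‖ ≤ M' * ‖δ⁻¹ • (y - x)‖ := by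
    intro ϑ z
    have h2 : HasFDerivAt (A ϑ) (((τ⁻¹ • ContinuousLinearMap.fst ℝ ℝ E)).prod
        (δ⁻¹ • ContinuousLinearMap.snd ℝ ℝ E)) z :=
      ((hasFDerivAt_fst.sub_const t).const_mul τ⁻¹).prodMk
        ((hasFDerivAt_snd.sub_const (xx ϑ)).const_smul δ⁻¹)
    have h3 := (hΨd (A ϑ z)).hasFDerivAt.comp z h2
    rw [show fderiv ℝ (φ ϑ) z = _ from h3.fderiv]
    simp only [ContinuousLinearMap.comp_apply, ContinuousLinearMap.prod_apply]
    refine (ContinuousLinearMap.le_opNorm _ _).trans ?_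
    gcongr
    · exact hM' _
    · simp [Prod.norm_def]
  set D : ℝ → ℝ := fun ϑ => ∫ z in Ω, u z * φ ϑ z with hD
  have hDd : ∀ ϑ ∈ Ioo (0 : ℝ) 1, HasDerivAt D
      (∫ z in Ω, inner ℝ (G z) (y - x) * φ ϑ z) ϑ := by
    intro ϑ hϑ
    have hϑ' := Ioo_subset_Icc_self hϑ
    have hfc : Continuous fun z => fderiv ℝ (φ ϑ) z (0, y - x) :=
      ((hφC ϑ).continuous_fderiv (by simp)).clm_apply continuous_const
    have h := (hasDerivAt_integral_of_dominated_loc_of_deriv_le (μ := volume.restrict Ω)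
      (F := fun ϑ z => u z * φ ϑ z)
      (F' := fun ϑ z => u z * (-fderiv ℝ (φ ϑ) z (0, y - x)))
      (bound := K.indicator fun _ => B * (M' * ‖δ⁻¹ • (y - x)‖))
      (isOpen_Ioo.mem_nhds hϑ) ?_ ?_ ?_ ?_ ?_ ?_).2
    · rw [← neg_neg (∫ z in Ω, inner ℝ (G z) (y - x) * φ ϑ z),
        ← hG.integral_fderiv_eq hΩ hu (hφC ϑ) (hφc ϑ hϑ') (hφΩ ϑ hϑ'), ← integral_neg]
      simpa only [mul_neg] using h
    · filter_upwards with ϑ'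
      exact (hu.aestronglyMeasurable hΩ.measurableSet).mul
        (hφC ϑ').continuous.aestronglyMeasurable
    · exact (hu.integrable_mul_of_tsupport_subset hΩ (hφC ϑ).continuous (hφc ϑ hϑ')
        (hφΩ ϑ hϑ')).integrableOn
    · exact (hu.aestronglyMeasurable hΩ.measurableSet).mul hfc.neg.aestronglyMeasurable
    · refine Eventually.of_forall fun z ϑ' hϑ' => ?_
      by_cases hz : z ∈ K
      · rw [indicator_of_mem hz, norm_mul, norm_neg]
        have := hB z hz
        have := hfd ϑ' z
        have : 0 ≤ B := (norm_nonneg _).trans (hB z hz)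
        gcongr
      · have : z ∉ tsupport fun z => fderiv ℝ (φ ϑ') z (0, y - x) := fun h =>
          hz (hsub ϑ' (Ioo_subset_Icc_self hϑ') (tsupport_fderiv_apply_subset ℝ _ h))
        rw [indicator_of_notMem hz]
        have h0 := image_eq_zero_of_notMem_tsupport this
        rw [h0]; simp
    · exact ((integrable_indicator_iff hK.measurableSet).2
        (integrableOn_const hK.measure_lt_top.ne)).integrableOn
    · exact Eventually.of_forall fun z ϑ' _ => (hφd ϑ' z).const_mul (u z)
  have hDc : ContinuousOn D (Icc 0 1) := by
    refine continuousOn_of_dominated (bound := K.indicator fun _ => B * M) ?_ ?_ ?_ ?_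
    · intro ϑ _
      exact (hu.aestronglyMeasurable hΩ.measurableSet).mul
        (hφC ϑ).continuous.aestronglyMeasurable
    · intro ϑ hϑ
      refine Eventually.of_forall fun z => ?_
      by_cases hz : z ∈ K
      · rw [indicator_of_mem hz, norm_mul]
        have := hB z hz
        have : 0 ≤ B := (norm_nonneg _).trans (hB z hz)
        have : ‖φ ϑ z‖ ≤ M := hM _
        gcongr
      · rw [indicator_of_notMem hz, image_eq_zero_of_notMem_tsupport fun h => hz (hsub ϑ hϑ h)]
        simp
    · exact ((integrable_indicator_iff hK.measurableSet).2
        (integrableOn_const hK.measure_lt_top.ne)).integrableOn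
    · exact Eventually.of_forall fun z => continuousOn_const.mul
        fun ϑ _ => (hφd ϑ z).continuousAt.continuousWithinAt
  have hbound : ∀ ϑ ∈ Icc (0 : ℝ) 1, |∫ z in Ω, inner ℝ (G z) (y - x) * φ ϑ z| ≤
      ‖y - x‖ * M * ∫ z in K, ‖G z‖ := by
    intro ϑ hϑ
    have hGK : IntegrableOn G K := hG.1.integrableOn_compact_subset hKΩ hK
    rw [setIntegral_eq_of_subset_of_forall_sdiff_eq_zero hΩ.measurableSet hKΩ
      fun z hz => by rw [image_eq_zero_of_notMem_tsupport fun h => hz.2 (hsub ϑ hϑ h), mul_zero],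
      ← Real.norm_eq_abs, ← integral_const_mul]
    refine norm_integral_le_of_norm_le (hGK.norm.const_mul _) (Eventually.of_forall fun z => ?_)
    rw [norm_mul]
    calc ‖inner ℝ (G z) (y - x)‖ * ‖φ ϑ z‖ ≤ (‖G z‖ * ‖y - x‖) * M := by
          gcongr
          · exact norm_inner_le_norm _ _
          · exact hM _
      _ = _ := by ring
  obtain ⟨ϑ, hϑ, hslope⟩ := exists_hasDerivAt_eq_slope D _ one_pos hDc hDd
  have hD01 : |D 1 - D 0| ≤ ‖y - x‖ * M * ∫ z in K, ‖G z‖ := by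
    have := hbound ϑ (Ioo_subset_Icc_self hϑ)
    rwa [hslope, sub_zero, div_one] at this
  have hDeq : ∀ ϑ ∈ Icc (0 : ℝ) 1, ∫ z : ℝ × E, u (t + τ * z.1, xx ϑ + δ • z.2) * Ψ z =
      (τ * δ ^ d)⁻¹ * D ϑ := by
    intro ϑ hϑ
    have h := integral_comp_affine (fun z => u z * φ ϑ z) t (xx ϑ) hτ hδ
    simp only [hD, setIntegral_eq_integral_of_tsupport_subset u (hφΩ ϑ hϑ)]
    rw [smul_eq_mul] at h
    rw [← h]
    refine integral_congr_ae (Eventually.of_forall fun z => ?_)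
    simp [hφ, hA, hτ.ne', hδ.ne']
  have e1 := hDeq 1 (by simp)
  have e0 := hDeq 0 (by simp)
  simp only [hxx, one_smul, add_sub_cancel, zero_smul, add_zero] at e1 e0
  rw [e1, e0, ← mul_sub, abs_mul, abs_of_pos (by positivity)]
  gcongr

end WeakGradient

/-! ### Comparing an earlier value with a later one at another point. -/

section TimeShift
open Filter Topology Metric

variable {d : ℕ}

local notation "E" => EuclideanSpace ℝ (Fin d)

/-- Times in [1, 2] correspond, after rescaling, to the middle third of [t, t + 3τ], in which both
fans of paths rest at full width. The kernel averages over the switching time and the direction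
together. -/
theorem exists_average_kernel (d : ℕ) : ∃ (Ψ : ℝ × EuclideanSpace ℝ (Fin d) → ℝ) (M : ℝ),
    ContDiff ℝ ∞ Ψ ∧ HasCompactSupport Ψ ∧ (∀ z, 0 ≤ Ψ z) ∧ (∀ z, Ψ z ≤ M) ∧ ∫ z, Ψ z = 1 ∧
      tsupport Ψ ⊆ Icc 1 2 ×ˢ closedBall 0 (1 / 2) := by
  let b : ContDiffBump ((3 / 2, 0) : ℝ × EuclideanSpace ℝ (Fin d)) :=
    ⟨1 / 4, 1 / 2, by norm_num, by norm_num⟩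
  have hcont : Continuous (b.normed volume) := b.continuous_normed
  have hc : HasCompactSupport (b.normed volume) := b.hasCompactSupport_normed
  obtain ⟨M, hM⟩ := hcont.bounded_above_of_compact_support hc
  refine ⟨b.normed volume, M, b.contDiff_normed, hc, b.nonneg_normed,
    fun z => (le_abs_self _).trans (hM z), b.integral_normed, ?_⟩
  rw [b.tsupport_normed_eq, ← closedBall_prod_same, Real.closedBall_eq_Icc]
  refine prod_mono (Icc_subset_Icc ?_ ?_) le_rfl <;> simp only [b] <;> norm_num

/-- The two cones of paths leaving `(t, x)` and arriving at `(t + 3τ, y)`: the pointwise estimate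
before averaging over the directions of the paths. -/
theorem IsViscositySub.exists_direction_bound [NeZero d] {p q C c₀ r Λ α : ℝ} (hq : 0 < q)
    (hc₀0 : 0 < c₀)
    (hc₀ : ∀ a b : ℝ, 0 ≤ a → 0 ≤ b → a * b ≤ 1 / C * a ^ p + c₀ * b ^ q)
    (hr : 1 < r) (hΛ : 0 < Λ) (hα : 0 < α) (hα₁ : -1 < (α - 1) * q)
    (hα₂ : -1 < α * (-(d / (r - 1))))
    {g u : ℝ × E → ℝ} {Ω : Set (ℝ × E)} (hΩ : IsOpen Ω) (hu : ContinuousOn u Ω)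
    (hg : ContinuousOn g Ω) (hg0 : ∀ z ∈ Ω, 0 ≤ g z) (hsub : IsViscositySub p C g Ω u)
    (hgi : IntegrableOn (fun z => g z ^ r) Ω)
    {t τ δ ρ : ℝ} (hτ : 0 < τ) (hδ : 0 < δ) {x y : E} (hx : ‖x‖ + δ ≤ ρ) (hy : ‖y‖ + δ ≤ ρ)
    (hbox : Icc t (t + 3 * τ) ×ˢ closedBall 0 ρ ⊆ Ω) :
    ∃ J : E → ℝ, IntegrableOn J (closedBall 0 1) ∧
      ∫ v in closedBall (0 : E) 1, J v ≤ 4 * ∫ z in Ω, g z ^ r ∧ (∀ v : E, ‖v‖ ≤ 1 → 0 ≤ J v) ∧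
      ∀ z ∈ (Icc 1 2 ×ˢ closedBall 0 (1 / 2) : Set (ℝ × E)), u (t, x) - u (t + 3 * τ, y) ≤
      (u (t + τ * z.1, x + δ • z.2) - u (t + τ * z.1, y + δ • z.2)) +
      2 * (c₀ * (α ^ q / ((α - 1) * q + 1)) * δ ^ q * τ ^ (1 - q) +
        Λ * δ ^ (-(d / (r - 1))) * ((1 / (α * (-(d / (r - 1))) + 1) + 1) * τ)) +
      Λ ^ (1 - r) * J z.2 := by
  -- A route from x to y: open up from x to x + δv during [t, t + τ], rest until t + τθ, pass to y +
  -- δv, rest until t + 2τ, then close up to y. Only the passage is not a path, and it leaves the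
  -- difference of u at two points with the same time. J collects the source terms of the four true
  -- paths and does not depend on θ.
  set A : ℝ := c₀ * (α ^ q / ((α - 1) * q + 1)) * δ ^ q * τ ^ (1 - q) with hA
  set L : ℝ := Λ * δ ^ (-((d : ℝ) / (r - 1))) with hL
  set κ : ℝ := α * (-((d : ℝ) / (r - 1))) + 1 with hκ
  have hball : ∀ {x : E}, ‖x‖ + δ ≤ ρ → closedBall x δ ⊆ closedBall 0 ρ := fun {x} hx =>
    closedBall_subset_closedBall' (by rw [dist_zero_right]; linarith)
  have hbox' : ∀ {x : E} {a b : ℝ}, ‖x‖ + δ ≤ ρ → t ≤ a → b ≤ t + 3 * τ →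
      Icc a b ×ˢ closedBall x δ ⊆ Ω := fun {x a b} hx ha hb =>
    (prod_mono (Icc_subset_Icc ha hb) (hball hx)).trans hbox
  -- the four contributions of the right-hand side
  have hh : ContinuousOn (fun z => g z ^ r) Ω := hg.rpow_const fun z _ => Or.inr (by linarith)
  have hh0 : ∀ z ∈ Ω, 0 ≤ g z ^ r := fun z hz => Real.rpow_nonneg (hg0 z hz) _
  have hwidth : ∀ {a b c e : ℝ} {x : E}, a ≤ b → IsUnitParam a b τ c e →
      Icc a b ×ˢ closedBall x δ ⊆ Ω → _ := fun {a b c e x} hab hce hb =>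
    integral_width_le (x := x) (w := fun s => δ * (c * s + e) ^ α) (δ := δ) hΩ hh hh0 hgi hab
      (continuousOn_const.mul (ContinuousOn.rpow_const (by fun_prop) fun s _ => Or.inr hα.le))
      (fun s hs => mul_nonneg hδ.le (Real.rpow_nonneg (hce.mem_Icc hτ hs).1 _))
      (fun s hs => mul_le_of_le_one_right hδ.le
        (Real.rpow_le_one (hce.mem_Icc hτ hs).1 (hce.mem_Icc hτ hs).2 hα.le)) hb
  have hwidth' : ∀ {a b : ℝ} {x : E}, a ≤ b → Icc a b ×ˢ closedBall x δ ⊆ Ω → _ :=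
    fun {a b x} hab hb =>
    integral_width_le (x := x) (w := fun _ => δ) (δ := δ) hΩ hh hh0 hgi hab
      continuousOn_const (fun s hs => hδ.le) (fun s hs => le_rfl) hb
  have hf := IsUnitParam.forward t hτ
  have hbk : IsUnitParam (t + 2 * τ) (t + 3 * τ) τ (-τ⁻¹) (τ⁻¹ * (t + 3 * τ)) := by
    have := IsUnitParam.backward (t + 3 * τ) hτ
    rwa [show t + 3 * τ - τ = t + 2 * τ by ring] at this
  obtain ⟨i₁, l₁⟩ := hwidth (x := x) (by linarith) hf (hbox' hx le_rfl (by linarith))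
  obtain ⟨i₂, l₂⟩ := hwidth' (a := t + τ) (b := t + 2 * τ) (x := x) (by linarith)
    (hbox' hx (by linarith) (by linarith))
  obtain ⟨i₃, l₃⟩ := hwidth' (a := t + τ) (b := t + 2 * τ) (x := y) (by linarith)
    (hbox' hy (by linarith) (by linarith))
  obtain ⟨i₄, l₄⟩ := hwidth (x := y) (by linarith) hbk (hbox' hy (by linarith) le_rfl)
  have c₁ := fun (v : E) (hv : ‖v‖ ≤ 1) => hsub.cone_le (x := x) (v := v) hq hc₀0 hc₀ hr hΛ hα hα₁
    hα₂ hΩ hu hg hg0 hτ hδ (by linarith) hf hv (hbox' hx le_rfl (by linarith))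
  have c₄ := fun (v : E) (hv : ‖v‖ ≤ 1) => hsub.cone_le (x := y) (v := v) hq hc₀0 hc₀ hr hΛ hα hα₁
    hα₂ hΩ hu hg hg0 hτ hδ (by linarith) hbk hv (hbox' hy (by linarith) le_rfl)
  have c₂ := fun (θ : ℝ) (hθ : θ ∈ Icc (1 : ℝ) 2) (v : E) (hv : ‖v‖ ≤ 1) =>
    hsub.static_le (x := x) (v := v) (a := t + τ) (b := t + τ * θ) (a' := t + τ)
      (b' := t + 2 * τ) hq hc₀0 hc₀ hr hΛ hΩ hu hg hg0 hδ (by nlinarith [hθ.1]) le_rfl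
      (by nlinarith [hθ.2]) hv (hbox' hx (by linarith) (by linarith))
  have c₃ := fun (θ : ℝ) (hθ : θ ∈ Icc (1 : ℝ) 2) (v : E) (hv : ‖v‖ ≤ 1) =>
    hsub.static_le (x := y) (v := v) (a := t + τ * θ) (b := t + 2 * τ) (a' := t + τ)
      (b' := t + 2 * τ) hq hc₀0 hc₀ hr hΛ hΩ hu hg hg0 hδ (by nlinarith [hθ.2])
      (by nlinarith [hθ.1]) le_rfl hv (hbox' hy (by linarith) (by linarith))
  have hf0 : τ⁻¹ * t + -(τ⁻¹ * t) = 0 := by ring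
  have hf1 : τ⁻¹ * (t + τ) + -(τ⁻¹ * t) = 1 := by field_simp; ring
  have hb1 : -τ⁻¹ * (t + 2 * τ) + τ⁻¹ * (t + 3 * τ) = 1 := by field_simp; ring
  have hb0 : -τ⁻¹ * (t + 3 * τ) + τ⁻¹ * (t + 3 * τ) = 0 := by ring
  simp only [hf0, hf1, hb0, hb1, Real.zero_rpow hα.ne', Real.one_rpow, mul_zero, mul_one,
    zero_smul, add_zero] at c₁ c₄
  set J₁ : E → ℝ := fun v => ∫ s in t..t + τ, (δ * (τ⁻¹ * s + -(τ⁻¹ * t)) ^ α) ^ d *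
    g (s, x + (δ * (τ⁻¹ * s + -(τ⁻¹ * t)) ^ α) • v) ^ r with hJ₁
  set J₂ : E → ℝ := fun v => ∫ s in t + τ..t + 2 * τ, δ ^ d * g (s, x + δ • v) ^ r with hJ₂
  set J₃ : E → ℝ := fun v => ∫ s in t + τ..t + 2 * τ, δ ^ d * g (s, y + δ • v) ^ r with hJ₃
  set J₄ : E → ℝ := fun v => ∫ s in t + 2 * τ..t + 3 * τ,
    (δ * (-τ⁻¹ * s + τ⁻¹ * (t + 3 * τ)) ^ α) ^ d *
    g (s, y + (δ * (-τ⁻¹ * s + τ⁻¹ * (t + 3 * τ)) ^ α) • v) ^ r with hJ₄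
  set J : E → ℝ := J₁ + J₂ + J₃ + J₄ with hJ
  set I := ∫ z in Ω, g z ^ r with hI
  have iJ : IntegrableOn J (closedBall 0 1) := ((i₁.add i₂).add i₃).add i₄
  have lJ : ∫ v in closedBall (0 : E) 1, J v ≤ 4 * I := by
    have : ∫ v in closedBall (0 : E) 1, J v = (∫ v in closedBall (0 : E) 1, J₁ v) +
        (∫ v in closedBall (0 : E) 1, J₂ v) + (∫ v in closedBall (0 : E) 1, J₃ v) +
        ∫ v in closedBall (0 : E) 1, J₄ v := by
      rw [hJ, integral_add' ((i₁.add i₂).add i₃) i₄, integral_add' (i₁.add i₂) i₃,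
        integral_add' i₁ i₂]
    rw [this]; linarith
  have hrect : ∀ {x : E} {a b : ℝ} {w : ℝ → ℝ}, a ≤ b → (∀ s ∈ Icc a b, 0 ≤ w s) →
      (∀ s ∈ Icc a b, w s ≤ δ) → Icc a b ×ˢ closedBall x δ ⊆ Ω → ∀ v : E, ‖v‖ ≤ 1 →
      0 ≤ ∫ s in a..b, w s ^ d * g (s, x + w s • v) ^ r := by
    intro x a b w hab h0 h1 hb v hv
    refine intervalIntegral.integral_nonneg hab fun s hs => mul_nonneg (pow_nonneg (h0 s hs) _) ?_
    refine hh0 _ (hb ⟨hs, ?_⟩)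
    simp only [mem_closedBall, dist_self_add_left, norm_smul, Real.norm_eq_abs,
      abs_of_nonneg (h0 s hs)]
    exact (mul_le_of_le_one_right (h0 s hs) hv).trans (h1 s hs)
  have hJ0 : ∀ v : E, ‖v‖ ≤ 1 → 0 ≤ J v := by
    intro v hv
    have n₁ := hrect (w := fun s => δ * (τ⁻¹ * s + -(τ⁻¹ * t)) ^ α) (x := x) (a := t)
      (b := t + τ) (by linarith)
      (fun s hs => mul_nonneg hδ.le (Real.rpow_nonneg (hf.mem_Icc hτ hs).1 _))
      (fun s hs => mul_le_of_le_one_right hδ.le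
        (Real.rpow_le_one (hf.mem_Icc hτ hs).1 (hf.mem_Icc hτ hs).2 hα.le))
      (hbox' hx le_rfl (by linarith)) v hv
    have n₂ := hrect (w := fun _ => δ) (x := x) (a := t + τ) (b := t + 2 * τ) (by linarith)
      (fun s hs => hδ.le) (fun s hs => le_rfl) (hbox' hx (by linarith) (by linarith)) v hv
    have n₃ := hrect (w := fun _ => δ) (x := y) (a := t + τ) (b := t + 2 * τ) (by linarith)
      (fun s hs => hδ.le) (fun s hs => le_rfl) (hbox' hy (by linarith) (by linarith)) v hv
    have n₄ := hrect (w := fun s => δ * (-τ⁻¹ * s + τ⁻¹ * (t + 3 * τ)) ^ α) (x := y)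
      (a := t + 2 * τ) (b := t + 3 * τ) (by linarith)
      (fun s hs => mul_nonneg hδ.le (Real.rpow_nonneg (hbk.mem_Icc hτ hs).1 _))
      (fun s hs => mul_le_of_le_one_right hδ.le
        (Real.rpow_le_one (hbk.mem_Icc hτ hs).1 (hbk.mem_Icc hτ hs).2 hα.le))
      (hbox' hy (by linarith) le_rfl) v hv
    simp only [hJ, hJ₁, hJ₂, hJ₃, hJ₄, Pi.add_apply]
    linarith
  -- the pointwise inequality
  refine ⟨J, iJ, lJ, hJ0, ?_⟩
  intro z hz
  have hz2 : ‖z.2‖ ≤ 1 := by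
    have : ‖z.2‖ ≤ 1 / 2 := by simpa using hz.2
    linarith
  have e₁ := c₁ z.2 hz2
  have e₂ := c₂ z.1 hz.1 z.2 hz2
  have e₃ := c₃ z.1 hz.1 z.2 hz2
  have e₄ := c₄ z.2 hz2
  have e₅ : Λ ^ (1 - r) * J z.2 = Λ ^ (1 - r) * J₁ z.2 + Λ ^ (1 - r) * J₂ z.2 +
    Λ ^ (1 - r) * J₃ z.2 + Λ ^ (1 - r) * J₄ z.2 := by
    simp only [hJ, Pi.add_apply]; ring
  have e₆ : L * ((1 / κ + 1) * τ) = L * (τ / κ) + L * τ := by ring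
  have e₇ : L * (t + 2 * τ - (t + τ)) = L * τ := by ring
  rw [e₇] at e₂ e₃
  rw [e₅, e₆]
  linarith

/-- A subsolution at an earlier time is controlled by its values at a later time, anywhere in
space, up to the integral of its gradient over the time interval in between. -/
theorem IsViscositySub.le_add_time_shift [NeZero d] {p q C c₀ r Λ α : ℝ} (hq : 0 < q)
    (hc₀0 : 0 < c₀)
    (hc₀ : ∀ a b : ℝ, 0 ≤ a → 0 ≤ b → a * b ≤ 1 / C * a ^ p + c₀ * b ^ q)
    (hr : 1 < r) (hΛ : 0 < Λ) (hα : 0 < α) (hα₁ : -1 < (α - 1) * q)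
    (hα₂ : -1 < α * (-(d / (r - 1))))
    {g u : ℝ × E → ℝ} {Ω : Set (ℝ × E)} (hΩ : IsOpen Ω) (hu : ContinuousOn u Ω)
    (hg : ContinuousOn g Ω) (hg0 : ∀ z ∈ Ω, 0 ≤ g z) (hsub : IsViscositySub p C g Ω u)
    (hgi : IntegrableOn (fun z => g z ^ r) Ω)
    {G : ℝ × E → E} (hG : IsWeakSpaceGrad Ω u G)
    {Ψ : ℝ × E → ℝ} {M : ℝ} (hΨ : ContDiff ℝ ∞ Ψ) (hΨc : HasCompactSupport Ψ)
    (hΨ0 : ∀ z, 0 ≤ Ψ z) (hM : ∀ z, Ψ z ≤ M) (hΨ1 : ∫ z, Ψ z = 1)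
    (hΨs : tsupport Ψ ⊆ Icc 1 2 ×ˢ closedBall 0 (1 / 2))
    {t τ δ ρ : ℝ} (hτ : 0 < τ) (hδ : 0 < δ) {x y : E} (hx : ‖x‖ + δ ≤ ρ) (hy : ‖y‖ + δ ≤ ρ)
    (hbox : Icc t (t + 3 * τ) ×ˢ closedBall 0 ρ ⊆ Ω) :
    u (t, x) ≤ u (t + 3 * τ, y) +
      2 * (c₀ * (α ^ q / ((α - 1) * q + 1)) * δ ^ q * τ ^ (1 - q) +
        Λ * δ ^ (-(d / (r - 1))) * ((1 / (α * (-(d / (r - 1))) + 1) + 1) * τ)) +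
      Λ ^ (1 - r) * (4 * M * ∫ z in Ω, g z ^ r) +
      (τ * δ ^ d)⁻¹ * (‖y - x‖ * M *
        ∫ z in Icc (t + τ) (t + 2 * τ) ×ˢ closedBall 0 ρ, ‖G z‖) := by
  -- The pointwise bound is integrated against Ψ in (θ, v). Since Ψ has mass one, the left side and
  -- the deterministic cost are unchanged. The passage becomes a difference of translated averages,
  -- controlled by the weak gradient, and the source term is bounded by M times the integral of J,
  -- the time slot [1, 2] having length one.
  obtain ⟨J, iJ, lJ, hJ0, hpt⟩ := hsub.exists_direction_bound hq hc₀0 hc₀ hr hΛ hα hα₁ hα₂ hΩ hu hg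
    hg0 hgi hτ hδ hx hy hbox
  set B : ℝ := 2 * (c₀ * (α ^ q / ((α - 1) * q + 1)) * δ ^ q * τ ^ (1 - q) +
    Λ * δ ^ (-(d / (r - 1))) * ((1 / (α * (-(d / (r - 1))) + 1) + 1) * τ)) with hB
  have hM0 : 0 ≤ M := (hΨ0 0).trans (hM 0)
  have hball : ∀ {x : E}, ‖x‖ + δ ≤ ρ → closedBall x δ ⊆ closedBall 0 ρ := fun {x} hx =>
    closedBall_subset_closedBall' (by rw [dist_zero_right]; linarith)
  set I := ∫ z in Ω, g z ^ r with hI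
  set Q : Set (ℝ × E) := Icc 1 2 ×ˢ closedBall 0 (1 / 2) with hQ
  -- integrate against the kernel
  have hQm : MeasurableSet Q := measurableSet_Icc.prod measurableSet_closedBall
  have hQc : IsCompact Q := isCompact_Icc.prod (isCompact_closedBall _ _)
  have hmemΩ : ∀ {x : E}, ‖x‖ + δ ≤ ρ → ∀ z ∈ Q, (t + τ * z.1, x + δ • z.2) ∈ Ω := by
    intro x hx z hz
    have h1 : 1 ≤ z.1 := hz.1.1
    have h2 : z.1 ≤ 2 := hz.1.2
    refine hbox ⟨⟨by nlinarith, by nlinarith⟩, hball hx ?_⟩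
    have : ‖z.2‖ ≤ 1 / 2 := by simpa using hz.2
    simp only [mem_closedBall, dist_self_add_left, norm_smul, Real.norm_eq_abs, abs_of_pos hδ]
    exact mul_le_of_le_one_right hδ.le (by linarith)
  have hΨQ : ∀ z, z ∉ Q → Ψ z = 0 := fun z hz =>
    image_eq_zero_of_notMem_tsupport fun h => hz (hΨs h)
  have hΨi : IntegrableOn Ψ Q := (hΨ.continuous.integrable_of_hasCompactSupport hΨc).integrableOn
  have hΨ1' : ∫ z in Q, Ψ z = 1 := by
    rw [← hΨ1]; exact setIntegral_eq_integral_of_forall_compl_eq_zero hΨQ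
  have huc : ∀ {x : E}, ‖x‖ + δ ≤ ρ →
      IntegrableOn (fun z => u (t + τ * z.1, x + δ • z.2) * Ψ z) Q := fun {x} hx =>
    ContinuousOn.integrableOn_compact hQc
      ((hu.comp (by fun_prop) (hmemΩ hx)).mul hΨ.continuous.continuousOn)
  have hueq : ∀ x : E, ∫ z in Q, u (t + τ * z.1, x + δ • z.2) * Ψ z =
      ∫ z : ℝ × E, u (t + τ * z.1, x + δ • z.2) * Ψ z := fun x =>
    setIntegral_eq_integral_of_forall_compl_eq_zero fun z hz => by rw [hΨQ z hz, mul_zero]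
  have hrest : (volume.restrict Q : Measure (ℝ × E)) =
      (volume.restrict (Icc 1 2)).prod (volume.restrict (closedBall 0 (1 / 2))) :=
    (Measure.prod_restrict _ _).symm
  have hcb : closedBall (0 : E) (1 / 2) ⊆ closedBall 0 1 := closedBall_subset_closedBall (by norm_num)
  have hJQ : IntegrableOn (fun z : ℝ × E => J z.2) Q := by
    rw [IntegrableOn, hrest]
    exact Integrable.comp_snd (iJ.mono_set hcb) _
  have hJQ1 : ∫ z in Q, J z.2 ≤ 4 * I := by
    rw [hrest, integral_fun_snd (fun v => J v)]
    have : (volume.restrict (Icc (1 : ℝ) 2)).real univ = 1 := by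
      simp [Measure.real]; norm_num
    rw [this, one_smul]
    refine le_trans ?_ lJ
    refine setIntegral_mono_set iJ ?_ hcb.eventuallyLE
    filter_upwards [ae_restrict_mem measurableSet_closedBall] with v hv
    exact hJ0 v (by simpa using hv)
  have hJΨ : IntegrableOn (fun z : ℝ × E => J z.2 * Ψ z) Q :=
    hJQ.mul_continuousOn hΨ.continuous.continuousOn hQc
  have hJΨ1 : ∫ z in Q, J z.2 * Ψ z ≤ M * (4 * I) := by
    calc ∫ z in Q, J z.2 * Ψ z ≤ ∫ z in Q, J z.2 * M := by
          refine setIntegral_mono_on hJΨ (hJQ.mul_const M) hQm fun z hz => ?_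
          have : ‖z.2‖ ≤ 1 / 2 := by simpa using hz.2
          exact mul_le_mul_of_nonneg_left (hM z) (hJ0 _ (by linarith))
      _ = M * ∫ z in Q, J z.2 := by rw [integral_mul_const, mul_comm]
      _ ≤ _ := by gcongr
  have hmain : (u (t, x) - u (t + 3 * τ, y)) * ∫ z in Q, Ψ z ≤
      ((∫ z in Q, u (t + τ * z.1, x + δ • z.2) * Ψ z) -
        ∫ z in Q, u (t + τ * z.1, y + δ • z.2) * Ψ z) +
      B * (∫ z in Q, Ψ z) +
      Λ ^ (1 - r) * ∫ z in Q, J z.2 * Ψ z := by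
    have i₁ := huc hx
    have i₂ := huc hy
    have i₃ : IntegrableOn (fun z => B * Ψ z) Q := hΨi.const_mul B
    have i₄ : IntegrableOn (fun z => Λ ^ (1 - r) * (J z.2 * Ψ z)) Q := hJΨ.const_mul _
    have i₅ : IntegrableOn (fun z => (u (t, x) - u (t + 3 * τ, y)) * Ψ z) Q := hΨi.const_mul _
    rw [← integral_const_mul, ← integral_const_mul, ← integral_const_mul, ← integral_sub' i₁ i₂,
      ← integral_add' (i₁.sub i₂) i₃, ← integral_add' ((i₁.sub i₂).add i₃) i₄]
    refine setIntegral_mono_on i₅ (((i₁.sub i₂).add i₃).add i₄) hQm fun z hz => ?_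
    have := mul_le_mul_of_nonneg_right (hpt z hz) (hΨ0 z)
    simp only [Pi.add_apply, Pi.sub_apply]
    linarith
  have hGle := hG.abs_average_sub_le hΩ hu hΨ hΨc (M := M)
    (fun z => by rw [abs_of_nonneg (hΨ0 z)]; exact hM z) (t := t) hτ hδ (x := x) (y := y)
    (K := Icc (t + τ) (t + 2 * τ) ×ˢ closedBall 0 ρ)
    (isCompact_Icc.prod (isCompact_closedBall _ _))
    ((Set.prod_mono (Icc_subset_Icc (by linarith) (by linarith)) le_rfl).trans hbox) (by
      intro ϑ hϑ z hz
      have hzQ := hΨs hz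
      have h1 : 1 ≤ z.1 := hzQ.1.1
      have h2 : z.1 ≤ 2 := hzQ.1.2
      refine ⟨⟨by nlinarith, by nlinarith⟩, ?_⟩
      have hconv : x + ϑ • (y - x) ∈ closedBall (0 : E) (ρ - δ) :=
        (convex_closedBall (0 : E) (ρ - δ)).add_smul_sub_mem (by simp; linarith)
          (by simp; linarith) hϑ
      have h3 : ‖x + ϑ • (y - x)‖ + δ ≤ ρ := by
        have : ‖x + ϑ • (y - x)‖ ≤ ρ - δ := by simpa using hconv
        linarith
      refine hball h3 ?_
      have : ‖z.2‖ ≤ 1 / 2 := by simpa using hzQ.2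
      simp only [mem_closedBall, dist_self_add_left, norm_smul, Real.norm_eq_abs, abs_of_pos hδ]
      exact mul_le_of_le_one_right hδ.le (by linarith))
  rw [hΨ1', mul_one, mul_one, hueq, hueq] at hmain
  have h7 := (abs_le.1 hGle).1
  have h8 : Λ ^ (1 - r) * ∫ z in Q, J z.2 * Ψ z ≤ Λ ^ (1 - r) * (4 * M * I) := by
    have : 0 ≤ Λ ^ (1 - r) := by positivity
    refine mul_le_mul_of_nonneg_left ?_ this
    linarith
  linarith

end TimeShift

/-! ### The time shift inequality with an arbitrarily small constant. -/

section Oscillation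
open Filter Topology Metric

variable {d : ℕ}

local notation "E" => EuclideanSpace ℝ (Fin d)

/-- The reference cylinder `(-3, 3) × B(0, R)`. -/
def refCyl (d : ℕ) (R : ℝ) : Set (ℝ × EuclideanSpace ℝ (Fin d)) := Ioo (-3) 3 ×ˢ ball 0 R

theorem isOpen_refCyl (R : ℝ) : IsOpen (refCyl d R) := isOpen_Ioo.prod isOpen_ball

/-- A viscosity solution `u` on the reference cylinder of the normalized pair of inequalities, with
weak spatial gradient `G` small in `L¹` and bounded in `L^p`, and with small source terms. -/
structure HasSmallGradient (p C r R N ε : ℝ) (u g : ℝ × E → ℝ) (G : ℝ × E → E) : Prop where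
  continuousOn : ContinuousOn u (refCyl d R)
  continuousOn_source : ContinuousOn g (refCyl d R)
  source_nonneg : ∀ z ∈ refCyl d R, 0 ≤ g z
  sub : IsViscositySub p C g (refCyl d R) u
  super : IsViscositySuperWith p C (C * ε) (refCyl d R) u
  weakGrad : IsWeakSpaceGrad (refCyl d R) u G
  integrableOn_grad : IntegrableOn G (refCyl d R)
  integrableOn_grad_rpow : IntegrableOn (fun z => ‖G z‖ ^ p) (refCyl d R)
  integrableOn_source : IntegrableOn (fun z => g z ^ r) (refCyl d R)
  integral_grad_le : ∫ z in refCyl d R, ‖G z‖ ≤ ε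
  integral_grad_rpow_le : ∫ z in refCyl d R, ‖G z‖ ^ p ≤ N
  integral_source_le : ∫ z in refCyl d R, g z ^ r ≤ ε

/-- The exponent will be 2 - q, whose sign depends on p, so both monotonicity cases are kept. -/
theorem min_rpow_le {a b x s : ℝ} (ha : 0 < a) (hax : a ≤ x) (hxb : x ≤ b) :
    min (a ^ s) (b ^ s) ≤ x ^ s := by
  rcases le_total 0 s with hs | hs
  · exact (min_le_left _ _).trans (Real.rpow_le_rpow ha.le hax hs)
  · exact (min_le_right _ _).trans (Real.rpow_le_rpow_of_nonpos (ha.trans_le hax) hxb hs)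

/-- Interpolation between the smallness in `L¹` and the boundedness in `L^p` of the gradient. -/
theorem exists_small_of_interpolation {p q c k A : ℝ} (hpq : p.HolderConjugate q) (hc : 0 < c)
    (hk : 0 < k) (hA : 0 < A) :
    ∃ ε > 0, ∀ X τ : ℝ, 0 < τ → τ ≤ 2 → X ≤ ε → X ≤ c * τ ^ (1 / q) →
      τ⁻¹ * (k * X) ≤ A * τ ^ (1 - q) := by
  have hq := hpq.symm.pos
  have hq1 := hpq.symm.lt
  -- Here e₀ = (q - 1)²/q is positive, so τ^(1/q) is o(τ^(2-q)) as τ tends to 0. Below τ₀ the L^p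
  -- bound alone suffices, and between τ₀ and 2 the uniform smallness of X does.
  set e₀ : ℝ := 1 / q - 2 + q with he₀
  have he₀pos : 0 < e₀ := by
    have : e₀ = (q - 1) ^ 2 / q := by rw [he₀]; field_simp; ring
    rw [this]
    have : 0 < q - 1 := by linarith
    positivity
  set τ₀ : ℝ := (A / (k * c)) ^ (1 / e₀) with hτ₀
  have hτ₀pos : 0 < τ₀ := by positivity
  have hτ₀e : τ₀ ^ e₀ = A / (k * c) := by
    rw [hτ₀, ← Real.rpow_mul (by positivity), one_div_mul_cancel he₀pos.ne', Real.rpow_one]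
  have hm : 0 < min (τ₀ ^ (2 - q)) ((2 : ℝ) ^ (2 - q)) := by
    apply lt_min <;> positivity
  refine ⟨A * min (τ₀ ^ (2 - q)) ((2 : ℝ) ^ (2 - q)) / k, by positivity, ?_⟩
  intro X τ hτ hτ2 hX1 hX2
  have key : k * X ≤ A * τ ^ (2 - q) := by
    rcases le_total τ τ₀ with h | h
    · have h1 : τ ^ e₀ ≤ A / (k * c) := by
        rw [← hτ₀e]; exact Real.rpow_le_rpow hτ.le h he₀pos.le
      have h2 : τ ^ (1 / q) = τ ^ e₀ * τ ^ (2 - q) := by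
        rw [← Real.rpow_add hτ]; congr 1; rw [he₀]; ring
      calc k * X ≤ k * (c * τ ^ (1 / q)) := by gcongr
        _ = k * c * τ ^ e₀ * τ ^ (2 - q) := by rw [h2]; ring
        _ ≤ k * c * (A / (k * c)) * τ ^ (2 - q) := by gcongr
        _ = A * τ ^ (2 - q) := by field_simp
    · calc k * X ≤ k * (A * min (τ₀ ^ (2 - q)) ((2 : ℝ) ^ (2 - q)) / k) := by gcongr
        _ = A * min (τ₀ ^ (2 - q)) ((2 : ℝ) ^ (2 - q)) := by field_simp
        _ ≤ A * τ ^ (2 - q) := by gcongr; exact min_rpow_le hτ₀pos h hτ2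
  have h3 : τ ^ (1 - q) = τ⁻¹ * τ ^ (2 - q) := by
    rw [← Real.rpow_neg_one, ← Real.rpow_add hτ]; congr 1; ring
  rw [h3]
  calc τ⁻¹ * (k * X) ≤ τ⁻¹ * (A * τ ^ (2 - q)) := by gcongr
    _ = _ := by ring

/-- The first bound is monotonicity. The second plays the role of Hölder's inequality in time: |G| ≤
M + M^(1-p) |G|^p with M = τ^(-1/p), for which both Mτ and M^(1-p) equal τ^(1/q). -/
theorem HasSmallGradient.integral_window_le {p q C r R N ε : ℝ} (hpq : p.HolderConjugate q)
    {u g : ℝ × E → ℝ} {G : ℝ × E → E} (h : HasSmallGradient p C r R N ε u g G)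
    {t τ ρ : ℝ} (hτ : 0 < τ) (hK : Icc t (t + τ) ×ˢ closedBall 0 ρ ⊆ refCyl d R) :
    ∫ z in Icc t (t + τ) ×ˢ closedBall 0 ρ, ‖G z‖ ≤ ε ∧
    ∫ z in Icc t (t + τ) ×ˢ closedBall 0 ρ, ‖G z‖ ≤
      (volume.real (closedBall (0 : E) ρ) + N) * τ ^ (1 / q) := by
  set K : Set (ℝ × E) := Icc t (t + τ) ×ˢ closedBall 0 ρ with hKdef
  have hKc : IsCompact K := isCompact_Icc.prod (isCompact_closedBall _ _)
  constructor
  · exact (setIntegral_mono_set h.integrableOn_grad.norm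
      (Eventually.of_forall fun z => norm_nonneg _) hK.eventuallyLE).trans h.integral_grad_le
  have hvol : volume.real K = τ * volume.real (closedBall (0 : E) ρ) := by
    rw [hKdef, Measure.real, Measure.volume_eq_prod, Measure.prod_prod, ENNReal.toReal_mul]
    simp [Measure.real, hτ.le]
  have hp := hpq.pos
  have hp1 := hpq.lt
  set M : ℝ := τ ^ (-(1 / p)) with hM
  have hM0 : 0 < M := by positivity
  have hpq' : 1 / p + 1 / q = 1 := by simpa using hpq.inv_add_inv_eq_one
  have e1 : M * τ = τ ^ (1 / q) := by
    rw [hM, ← Real.rpow_add_one hτ.ne']; congr 1; linarith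
  have e2 : M ^ (1 - p) = τ ^ (1 / q) := by
    rw [hM, ← Real.rpow_mul hτ.le]; congr 1
    have : 1 / q = 1 - 1 / p := by linarith
    rw [this]; field_simp; ring
  have hp_int : ∫ z in K, ‖G z‖ ^ p ≤ N :=
    (setIntegral_mono_set h.integrableOn_grad_rpow
      (Eventually.of_forall fun z => by positivity) hK.eventuallyLE).trans h.integral_grad_rpow_le
  have iK : IntegrableOn (fun z => ‖G z‖ ^ p) K := h.integrableOn_grad_rpow.mono_set hK
  have ic : IntegrableOn (fun _ : ℝ × E => M) K := integrableOn_const hKc.measure_lt_top.ne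
  calc ∫ z in K, ‖G z‖ ≤ ∫ z in K, (M + M ^ (1 - p) * ‖G z‖ ^ p) :=
        integral_mono (h.integrableOn_grad.mono_set hK).norm (ic.add (iK.const_mul _))
          fun z => le_add_rpow_mul hp1 hM0 (norm_nonneg _)
    _ = M * τ * volume.real (closedBall (0 : E) ρ) + M ^ (1 - p) * ∫ z in K, ‖G z‖ ^ p := by
        rw [integral_add ic (iK.const_mul _), integral_const_mul, setIntegral_const, hvol,
          smul_eq_mul]
        ring
    _ ≤ τ ^ (1 / q) * volume.real (closedBall (0 : E) ρ) + τ ^ (1 / q) * N := by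
        rw [e1, e2]; gcongr
    _ = _ := by ring

set_option maxHeartbeats 400000 in
/-- Values at an earlier time are controlled by the values at later times at any other point, with
an arbitrarily small constant, if the gradient and the sources are small. -/
theorem exists_time_shift_const [NeZero d] {p q C r R N a : ℝ} (hpq : p.HolderConjugate q)
    (hC : 0 < C) (hr : 1 + d / p < r) (hR : 0 ≤ R) (hN : 0 ≤ N) (ha : 0 < a) :
    ∃ ε > 0, ∀ (u g : ℝ × E → ℝ) (G : ℝ × E → E), HasSmallGradient p C r (R + 2) N ε u g G →
      ∀ (t τ : ℝ) (x y : E), 0 < τ → -2 ≤ t → t + 3 * τ ≤ 2 → ‖x‖ ≤ R → ‖y‖ ≤ R →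
        u (t, x) ≤ u (t + 3 * τ, y) + a * τ ^ (1 - q) := by
  have hp := hpq.pos
  have hq := hpq.symm.pos
  have hq1 := hpq.symm.lt
  have hd : (0 : ℝ) < d := by exact_mod_cast Nat.pos_of_ne_zero (NeZero.ne d)
  have hdp : 0 < d / p := by positivity
  have hr1 : 1 < r := by linarith
  obtain ⟨c₀, hc₀0, hc₀⟩ := exists_young_const hpq hC
  obtain ⟨Ψ, M, hΨ, hΨc, hΨ0, hM, hΨ1, hΨs⟩ := exists_average_kernel d
  have hM0 : 0 ≤ M := (hΨ0 0).trans (hM 0)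
  -- The two integrability conditions at the tip of the cones are compatible precisely because r > 1
  -- + d/p.
  obtain ⟨α, hα1, hα2⟩ : ∃ α, 1 / p < α ∧ α < (r - 1) / d := by
    apply exists_between
    rw [lt_div_iff₀ hd]
    calc 1 / p * d = d / p := by ring
      _ < r - 1 := by linarith
  have hα : 0 < α := lt_trans (by positivity) hα1
  have hα₁ : -1 < (α - 1) * q := by
    have h1 : 1 / p + 1 / q = 1 := by simpa using hpq.inv_add_inv_eq_one
    have h2 : 1 / p * q < α * q := by gcongr
    have h3 : 1 / p * q = q - 1 := by
      have : 1 / p = 1 - 1 / q := by linarith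
      rw [this]; field_simp
    linarith
  have hα₂ : -1 < α * (-(d / (r - 1))) := by
    have : α * d < r - 1 := by rwa [lt_div_iff₀ hd] at hα2
    have h2 : α * (d / (r - 1)) < 1 := by
      rw [← mul_div_assoc, div_lt_one (by linarith)]; exact this
    linarith
  set K₁ : ℝ := c₀ * (α ^ q / ((α - 1) * q + 1)) with hK₁
  have hK₁0 : 0 < K₁ := by
    have : 0 < (α - 1) * q + 1 := by linarith
    positivity
  set K₂ : ℝ := 1 / (α * (-((d : ℝ) / (r - 1))) + 1) + 1 with hK₂
  have hK₂0 : 0 < K₂ := by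
    have : 0 < α * (-((d : ℝ) / (r - 1))) + 1 := by linarith
    positivity
  -- the choice of the constants
  set δ : ℝ := min 1 ((a / (8 * K₁)) ^ (1 / q)) with hδ
  have hδ0 : 0 < δ := lt_min one_pos (by positivity)
  have hδ1 : δ ≤ 1 := min_le_left _ _
  -- The budget a τ^(1-q) is split into four quarters. A small width δ pays the kinetic cost, then a
  -- small Λ pays the threshold cost, and a small ε finally pays the sources and the gradient, whose
  -- coefficients are fixed by then. The powers of 2 come from τ ≤ 2.
  have hδq : 2 * (K₁ * δ ^ q) ≤ a / 4 := by
    have h1 : δ ^ q ≤ a / (8 * K₁) := by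
      calc δ ^ q ≤ ((a / (8 * K₁)) ^ (1 / q)) ^ q :=
            Real.rpow_le_rpow hδ0.le (min_le_right _ _) hq.le
        _ = a / (8 * K₁) := by
            rw [← Real.rpow_mul (by positivity), one_div_mul_cancel hq.ne', Real.rpow_one]
    calc 2 * (K₁ * δ ^ q) ≤ 2 * (K₁ * (a / (8 * K₁))) := by gcongr
      _ = a / 4 := by field_simp; ring
  set δe : ℝ := δ ^ (-((d : ℝ) / (r - 1))) with hδe
  have hδe0 : 0 < δe := by positivity
  set Λ : ℝ := a / (8 * δe * K₂ * 2 ^ q) with hΛ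
  have hΛ0 : 0 < Λ := by positivity
  have hΛeq : 2 * (Λ * δe * (K₂ * 2 ^ q)) = a / 4 := by rw [hΛ]; field_simp; ring
  set V : ℝ := volume.real (closedBall (0 : E) (R + 1)) with hV
  have hV0 : 0 ≤ V := measureReal_nonneg
  set k : ℝ := (δ ^ d)⁻¹ * (2 * R * M) + 1 with hk
  have hk0 : 0 < k := by positivity
  obtain ⟨ε₁, hε₁, hint⟩ := exists_small_of_interpolation (A := a / 4) (c := V + N + 1) (k := k)
    hpq (by positivity) hk0 (by positivity)
  set ε₂ : ℝ := a / 4 * 2 ^ (1 - q) / (Λ ^ (1 - r) * (4 * M) + 1) with hε₂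
  have hε₂0 : 0 < ε₂ := by positivity
  have hε₂le : Λ ^ (1 - r) * (4 * M) * ε₂ ≤ a / 4 * 2 ^ (1 - q) := by
    have h0 : 0 ≤ Λ ^ (1 - r) * (4 * M) := by positivity
    rw [hε₂, mul_div_assoc', div_le_iff₀ (by positivity)]
    rw [mul_comm]
    gcongr
    linarith
  refine ⟨min ε₁ ε₂, lt_min hε₁ hε₂0, ?_⟩
  intro u g G h t τ x y hτ ht htτ hx hy
  have hτ2 : τ ≤ 2 := by linarith
  have hbox : Icc t (t + 3 * τ) ×ˢ closedBall 0 (R + 1) ⊆ refCyl d (R + 2) := by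
    refine Set.prod_mono (fun s hs => ⟨?_, ?_⟩) (closedBall_subset_ball (by linarith))
    · linarith [hs.1]
    · linarith [hs.2]
  have hmain := h.sub.le_add_time_shift hq hc₀0 hc₀ hr1 hΛ0 hα hα₁ hα₂ (isOpen_refCyl _)
    h.continuousOn h.continuousOn_source h.source_nonneg h.integrableOn_source h.weakGrad hΨ hΨc hΨ0
    hM hΨ1 hΨs hτ hδ0 (x := x) (y := y) (ρ := R + 1) (by linarith) (by linarith) hbox
  rw [← hK₁, ← hδe, ← hK₂] at hmain
  have hwin := h.integral_window_le hpq (t := t + τ) (τ := τ) (ρ := R + 1) hτ (by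
    refine (Set.prod_mono (Icc_subset_Icc ?_ ?_) le_rfl).trans hbox <;> linarith)
  rw [show t + τ + τ = t + 2 * τ by ring] at hwin
  set X := ∫ z in Icc (t + τ) (t + 2 * τ) ×ˢ closedBall 0 (R + 1), ‖G z‖ with hX
  have hX0 : 0 ≤ X := integral_nonneg fun z => norm_nonneg _
  set I := ∫ z in refCyl d (R + 2), g z ^ r with hI
  set T : ℝ := τ ^ (1 - q) with hT
  have hT0 : 0 < T := by positivity
  have t₁ : 2 * (K₁ * δ ^ q * T) ≤ a / 4 * T := by
    calc 2 * (K₁ * δ ^ q * T) = 2 * (K₁ * δ ^ q) * T := by ring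
      _ ≤ a / 4 * T := by gcongr
  have t₂ : 2 * (Λ * δe * (K₂ * τ)) ≤ a / 4 * T := by
    have h1 : τ = τ ^ q * T := by rw [hT, ← Real.rpow_add hτ]; simp
    have h2 : τ ^ q ≤ 2 ^ q := Real.rpow_le_rpow hτ.le hτ2 hq.le
    calc 2 * (Λ * δe * (K₂ * τ)) = 2 * (Λ * δe * (K₂ * τ ^ q)) * T := by
          nth_rewrite 1 [h1]; ring
      _ ≤ 2 * (Λ * δe * (K₂ * 2 ^ q)) * T := by gcongr
      _ = a / 4 * T := by rw [hΛeq]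
  have t₃ : Λ ^ (1 - r) * (4 * M * I) ≤ a / 4 * T := by
    have h1 : (2 : ℝ) ^ (1 - q) ≤ T :=
      Real.rpow_le_rpow_of_nonpos hτ hτ2 (by linarith)
    calc Λ ^ (1 - r) * (4 * M * I) = Λ ^ (1 - r) * (4 * M) * I := by ring
      _ ≤ Λ ^ (1 - r) * (4 * M) * ε₂ := by
          gcongr
          exact h.integral_source_le.trans (min_le_right _ _)
      _ ≤ a / 4 * 2 ^ (1 - q) := hε₂le
      _ ≤ a / 4 * T := by gcongr
  have t₄ : (τ * δ ^ d)⁻¹ * (‖y - x‖ * M * X) ≤ a / 4 * T := by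
    have h1 : ‖y - x‖ ≤ 2 * R := (norm_sub_le _ _).trans (by linarith)
    have h2 := hint X τ hτ hτ2 (hwin.1.trans (min_le_left _ _)) (hwin.2.trans (by
      have : 0 ≤ τ ^ (1 / q) := by positivity
      exact mul_le_mul_of_nonneg_right (by linarith) this))
    calc (τ * δ ^ d)⁻¹ * (‖y - x‖ * M * X) ≤ (τ * δ ^ d)⁻¹ * (2 * R * M * X) := by gcongr
      _ = τ⁻¹ * ((δ ^ d)⁻¹ * (2 * R * M) * X) := by rw [mul_inv]; ring
      _ ≤ τ⁻¹ * (k * X) := by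
          have : (δ ^ d)⁻¹ * (2 * R * M) ≤ k := by rw [hk]; linarith
          gcongr
      _ ≤ a / 4 * T := h2
  linarith

end Oscillation

/-! ### The barrier for supersolutions and the oscillation estimate. -/

section OscillationBound
open Filter Topology Metric

variable {d : ℕ}

local notation "E" => EuclideanSpace ℝ (Fin d)

/-- A viscosity supersolution cannot be touched from below by a function which is concave in space
and increases too fast in time. -/
theorem IsViscositySuperWith.timeDeriv_le {p C e : ℝ} {u : ℝ × E → ℝ} {Ω : Set (ℝ × E)}
    (hu : IsViscositySuperWith p C e Ω u) {θ A : ℝ → ℝ} {θ' A' : ℝ} {x₀ : E} {z : ℝ × E}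
    (hθ : ContDiffAt ℝ 1 θ z.1) (hA : ContDiffAt ℝ 1 A z.1) (hθ' : HasDerivAt θ θ' z.1)
    (hA' : HasDerivAt A A' z.1) (hz : z ∈ Ω)
    (hmin : IsLocalMin (fun w : ℝ × E => u w - θ w.1 + A w.1 * ‖w.2 - x₀‖ ^ 2) z) :
    θ' - A' * ‖z.2 - x₀‖ ^ 2 ≤ C * (2 * |A z.1| * ‖z.2 - x₀‖) ^ p + e := by
  set φ : ℝ × E → ℝ := fun w => θ w.1 - A w.1 * ‖w.2 - x₀‖ ^ 2 with hφ
  have hφC : ContDiffAt ℝ 1 φ z :=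
    (hθ.comp z contDiffAt_fst).sub
      ((hA.comp z contDiffAt_fst).mul ((contDiffAt_snd.sub contDiffAt_const).norm_sq ℝ))
  have ht : timeDeriv φ z = θ' - A' * ‖z.2 - x₀‖ ^ 2 :=
    (hθ'.sub (hA'.mul_const (‖z.2 - x₀‖ ^ 2))).deriv
  have hx : spaceGrad φ z = (2 * -A z.1) • (z.2 - x₀) := by
    have h3 := hasGradientAt_norm_sub_sq (-A z.1) x₀ z.2
    rw [hasGradientAt_iff_hasFDerivAt] at h3
    have h4 := hasGradientAt_iff_hasFDerivAt.2 (h3.const_add (θ z.1))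
    rw [← h4.gradient, spaceGrad]
    congr 1
    funext y
    simp only [hφ]; ring
  have h := hu.le_of_contDiffAt hφC hz (by
    refine hmin.congr (Eventually.of_forall fun w => ?_)
    simp only [hφ]; ring)
  rw [ht, hx, norm_smul, norm_mul, norm_neg, Real.norm_eq_abs, Real.norm_eq_abs, abs_two] at h
  linarith

/-- The barrier estimate: values of `u` at a late time are controlled by its value at an earlier
time, in some point of the unit ball. -/
theorem exists_late_le {p q C μ ℓ a b ε : ℝ} (hpq : p.HolderConjugate q) (hC : 0 < C)
    (hμ : 0 < μ) (ha : 0 < a) (hℓ : 0 < ℓ) (hℓ8 : ℓ ≤ 1 / 8) (haμ : C * (2 * a) ^ p ≤ μ / 3)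
    (hℓa : ℓ * (μ * 4 ^ q) ≤ a / 4) (hba : b * (ℓ / 3) ^ (1 - q) ≤ a / 2)
    (hε : C * ε ≤ μ / 3 * 4 ^ (-(2 * q))) {R : ℝ} {u : ℝ × E → ℝ}
    (hu : ContinuousOn u (refCyl d (R + 2)))
    (hsuper : IsViscositySuperWith p C (C * ε) (refCyl d (R + 2)) u)
    (hshift : ∀ (t τ : ℝ) (x y : E), 0 < τ → -2 ≤ t → t + 3 * τ ≤ 2 → ‖x‖ ≤ R → ‖y‖ ≤ R →
        u (t, x) ≤ u (t + 3 * τ, y) + b * τ ^ (1 - q))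
    {s₁ : ℝ} {x₁ : E} (hs₁ : s₁ ∈ Icc (-1 : ℝ) 1) (hx₁ : ‖x₁‖ + 1 ≤ R) :
    ∃ x, ‖x‖ ≤ R ∧ u (2, x) ≤ u (s₁, x₁) + μ := by
  have hp := hpq.pos
  have hq := hpq.symm.pos
  have hq1 := hpq.symm.lt
  have hqq : (q - 1) * p = q := by
    have h1 : p⁻¹ + q⁻¹ = 1 := hpq.inv_add_inv_eq_one
    field_simp at h1
    linarith
  -- With ρ = s + 2, the barrier is θ(s) - A(s) |x - x₁|², where θ' = μ ρ^(-2q) and A = a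
  -- ρ^(-2(q-1)). The exponents match twice: A^p scales like θ', because (q - 1)p = q, and A scales
  -- like the time shift error for a lag of order ρ². The normalisation m(2q - 1) = μ produces θ'.
  -- As θ tends to -∞ at time -2, u - θ + A |x - x₁|² attains its minimum at a time after -2, and
  -- the point is to force that time to be 2.
  set m : ℝ := μ / (2 * q - 1) with hm
  have h2q : 1 < 2 * q - 1 := by linarith
  have hm0 : 0 < m := by positivity
  have hmμ : m ≤ μ := div_le_self hμ.le h2q.le
  have hmeq : m * (2 * q - 1) = μ := by rw [hm]; field_simp
  set θ : ℝ → ℝ := fun s => -(m * (s + 2) ^ (1 - 2 * q)) with hθ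
  set A : ℝ → ℝ := fun s => a * (s + 2) ^ (-(2 * (q - 1))) with hA
  have hlin : ∀ s : ℝ, HasDerivAt (fun s : ℝ => s + 2) 1 s := fun s =>
    (hasDerivAt_id s).add_const 2
  have hθd : ∀ s : ℝ, -2 < s → HasDerivAt θ (μ * (s + 2) ^ (-(2 * q))) s := by
    intro s hs
    have h := (((hlin s).rpow_const (p := 1 - 2 * q) (Or.inl (by linarith))).const_mul m).neg
    refine h.congr_deriv ?_
    rw [show (1 : ℝ) - 2 * q - 1 = -(2 * q) by ring, ← hmeq]; ring
  have hAd : ∀ s : ℝ, -2 < s → HasDerivAt A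
      (a * (1 * (-(2 * (q - 1))) * (s + 2) ^ (-(2 * (q - 1)) - 1))) s := fun s hs =>
    ((hlin s).rpow_const (Or.inl (by linarith))).const_mul a
  have hl : ∀ s : ℝ, ContDiffAt ℝ 1 (fun s : ℝ => s + 2) s := fun s => by fun_prop
  have hθC : ∀ s : ℝ, -2 < s → ContDiffAt ℝ 1 θ s := fun s hs =>
    (contDiffAt_const.mul ((hl s).rpow_const_of_ne (by linarith))).neg
  have hAC : ∀ s : ℝ, -2 < s → ContDiffAt ℝ 1 A s := fun s hs =>
    contDiffAt_const.mul ((hl s).rpow_const_of_ne (by linarith))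
  have hA0 : ∀ s : ℝ, -2 < s → 0 < A s := fun s hs => by
    have : 0 < s + 2 := by linarith
    simp only [hA]; positivity
  set F : ℝ × E → ℝ := fun w => u w - θ w.1 + A w.1 * ‖w.2 - x₁‖ ^ 2 with hF
  have hballR : ∀ x ∈ closedBall x₁ 1, ‖x‖ ≤ R := fun x hx => by
    have h1 : ‖x - x₁‖ ≤ 1 := by simpa [dist_eq_norm] using hx
    have h2 : ‖x‖ ≤ ‖x - x₁‖ + ‖x₁‖ := by simpa using norm_add_le (x - x₁) x₁
    linarith
  have hmemΩ : ∀ s ∈ Icc (-2 : ℝ) 2, ∀ x ∈ closedBall x₁ 1, (s, x) ∈ refCyl d (R + 2) := by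
    intro s hs x hx
    refine ⟨⟨by linarith [hs.1], by linarith [hs.2]⟩, ?_⟩
    rw [mem_ball_zero_iff]; linarith [hballR x hx]
  obtain ⟨B, hB⟩ := ((isCompact_Icc (a := (-2 : ℝ)) (b := 2)).prod
    (isCompact_closedBall x₁ 1)).exists_bound_of_continuousOn
    (hu.mono fun z hz => hmemΩ z.1 hz.1 z.2 hz.2)
  -- near the initial time the barrier is far below `u`
  obtain ⟨sb, hsb2, hsb1, hsb⟩ : ∃ sb, -2 < sb ∧ sb < s₁ ∧ ∀ s, -2 < s → s ≤ sb →
      ∀ x ∈ closedBall x₁ 1, F (s₁, x₁) < F (s, x) := by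
    set W : ℝ := |F (s₁, x₁)| + |B| + 1 with hW
    have hW0 : 0 < W := by positivity
    set η : ℝ := min (1 / 2) ((m / W) ^ (1 / (2 * q - 1))) with hη
    have hη0 : 0 < η := lt_min (by norm_num) (by positivity)
    have hη1 : η ≤ 1 / 2 := min_le_left _ _
    refine ⟨-2 + η, by linarith, by linarith [hs₁.1], fun s hs hsη x hx => ?_⟩
    have hs0 : 0 < s + 2 := by linarith
    have h1 : (s + 2) ^ (2 * q - 1) ≤ m / W := by
      calc (s + 2) ^ (2 * q - 1) ≤ ((m / W) ^ (1 / (2 * q - 1))) ^ (2 * q - 1) := by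
            refine Real.rpow_le_rpow hs0.le ?_ (by linarith)
            exact le_trans (by linarith) (min_le_right _ _)
        _ = m / W := by
            rw [← Real.rpow_mul (by positivity), one_div_mul_cancel (by linarith), Real.rpow_one]
    have h2 : W ≤ m * (s + 2) ^ (1 - 2 * q) := by
      have h3 : (s + 2) ^ (1 - 2 * q) = ((s + 2) ^ (2 * q - 1))⁻¹ := by
        rw [← Real.rpow_neg hs0.le]; congr 1; ring
      have h4 : 0 < (s + 2) ^ (2 * q - 1) := by positivity
      rw [h3, ← div_eq_mul_inv, le_div_iff₀ h4]
      calc W * (s + 2) ^ (2 * q - 1) ≤ W * (m / W) := by gcongr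
        _ = m := by field_simp
    have h5 := abs_le.1 (hB (s, x) ⟨⟨hs.le, by linarith [hs₁.2]⟩, hx⟩)
    have h6 : 0 ≤ A s * ‖x - x₁‖ ^ 2 := mul_nonneg (hA0 s hs).le (by positivity)
    have h7 : F (s, x) = u (s, x) + m * (s + 2) ^ (1 - 2 * q) + A s * ‖x - x₁‖ ^ 2 := by
      simp only [hF, hθ]; ring
    rw [h7]
    have h8 := le_abs_self (F (s₁, x₁))
    have h9 := le_abs_self B
    linarith
  have hFc : ContinuousOn F (Icc sb 2 ×ˢ closedBall x₁ 1) := by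
    have hc1 : ContinuousOn (fun w : ℝ × E => θ w.1) (Icc sb 2 ×ˢ closedBall x₁ 1) :=
      ContinuousOn.comp (g := θ) (t := Icc sb 2)
        (fun s hs => (hθd s (by linarith [hs.1])).continuousAt.continuousWithinAt)
        continuousOn_fst fun w hw => hw.1
    have hc2 : ContinuousOn (fun w : ℝ × E => A w.1) (Icc sb 2 ×ˢ closedBall x₁ 1) :=
      ContinuousOn.comp (g := A) (t := Icc sb 2)
        (fun s hs => (hAd s (by linarith [hs.1])).continuousAt.continuousWithinAt)
        continuousOn_fst fun w hw => hw.1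
    refine ((hu.mono fun z hz => hmemΩ z.1 ⟨by linarith [hz.1.1], hz.1.2⟩ z.2 hz.2).sub hc1).add
      (hc2.mul (by fun_prop))
  have hs₁mem : (s₁, x₁) ∈ Icc sb 2 ×ˢ closedBall x₁ 1 :=
    ⟨⟨hsb1.le, by linarith [hs₁.2]⟩, by simp⟩
  obtain ⟨⟨s, x⟩, ⟨hs, hx⟩, hmin⟩ := (isCompact_Icc.prod
    (isCompact_closedBall x₁ 1)).exists_isMinOn ⟨_, hs₁mem⟩ hFc
  simp only at hs hx
  have hmin1 : F (s, x) ≤ F (s₁, x₁) := hmin hs₁mem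
  have hglob : ∀ s', -2 < s' → s' ≤ 2 → ∀ x' ∈ closedBall x₁ 1, F (s, x) ≤ F (s', x') := by
    intro s' h1 h2 x' hx'
    rcases le_total s' sb with h | h
    · exact hmin1.trans (hsb s' h1 h x' hx').le
    · exact hmin (show (s', x') ∈ Icc sb 2 ×ˢ closedBall x₁ 1 from ⟨⟨h, h2⟩, hx'⟩)
  have hs2 : -2 < s := by linarith [hs.1]
  set ρ : ℝ := s + 2 with hρ
  have hρ0 : 0 < ρ := by linarith
  have hρ4 : ρ ≤ 4 := by linarith [hs.2]
  have hxnorm : ‖x - x₁‖ ≤ 1 := by simpa [dist_eq_norm] using hx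
  -- the minimum is not attained on the lateral boundary
  have hlat : ‖x - x₁‖ < 1 := by
    refine lt_of_le_of_ne hxnorm fun hcon => ?_
    -- Going back by the lag L from the lateral point (s, x) to the axis costs at most (a/2)
    -- ρ^(-2(q-1)) by the time shift inequality. The change of θ costs at most half as much again.
    -- The total stays below A(s), the gain on the lateral boundary, so the axis would have a
    -- smaller value.
    set L : ℝ := ℓ * ρ ^ 2 with hL
    have hL0 : 0 < L := by positivity
    have hLρ : L ≤ ρ / 2 := by
      have : ℓ * ρ ≤ 1 / 8 * 4 := by gcongr
      calc L = ℓ * ρ * ρ := by rw [hL]; ring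
        _ ≤ (1 / 8 * 4) * ρ := by gcongr
        _ = ρ / 2 := by ring
    have hsL : -2 < s - L := by linarith
    have h1 := hshift (s - L) (L / 3) x₁ x (by positivity) (by linarith) (by linarith [hs.2])
      (hballR x₁ (by simp)) (hballR x hx)
    rw [show s - L + 3 * (L / 3) = s by ring] at h1
    have h2 := hglob (s - L) hsL (by linarith [hs.2]) x₁ (by simp)
    simp only [hF, sub_self, norm_zero, hcon] at h2
    have h3 : θ s - θ (s - L) ≤ a / 4 * ρ ^ (-(2 * (q - 1))) := by
      obtain ⟨c, hc, hceq⟩ := exists_hasDerivAt_eq_slope θ (fun s => μ * (s + 2) ^ (-(2 * q)))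
        (show s - L < s by linarith)
        (fun y hy => (hθd y (by linarith [hy.1])).continuousAt.continuousWithinAt)
        (fun y hy => hθd y (by linarith [hy.1]))
      rw [eq_div_iff (by linarith)] at hceq
      have hcρ : ρ / 2 ≤ c + 2 := by linarith [hc.1]
      have h4 : (c + 2) ^ (-(2 * q)) ≤ (ρ / 2) ^ (-(2 * q)) :=
        Real.rpow_le_rpow_of_nonpos (by positivity) hcρ (by linarith)
      have h5 : (ρ / 2) ^ (-(2 * q)) = 4 ^ q * ρ ^ (-(2 * q)) := by
        rw [Real.div_rpow hρ0.le (by norm_num), Real.rpow_neg (by norm_num : (0 : ℝ) ≤ 2),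
          Real.rpow_mul (by norm_num : (0 : ℝ) ≤ 2)]
        norm_num
        ring
      have h6 : ρ ^ 2 * ρ ^ (-(2 * q)) = ρ ^ (-(2 * (q - 1))) := by
        rw [← Real.rpow_natCast, ← Real.rpow_add hρ0]; congr 1; push_cast; ring
      calc θ s - θ (s - L) = μ * (c + 2) ^ (-(2 * q)) * L := by rw [← hceq]; ring
        _ ≤ μ * (4 ^ q * ρ ^ (-(2 * q))) * L := by rw [← h5]; gcongr
        _ = ℓ * (μ * 4 ^ q) * (ρ ^ 2 * ρ ^ (-(2 * q))) := by rw [hL]; ring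
        _ ≤ a / 4 * (ρ ^ 2 * ρ ^ (-(2 * q))) := by gcongr
        _ = _ := by rw [h6]
    have h7 : b * (L / 3) ^ (1 - q) ≤ a / 2 * ρ ^ (-(2 * (q - 1))) := by
      have h8 : (L / 3) ^ (1 - q) = (ℓ / 3) ^ (1 - q) * ρ ^ (-(2 * (q - 1))) := by
        rw [show L / 3 = ℓ / 3 * ρ ^ 2 by rw [hL]; ring, Real.mul_rpow (by positivity)
          (by positivity), ← Real.rpow_natCast, ← Real.rpow_mul hρ0.le]
        congr 2; push_cast; ring
      rw [h8, ← mul_assoc]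
      gcongr
    have h9 : A s = a * ρ ^ (-(2 * (q - 1))) := rfl
    have h10 : 0 < a * ρ ^ (-(2 * (q - 1))) := by positivity
    rw [h9] at h2
    norm_num at h2
    linarith
  -- nor in the interior
  have hs_eq : s = 2 := by
    by_contra hne
    have hslt : s < 2 := lt_of_le_of_ne hs.2 hne
    have hloc : IsLocalMin F (s, x) := by
      have h1 : Ioo (-2 : ℝ) 2 ×ˢ ball x₁ 1 ∈ 𝓝 ((s, x) : ℝ × E) :=
        (isOpen_Ioo.prod isOpen_ball).mem_nhds
          ⟨⟨hs2, hslt⟩, by simpa [mem_ball, dist_eq_norm] using hlat⟩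
      filter_upwards [h1] with w hw
      exact hglob w.1 hw.1.1 hw.1.2.le w.2 (ball_subset_closedBall hw.2)
    -- Since A decreases, its time derivative has the favourable sign. The Hamiltonian and the
    -- constant error take at most a third of θ' each, which contradicts the supersolution property.
    have h := hsuper.timeDeriv_le (z := (s, x)) (hθC s hs2) (hAC s hs2) (hθd s hs2) (hAd s hs2)
      (hmemΩ s ⟨hs2.le, hs.2⟩ x hx) hloc
    simp only [← hρ] at h
    have e1 : 0 ≤ -(a * (1 * (-(2 * (q - 1))) * ρ ^ (-(2 * (q - 1)) - 1)) * ‖x - x₁‖ ^ 2) := by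
      have : -(a * (1 * (-(2 * (q - 1))) * ρ ^ (-(2 * (q - 1)) - 1)) * ‖x - x₁‖ ^ 2) =
        a * (2 * (q - 1)) * ρ ^ (-(2 * (q - 1)) - 1) * ‖x - x₁‖ ^ 2 := by ring
      rw [this]
      have : 0 < q - 1 := by linarith
      positivity
    have e2 : C * (2 * |A s| * ‖x - x₁‖) ^ p ≤ μ / 3 * ρ ^ (-(2 * q)) := by
      have e3 : (2 * |A s| * ‖x - x₁‖) ^ p ≤ (2 * a) ^ p * ρ ^ (-(2 * q)) := by
        calc (2 * |A s| * ‖x - x₁‖) ^ p ≤ (2 * a * ρ ^ (-(2 * (q - 1)))) ^ p := by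
              refine Real.rpow_le_rpow (by positivity) ?_ hp.le
              rw [abs_of_pos (hA0 s hs2)]
              have : A s = a * ρ ^ (-(2 * (q - 1))) := rfl
              rw [this, ← mul_assoc]
              exact mul_le_of_le_one_right (by positivity) hlat.le
          _ = (2 * a) ^ p * ρ ^ (-(2 * q)) := by
              rw [Real.mul_rpow (by positivity) (by positivity), ← Real.rpow_mul hρ0.le]
              congr 2
              linear_combination -2 * hqq
      calc C * (2 * |A s| * ‖x - x₁‖) ^ p ≤ C * ((2 * a) ^ p * ρ ^ (-(2 * q))) := by gcongr
        _ = C * (2 * a) ^ p * ρ ^ (-(2 * q)) := by ring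
        _ ≤ _ := by gcongr
    have e4 : C * ε ≤ μ / 3 * ρ ^ (-(2 * q)) := by
      refine hε.trans ?_
      gcongr ?_ * ?_
      exact Real.rpow_le_rpow_of_nonpos hρ0 hρ4 (by linarith)
    have e5 : 0 < μ * ρ ^ (-(2 * q)) := by positivity
    linarith
  subst hs_eq
  refine ⟨x, hballR x hx, ?_⟩
  simp only [hF, hθ, sub_self, norm_zero] at hmin1
  have e1 : 0 ≤ A 2 * ‖x - x₁‖ ^ 2 := mul_nonneg (hA0 2 (by norm_num)).le (by positivity)
  have e2 : m * (s₁ + 2) ^ (1 - 2 * q) ≤ m := by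
    refine mul_le_of_le_one_right hm0.le ?_
    exact Real.rpow_le_one_of_one_le_of_nonpos (by linarith [hs₁.1]) (by linarith)
  have e3 : 0 ≤ m * ((2 : ℝ) + 2) ^ (1 - 2 * q) := by positivity
  norm_num at hmin1 e3
  linarith

theorem HasSmallGradient.mono {p C r R N e ε : ℝ} (hC : 0 ≤ C) {u g : ℝ × E → ℝ} {G : ℝ × E → E}
    (h : HasSmallGradient p C r R N e u g G) (he : e ≤ ε) :
    HasSmallGradient p C r R N ε u g G :=
  { h with
    super := fun φ hφ z hz hmin => by
      have h1 := h.super φ hφ z hz hmin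
      have h2 : C * e ≤ C * ε := by gcongr
      linarith
    integral_grad_le := h.integral_grad_le.trans he
    integral_source_le := h.integral_source_le.trans he }

/-- Smallness of the gradient and of the sources forces a small oscillation. -/
theorem exists_oscillation_const [NeZero d] {p r C R N w : ℝ} (hp : 1 < p)
    (hC : 0 < C) (hr : 1 + d / p < r) (hR : 0 ≤ R) (hN : 0 ≤ N) (hw : 0 < w) :
    ∃ ε > 0, ∀ (u g : ℝ × E → ℝ) (G : ℝ × E → E) (e : ℝ), e ≤ ε →
      HasSmallGradient p C r (R + 2) N e u g G →
      ∀ z₁ ∈ Icc (-1 : ℝ) 1 ×ˢ closedBall (0 : E) (R - 1),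
      ∀ z₂ ∈ Icc (-1 : ℝ) 1 ×ˢ closedBall (0 : E) (R - 1), u z₂ ≤ u z₁ + w := by
  set q : ℝ := p / (p - 1) with hqdef
  have hpq : p.HolderConjugate q := Real.HolderConjugate.conjExponent hp
  have hq1 := hpq.symm.lt
  have hp0 := hpq.pos
  -- Half of w is spent on the barrier, from z₁ to some point x at time 2, and half on the time
  -- shift from z₂ to that same x. The latter lag is at least 1, whence the factor (1/3)^(1-q). The
  -- constants are fixed in the order a, ℓ, b, ε.
  set μ : ℝ := w / 2 with hμdef
  have hμ : 0 < μ := by positivity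
  set a : ℝ := (μ / (3 * C)) ^ (1 / p) / 2 with hadef
  have ha : 0 < a := by positivity
  have haμ : C * (2 * a) ^ p ≤ μ / 3 := by
    rw [hadef, mul_div_cancel₀ _ (two_ne_zero), ← Real.rpow_mul (by positivity),
      one_div_mul_cancel hp0.ne', Real.rpow_one]
    apply le_of_eq; field_simp
  set ℓ : ℝ := min (1 / 8) (a / 4 / (μ * 4 ^ q)) with hℓdef
  have hℓ : 0 < ℓ := lt_min (by norm_num) (by positivity)
  have hℓa : ℓ * (μ * 4 ^ q) ≤ a / 4 := by
    rw [← le_div_iff₀ (by positivity)]; exact min_le_right _ _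
  set b : ℝ := min (a / 2 / (ℓ / 3) ^ (1 - q)) (w / 2 / (1 / 3) ^ (1 - q)) with hbdef
  have hb : 0 < b := lt_min (by positivity) (by positivity)
  have hba : b * (ℓ / 3) ^ (1 - q) ≤ a / 2 := by
    rw [← le_div_iff₀ (by positivity)]; exact min_le_left _ _
  have hbw : b * (1 / 3) ^ (1 - q) ≤ w / 2 := by
    rw [← le_div_iff₀ (by positivity)]; exact min_le_right _ _
  obtain ⟨ε₁, hε₁, hshift⟩ := exists_time_shift_const (a := b) hpq hC hr hR hN hb
  refine ⟨min ε₁ (μ / 3 * 4 ^ (-(2 * q)) / C), lt_min hε₁ (by positivity), ?_⟩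
  intro u g G e he h z₁ hz₁ z₂ hz₂
  replace h := h.mono hC.le he
  set ε := min ε₁ (μ / 3 * 4 ^ (-(2 * q)) / C) with hε
  have hCε : C * ε ≤ μ / 3 * 4 ^ (-(2 * q)) := by
    rw [mul_comm, ← le_div_iff₀ hC]; exact min_le_right _ _
  have hsh := hshift u g G (h.mono hC.le (min_le_left _ _))
  have hn₁ : ‖z₁.2‖ ≤ R - 1 := by simpa using hz₁.2
  have hn₂ : ‖z₂.2‖ ≤ R - 1 := by simpa using hz₂.2
  obtain ⟨x, hx, hux⟩ := exists_late_le hpq hC hμ ha hℓ (min_le_left _ _) haμ hℓa hba hCε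
    h.continuousOn h.super hsh (s₁ := z₁.1) (x₁ := z₁.2) hz₁.1 (by linarith)
  have h1 : z₂.1 ≤ 1 := hz₂.1.2
  have h0 : -1 ≤ z₂.1 := hz₂.1.1
  have h2 := hsh z₂.1 ((2 - z₂.1) / 3) z₂.2 x (by linarith) (by linarith) (by linarith)
    (by linarith) hx
  rw [show z₂.1 + 3 * ((2 - z₂.1) / 3) = 2 by ring] at h2
  have h3 : b * ((2 - z₂.1) / 3) ^ (1 - q) ≤ w / 2 := by
    refine le_trans ?_ hbw
    gcongr ?_ * ?_
    exact Real.rpow_le_rpow_of_nonpos (by norm_num) (by linarith) (by linarith)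
  simp only [Prod.mk.eta] at h2 hux
  linarith

end OscillationBound

/-! ### Lipschitz approximation by sup-convolution. -/

section Approximation
open Filter Topology Metric
open scoped NNReal

variable {d : ℕ}

local notation "E" => EuclideanSpace ℝ (Fin d)

/-- The gradient in the space variable, read off the full derivative. -/
noncomputable def fderivSpace (U : ℝ × E → ℝ) (z : ℝ × E) : E :=
  (InnerProductSpace.toDual ℝ E).symm ((fderiv ℝ U z).comp (ContinuousLinearMap.inr ℝ ℝ E))

theorem inner_fderivSpace (U : ℝ × E → ℝ) (z : ℝ × E) (e : E) :
    inner ℝ (fderivSpace U z) e = fderiv ℝ U z (0, e) := by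
  simp [fderivSpace]

theorem fderivSpace_apply (U : ℝ × E → ℝ) (z : ℝ × E) (i : Fin d) :
    fderivSpace U z i = fderiv ℝ U z (0, EuclideanSpace.single i 1) := by
  rw [← inner_fderivSpace]; simp [EuclideanSpace.inner_single_right]

theorem spaceGrad_eq_fderivSpace {U : ℝ × E → ℝ} {z : ℝ × E} (h : DifferentiableAt ℝ U z) :
    spaceGrad U z = fderivSpace U z := by
  refine ext_inner_right ℝ fun e => ?_
  rw [inner_spaceGrad h, inner_fderivSpace]

theorem measurable_fderivSpace (U : ℝ × E → ℝ) : Measurable (fderivSpace U) := by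
  have h1 : Measurable (fderiv ℝ U) := measurable_fderiv ℝ U
  have h2 : Continuous fun T : (ℝ × E) →L[ℝ] ℝ =>
      (InnerProductSpace.toDual ℝ E).symm (T.comp (ContinuousLinearMap.inr ℝ ℝ E)) :=
    (InnerProductSpace.toDual ℝ E).symm.continuous.comp
      (ContinuousLinearMap.compL ℝ E (ℝ × E) ℝ |>.flip _).continuous
  exact h2.measurable.comp h1

theorem norm_fderivSpace_le {U : ℝ × E → ℝ} {L : ℝ≥0} (hU : LipschitzWith L U) (z : ℝ × E) :
    ‖fderivSpace U z‖ ≤ L := by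
  rw [fderivSpace, LinearIsometryEquiv.norm_map]
  calc ‖(fderiv ℝ U z).comp (ContinuousLinearMap.inr ℝ ℝ E)‖
      ≤ ‖fderiv ℝ U z‖ * ‖ContinuousLinearMap.inr ℝ ℝ E‖ := ContinuousLinearMap.opNorm_comp_le _ _
    _ ≤ L * 1 := by
        gcongr
        · exact norm_fderiv_le_of_lipschitz ℝ hU
        · exact ContinuousLinearMap.norm_inr_le_one ℝ ℝ E
    _ = L := mul_one _

/-- A viscosity subsolution is a uniform limit, on compact sets, of Lipschitz functions which are
almost everywhere subsolutions. -/
theorem IsViscositySub.exists_lipschitz_approx {p C : ℝ} {f u : ℝ × E → ℝ} {Ω : Set (ℝ × E)}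
    (hΩ : IsOpen Ω) (hu : ContinuousOn u Ω) (hf : ContinuousOn f Ω)
    (hsub : IsViscositySub p C f Ω u) {K : Set (ℝ × E)} (hK : IsCompact K) (hKΩ : K ⊆ Ω) {ε : ℝ}
    (hε : 0 < ε) :
    ∃ (L : ℝ≥0) (U : ℝ × E → ℝ), LipschitzWith L U ∧ (∀ z ∈ K, |U z - u z| ≤ ε) ∧
      ∀ z ∈ K, DifferentiableAt ℝ U z →
        -fderiv ℝ U z (1, 0) + 1 / C * ‖fderivSpace U z‖ ^ p ≤ f z + ε := by
  rcases K.eq_empty_or_nonempty with rfl | hKne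
  · exact ⟨0, fun _ => 0, LipschitzWith.const _, by simp, by simp⟩
  obtain ⟨δ₀, hδ₀, hδ₀Ω⟩ := hK.exists_cthickening_subset_open hΩ hKΩ
  set K₀ := cthickening δ₀ K with hK₀
  have hK₀c : IsCompact K₀ := hK.cthickening
  have hKK₀ : K ⊆ K₀ := self_subset_cthickening K
  obtain ⟨δ₁, hδ₁, huδ⟩ := Metric.uniformContinuousOn_iff.1
    (hK₀c.uniformContinuousOn_of_continuous (hu.mono hδ₀Ω)) ε hε
  obtain ⟨δ₂, hδ₂, hfδ⟩ := Metric.uniformContinuousOn_iff.1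
    (hK₀c.uniformContinuousOn_of_continuous (hf.mono hδ₀Ω)) ε hε
  set δ := min δ₀ (min δ₁ δ₂) with hδ
  have hδpos : 0 < δ := lt_min hδ₀ (lt_min hδ₁ hδ₂)
  obtain ⟨B, hB⟩ := hK₀c.exists_bound_of_continuousOn (hu.mono hδ₀Ω)
  let χ : ContDiffBump (0 : ℝ × E) := ⟨δ / 2, δ, by positivity, by linarith⟩
  -- The approximation is a sup-convolution with the penalty n(1 - χ) in place of a quadratic one.
  -- It is Lipschitz, and at distance at least δ it equals n, more than twice the bound of u, so for
  -- z in K the maximising point lies within δ of z.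
  set n : ℝ := 2 * |B| + 1 with hn
  have hn0 : 0 < n := by positivity
  set P : ℝ × E → ℝ := fun z => n * (1 - χ z) with hP
  have hχC : ContDiff ℝ 1 χ := χ.contDiff
  have hPC : ContDiff ℝ 1 P := contDiff_const.mul (contDiff_const.sub hχC)
  have hPd : Differentiable ℝ P := hPC.differentiable (by simp)
  have hP0 : P 0 = 0 := by
    simp [hP, χ.one_of_mem_closedBall (mem_closedBall_self χ.rIn_pos.le)]
  have hPnn : ∀ z, 0 ≤ P z := fun z => mul_nonneg hn0.le (sub_nonneg.2 χ.le_one)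
  have hPfar : ∀ z, P z < n → ‖z‖ < δ := by
    intro z hz
    by_contra! hcon
    have : χ z = 0 := χ.zero_of_le_dist (by rw [dist_zero_right]; exact hcon)
    simp [hP, this] at hz
  obtain ⟨L₀, hL₀⟩ := hχC.lipschitzWith_of_hasCompactSupport χ.hasCompactSupport (by simp)
  set L : ℝ≥0 := n.toNNReal * L₀ with hL
  have hLP : LipschitzWith L P := by
    refine LipschitzWith.of_dist_le_mul fun z z' => ?_
    have h1 := hL₀.dist_le_mul z z'
    rw [Real.dist_eq] at h1 ⊢
    have h2 : P z - P z' = -(n * (χ z - χ z')) := by simp only [hP]; ring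
    rw [h2, abs_neg, abs_mul, abs_of_pos hn0, hL, NNReal.coe_mul, Real.coe_toNNReal _ hn0.le,
      mul_assoc]
    gcongr
  have hcont : ∀ z, ContinuousOn (fun w => u w - P (z - w)) K₀ := fun z =>
    (hu.mono hδ₀Ω).sub (hPC.continuous.comp (by fun_prop)).continuousOn
  have hmax : ∀ z, ∃ w ∈ K₀, ∀ w' ∈ K₀, u w' - P (z - w') ≤ u w - P (z - w) := fun z =>
    hK₀c.exists_isMaxOn (hKne.mono hKK₀) (hcont z)
  choose W hW hWmax using hmax
  set U : ℝ × E → ℝ := fun z => u (W z) - P (z - W z) with hU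
  have hUge : ∀ z, ∀ w ∈ K₀, u w - P (z - w) ≤ U z := fun z w hw => hWmax z w hw
  have hULip : LipschitzWith L U := by
    refine LipschitzWith.of_le_add_mul L fun z z' => ?_
    have h1 := hUge z' (W z) (hW z)
    have h2 := hLP.dist_le_mul (z' - W z) (z - W z)
    rw [Real.dist_eq, dist_sub_right, dist_comm] at h2
    have h3 := (abs_le.1 h2).2
    have h4 : U z = u (W z) - P (z - W z) := rfl
    linarith
  have hloc : ∀ z ∈ K, ‖z - W z‖ < δ := by
    intro z hz
    apply hPfar
    have h1 := hUge z z (hKK₀ hz)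
    rw [sub_self, hP0] at h1
    have h2 := abs_le.1 (hB z (hKK₀ hz))
    have h3 := abs_le.1 (hB (W z) (hW z))
    have h4 : U z = u (W z) - P (z - W z) := rfl
    have h5 := le_abs_self B
    linarith
  refine ⟨L, U, hULip, fun z hz => ?_, fun z hz hdiff => ?_⟩
  · have h1 := hUge z z (hKK₀ hz)
    rw [sub_self, hP0] at h1
    have h2 := huδ (W z) (hW z) z (hKK₀ hz) (by
      rw [dist_comm, dist_eq_norm]
      exact (hloc z hz).trans_le ((min_le_right _ _).trans (min_le_left _ _)))
    rw [Real.dist_eq] at h2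
    have h3 := abs_lt.1 h2
    have h4 : U z = u (W z) - P (z - W z) := rfl
    have h5 := hPnn (z - W z)
    rw [abs_le]; constructor <;> linarith
  · set w := W z with hw
    set φ : ℝ × E → ℝ := fun w' => P (z - w') with hφ
    have hφC : ContDiff ℝ 1 φ := hPC.comp (contDiff_const.sub contDiff_id)
    have hφd : Differentiable ℝ φ := hφC.differentiable (by simp)
    have hwnhds : K₀ ∈ 𝓝 w := by
      have h1 : w ∈ thickening δ₀ K := by
        rw [mem_thickening_iff]
        refine ⟨z, hz, ?_⟩
        rw [dist_comm, dist_eq_norm]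
        exact (hloc z hz).trans_le (min_le_left _ _)
      exact mem_of_superset (isOpen_thickening.mem_nhds h1) (thickening_subset_cthickening _ _)
    have hlocmax : IsLocalMax (fun w' => u w' - φ w') w := by
      filter_upwards [hwnhds] with w' hw'
      exact hWmax z w' hw'
    have h1 := hsub.le_of_contDiffAt hφC.contDiffAt (hδ₀Ω (hW z)) hlocmax
    -- U is touched from below at z by a translate of -P centred at w, and u from above at w by the
    -- reflected penalty φ. Both have derivative -DP(z - w), so the viscosity inequality at w
    -- becomes one for the derivative of U at z.
    have hfd : fderiv ℝ φ w = fderiv ℝ U z := by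
      have e1 : HasFDerivAt φ (-(fderiv ℝ P (z - w))) w := by
        have h2 : HasFDerivAt (fun w' : ℝ × E => z - w') (-ContinuousLinearMap.id ℝ (ℝ × E)) w :=
          (hasFDerivAt_id w).const_sub z
        have h3 := (hPd (z - w)).hasFDerivAt.comp w h2
        refine h3.congr_fderiv ?_
        ext <;> simp
      have e2 : HasFDerivAt (fun z' => u w - P (z' - w)) (-(fderiv ℝ P (z - w))) z := by
        have h2 : HasFDerivAt (fun z' : ℝ × E => z' - w) (ContinuousLinearMap.id ℝ (ℝ × E)) z :=
          (hasFDerivAt_id z).sub_const w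
        have h3 := ((hPd (z - w)).hasFDerivAt.comp z h2).const_sub (u w)
        exact h3
      have e3 : IsLocalMin (fun z' => U z' - (u w - P (z' - w))) z := by
        refine Eventually.of_forall fun z' => ?_
        have h4 : U z = u w - P (z - w) := rfl
        have h5 := hUge z' w (hW z)
        simp only [h4, sub_self]
        linarith
      have e4 := e3.hasFDerivAt_eq_zero (hdiff.hasFDerivAt.sub e2)
      rw [e1.fderiv]
      exact (sub_eq_zero.1 e4).symm
    rw [timeDeriv_eq_fderiv (hφd w), spaceGrad_eq_fderivSpace (hφd w), fderivSpace, hfd] at h1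
    have h2 := hfδ w (hW z) z (hKK₀ hz) (by
      rw [dist_comm, dist_eq_norm]
      exact (hloc z hz).trans_le ((min_le_right _ _).trans (min_le_right _ _)))
    rw [Real.dist_eq] at h2
    have h3 := abs_lt.1 h2
    rw [fderivSpace]
    linarith

end Approximation

/-! ### Selection of strongly convergent sequences from midpoint-convex sets. -/

section Komlos
open Filter Topology

variable {F : Type*} [NormedAddCommGroup F] [InnerProductSpace ℝ F]

/-- Quantitative strict convexity of `a ↦ √(1 + ‖a‖²)`. -/
theorem norm_sub_sq_le_sqrt_gap (a b : F) :
    ‖a - b‖ ^ 2 ≤ 8 * (1 + ‖a‖ + ‖b‖) ^ 3 * ((√(1 + ‖a‖ ^ 2) + √(1 + ‖b‖ ^ 2)) / 2 -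
      √(1 + ‖(1 / 2 : ℝ) • (a + b)‖ ^ 2)) := by
  set A := √(1 + ‖a‖ ^ 2) with hA
  set B := √(1 + ‖b‖ ^ 2) with hB
  set M := √(1 + ‖(1 / 2 : ℝ) • (a + b)‖ ^ 2) with hM
  set s := 1 + ‖a‖ + ‖b‖ with hs
  have na := norm_nonneg a
  have nb := norm_nonneg b
  have hA2 : A ^ 2 = 1 + ‖a‖ ^ 2 := Real.sq_sqrt (by positivity)
  have hB2 : B ^ 2 = 1 + ‖b‖ ^ 2 := Real.sq_sqrt (by positivity)
  have hM2 : M ^ 2 = 1 + ‖(1 / 2 : ℝ) • (a + b)‖ ^ 2 := Real.sq_sqrt (by positivity)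
  have hn : ‖(1 / 2 : ℝ) • (a + b)‖ = ‖a + b‖ / 2 := by
    rw [norm_smul]; norm_num; ring
  have hadd : ‖a + b‖ ^ 2 = ‖a‖ ^ 2 + 2 * inner ℝ a b + ‖b‖ ^ 2 := norm_add_sq_real a b
  have hsub : ‖a - b‖ ^ 2 = ‖a‖ ^ 2 - 2 * inner ℝ a b + ‖b‖ ^ 2 := norm_sub_sq_real a b
  have hcs : (inner ℝ a b) ^ 2 ≤ ‖a‖ ^ 2 * ‖b‖ ^ 2 := by
    rw [← mul_pow]; exact sq_le_sq' (by have := neg_le_of_abs_le (abs_real_inner_le_norm a b); linarith)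
      (real_inner_le_norm a b)
  set c := inner ℝ a b with hc
  have hA1 : 1 ≤ A := by rw [hA, Real.one_le_sqrt]; nlinarith
  have hB1 : 1 ≤ B := by rw [hB, Real.one_le_sqrt]; nlinarith
  have hM0 : 0 ≤ M := Real.sqrt_nonneg _
  have hAs : A ≤ s := Real.sqrt_le_iff.2 ⟨by positivity, by nlinarith⟩
  have hBs : B ≤ s := Real.sqrt_le_iff.2 ⟨by positivity, by nlinarith⟩
  have hMs : M ≤ s := by
    refine Real.sqrt_le_iff.2 ⟨by positivity, ?_⟩
    rw [hn]
    have := pow_le_pow_left₀ (norm_nonneg (a + b)) (norm_add_le a b) 2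
    nlinarith
  have hs1 : 1 ≤ s := by linarith
  -- AB and 1 + c are the product of the norms and the inner product of (1, a) and (1, b). The
  -- Cauchy–Schwarz defect controls |a - b|², and it is also half of (A + B)² - (2M)².
  have h1 : ‖a - b‖ ^ 2 ≤ (A * B) ^ 2 - (1 + c) ^ 2 := by
    rw [mul_pow, hA2, hB2, hsub]; linarith
  have hAB : |1 + c| ≤ A * B := by
    refine abs_le_of_sq_le_sq ?_ (by positivity)
    linarith [sq_nonneg ‖a - b‖]
  have hAB' := abs_le.1 hAB
  have h2 : ‖a - b‖ ^ 2 ≤ (A * B - (1 + c)) * (2 * (A * B)) := by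
    refine h1.trans ?_
    rw [show (A * B) ^ 2 - (1 + c) ^ 2 = (A * B - (1 + c)) * (A * B + (1 + c)) by ring]
    exact mul_le_mul_of_nonneg_left (by linarith) (by linarith)
  have h3 : (A + B - 2 * M) * (A + B + 2 * M) = 2 * (A * B - (1 + c)) := by
    have : (A + B - 2 * M) * (A + B + 2 * M) = A ^ 2 + B ^ 2 + 2 * (A * B) - 4 * M ^ 2 := by ring
    rw [this, hA2, hB2, hM2, hn]; linarith
  have h4 : 0 ≤ A + B - 2 * M := by
    by_contra hcon
    have : (A + B - 2 * M) * (A + B + 2 * M) < 0 :=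
      mul_neg_of_neg_of_pos (not_le.1 hcon) (by linarith)
    linarith
  calc ‖a - b‖ ^ 2 ≤ (A * B - (1 + c)) * (2 * (A * B)) := h2
    _ = (A + B - 2 * M) * ((A + B + 2 * M) * (A * B)) := by linear_combination -(A * B) * h3
    _ ≤ (A + B - 2 * M) * ((4 * s) * (s * s)) := by gcongr; linarith
    _ = _ := by ring

/-- Where 1 + |a| + |b| ≤ N, the quadratic estimate is linearised with the parameter κ. Elsewhere
p-th powers carry the small factor N^(1-p). Taking κ small and N large first, L¹ distances become
small as soon as the convexity gap is. -/
theorem norm_sub_le_sqrt_gap {p κ N : ℝ} (hp : 1 < p) (hκ : 0 < κ) (hN : 0 < N) (a b : F) :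
    ‖a - b‖ ≤ κ + 2 * N ^ 3 / κ * ((√(1 + ‖a‖ ^ 2) + √(1 + ‖b‖ ^ 2)) / 2 -
      √(1 + ‖(1 / 2 : ℝ) • (a + b)‖ ^ 2)) + N ^ (1 - p) * 3 ^ p * (1 + ‖a‖ ^ p + ‖b‖ ^ p) := by
  have hgap := norm_sub_sq_le_sqrt_gap a b
  set g := (√(1 + ‖a‖ ^ 2) + √(1 + ‖b‖ ^ 2)) / 2 - √(1 + ‖(1 / 2 : ℝ) • (a + b)‖ ^ 2)
  set s := 1 + ‖a‖ + ‖b‖ with hs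
  have hs0 : 0 < s := by positivity
  have hg : 0 ≤ g := by
    by_contra hcon
    have : 8 * s ^ 3 * g < 0 := mul_neg_of_pos_of_neg (by positivity) (not_le.1 hcon)
    linarith [sq_nonneg ‖a - b‖]
  have hab : ‖a - b‖ ≤ s := (norm_sub_le a b).trans (by linarith)
  rcases le_total s N with h | h
  · have h1 : ‖a - b‖ ^ 2 ≤ 8 * N ^ 3 * g := hgap.trans (by gcongr)
    have h2 : ‖a - b‖ ≤ κ + ‖a - b‖ ^ 2 / (4 * κ) := by
      rw [← sub_nonneg]
      have : κ + ‖a - b‖ ^ 2 / (4 * κ) - ‖a - b‖ = (2 * κ - ‖a - b‖) ^ 2 / (4 * κ) := by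
        field_simp; ring
      rw [this]; positivity
    have h3 : ‖a - b‖ ^ 2 / (4 * κ) ≤ 2 * N ^ 3 / κ * g := by
      calc ‖a - b‖ ^ 2 / (4 * κ) ≤ 8 * N ^ 3 * g / (4 * κ) := by gcongr
        _ = _ := by field_simp; ring
    have h4 : 0 ≤ N ^ (1 - p) * 3 ^ p * (1 + ‖a‖ ^ p + ‖b‖ ^ p) := by positivity
    linarith
  · have h1 : s = s ^ (1 - p) * s ^ p := by
      rw [← Real.rpow_add hs0]; simp
    have h2 : s ^ (1 - p) ≤ N ^ (1 - p) :=
      Real.rpow_le_rpow_of_nonpos hN h (by linarith)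
    set m := max 1 (max ‖a‖ ‖b‖) with hm
    have hm1 : 1 ≤ m := le_max_left _ _
    have h3 : s ≤ 3 * m := by
      have := le_max_left ‖a‖ ‖b‖
      have := le_max_right ‖a‖ ‖b‖
      have := le_max_right 1 (max ‖a‖ ‖b‖)
      linarith
    have h4 : m ^ p ≤ 1 + ‖a‖ ^ p + ‖b‖ ^ p := by
      have e1 : 0 ≤ ‖a‖ ^ p := by positivity
      have e2 : 0 ≤ ‖b‖ ^ p := by positivity
      rcases max_choice 1 (max ‖a‖ ‖b‖) with h | h
      · rw [hm, h, Real.one_rpow]; linarith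
      · rw [hm, h]
        rcases max_choice ‖a‖ ‖b‖ with h | h <;> rw [h] <;> linarith
    have h5 : s ^ p ≤ 3 ^ p * (1 + ‖a‖ ^ p + ‖b‖ ^ p) := by
      calc s ^ p ≤ (3 * m) ^ p := by gcongr
        _ = 3 ^ p * m ^ p := Real.mul_rpow (by norm_num) (by positivity)
        _ ≤ _ := by gcongr
    have h6 : s ≤ N ^ (1 - p) * (3 ^ p * (1 + ‖a‖ ^ p + ‖b‖ ^ p)) := by
      calc s = s ^ (1 - p) * s ^ p := h1
        _ ≤ _ := by gcongr
    have h7 : 0 ≤ 2 * N ^ 3 / κ * g := by positivity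
    rw [← mul_assoc] at h6
    linarith

/-- A Komlós-type theorem: from a decreasing sequence of nonempty midpoint-convex sets, bounded in
`L^p` for some `p > 1`, one can choose representatives converging almost everywhere and in `L¹`. -/
theorem exists_seq_tendsto_of_midpoint_mem {X : Type*} [MeasurableSpace X] {μ : Measure X}
    [IsFiniteMeasure μ] [CompleteSpace F] {p B : ℝ} (hp : 1 < p) {S : ℕ → Set (X → F)}
    (hanti : Antitone S) (hne : ∀ k, (S k).Nonempty)
    (hmid : ∀ k, ∀ a ∈ S k, ∀ b ∈ S k, (fun z => (1 / 2 : ℝ) • (a z + b z)) ∈ S k)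
    (hmeas : ∀ k, ∀ a ∈ S k, AEStronglyMeasurable a μ)
    (hint : ∀ k, ∀ a ∈ S k, Integrable (fun z => ‖a z‖ ^ p) μ)
    (hB : ∀ k, ∀ a ∈ S k, ∫ z, ‖a z‖ ^ p ∂μ ≤ B) :
    ∃ (h : ℕ → X → F) (G : X → F), (∀ k, h k ∈ S k) ∧ Integrable G μ ∧
      (∀ᵐ z ∂μ, Tendsto (fun k => h k z) atTop (𝓝 (G z))) ∧
      Tendsto (fun k => ∫ z, ‖h k z - G z‖ ∂μ) atTop (𝓝 0) := by
  set m := μ.real univ with hmdef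
  have hm0 : 0 ≤ m := measureReal_nonneg
  have hnorm : ∀ (x : F), ‖x‖ ≤ 1 + ‖x‖ ^ p := fun x => by
    have e1 : 0 ≤ ‖x‖ ^ p := by positivity
    rcases le_total ‖x‖ 1 with h | h
    · linarith
    · have := Real.rpow_le_rpow_of_exponent_le h hp.le
      rw [Real.rpow_one] at this; linarith
  have hI : ∀ k, ∀ a ∈ S k, Integrable a μ := fun k a ha => by
    refine Integrable.mono' ((integrable_const (1 : ℝ)).add (hint k a ha)) (hmeas k a ha)
      (Eventually.of_forall fun z => hnorm _)
  have hsq : ∀ x : F, √(1 + ‖x‖ ^ 2) ≤ 1 + ‖x‖ := fun x =>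
    Real.sqrt_le_iff.2 ⟨by positivity, by nlinarith [norm_nonneg x]⟩
  have hIs : ∀ k, ∀ a ∈ S k, Integrable (fun z => √(1 + ‖a z‖ ^ 2)) μ := fun k a ha => by
    refine Integrable.mono' ((integrable_const (1 : ℝ)).add (hI k a ha).norm) ?_
      (Eventually.of_forall fun z => ?_)
    · exact (Real.continuous_sqrt.comp (continuous_const.add
        (continuous_norm.pow 2))).comp_aestronglyMeasurable (hmeas k a ha)
    · rw [Real.norm_of_nonneg (Real.sqrt_nonneg _)]; exact hsq _
  -- J is a convex functional whose midpoint gap controls the L¹ distance of p-bounded functions.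
  -- Nearly minimising it on each set replaces weak compactness.
  set J : (X → F) → ℝ := fun a => ∫ z, √(1 + ‖a z‖ ^ 2) ∂μ with hJ
  have hJ0 : ∀ a, 0 ≤ J a := fun a => integral_nonneg fun z => Real.sqrt_nonneg _
  have hJB : ∀ k, ∀ a ∈ S k, J a ≤ 2 * m + B := fun k a ha => by
    have : J a ≤ ∫ z, ((2 : ℝ) + ‖a z‖ ^ p) ∂μ := by
      refine integral_mono (hIs k a ha) ((integrable_const _).add (hint k a ha)) fun z => ?_
      have := hsq (a z); have := hnorm (a z); dsimp only; linarith
    rw [integral_add (integrable_const _) (hint k a ha)] at this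
    simp only [integral_const, smul_eq_mul] at this
    have := hB k a ha
    linarith
  set α : ℕ → ℝ := fun k => sInf (J '' S k) with hα
  have hbdd : ∀ k, BddBelow (J '' S k) := fun k => ⟨0, by rintro _ ⟨a, -, rfl⟩; exact hJ0 a⟩
  have hαle : ∀ k, ∀ a ∈ S k, α k ≤ J a := fun k a ha =>
    csInf_le (hbdd k) (mem_image_of_mem _ ha)
  have hαmono : Monotone α := fun k l hkl =>
    csInf_le_csInf (hbdd k) ((hne l).image _) (image_mono (hanti hkl))
  have hαB : BddAbove (range α) := ⟨2 * m + B, by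
    rintro _ ⟨k, rfl⟩
    obtain ⟨a, ha⟩ := hne k
    exact (hαle k a ha).trans (hJB k a ha)⟩
  have hαlim := tendsto_atTop_ciSup hαmono hαB
  set A := ⨆ k, α k with hA
  have hαA : ∀ k, α k ≤ A := fun k => le_ciSup hαB k
  have hex : ∀ k : ℕ, ∃ a ∈ S k, J a ≤ α k + 1 / (k + 1) := fun k => by
    obtain ⟨_, ⟨a, ha, rfl⟩, hlt⟩ := Real.lt_sInf_add_pos ((hne k).image J)
      (ε := 1 / ((k : ℝ) + 1)) (by positivity)
    exact ⟨a, ha, hlt.le⟩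
  choose h hS hJh using hex
  -- For k ≤ l the midpoint of h k and h l still lies in S k, so J there is at least α k. The gap is
  -- thus bounded by A - α k + 1/(k + 1), which tends to 0 because the infima increase to A.
  have hpair : ∀ κ N : ℝ, 0 < κ → 0 < N → ∀ k l : ℕ, k ≤ l →
      ∫ z, ‖h k z - h l z‖ ∂μ ≤ κ * m + 2 * N ^ 3 / κ * (A - α k + 1 / (k + 1)) +
        N ^ (1 - p) * 3 ^ p * (m + 2 * B) := by
    intro κ N hκ hN k l hkl
    have hlk : h l ∈ S k := hanti hkl (hS l)
    have hmem := hmid k _ (hS k) _ hlk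
    have i1 := hIs k _ (hS k)
    have i2 := hIs k _ hlk
    have i3 := hIs k _ hmem
    have j1 := hint k _ (hS k)
    have j2 := hint k _ hlk
    have i12 : Integrable (fun z => (√(1 + ‖h k z‖ ^ 2) + √(1 + ‖h l z‖ ^ 2)) / 2) μ :=
      (i1.add i2).div_const 2
    have ig : Integrable (fun z => (√(1 + ‖h k z‖ ^ 2) + √(1 + ‖h l z‖ ^ 2)) / 2 -
        √(1 + ‖(1 / 2 : ℝ) • (h k z + h l z)‖ ^ 2)) μ := i12.sub i3
    have ip' : Integrable (fun z => 1 + ‖h k z‖ ^ p) μ := (integrable_const 1).add j1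
    have ip : Integrable (fun z => 1 + ‖h k z‖ ^ p + ‖h l z‖ ^ p) μ := ip'.add j2
    have ik : Integrable (fun z => κ + 2 * N ^ 3 / κ *
        ((√(1 + ‖h k z‖ ^ 2) + √(1 + ‖h l z‖ ^ 2)) / 2 -
          √(1 + ‖(1 / 2 : ℝ) • (h k z + h l z)‖ ^ 2))) μ :=
      (integrable_const _).add (ig.const_mul _)
    have h1 : ∫ z, ‖h k z - h l z‖ ∂μ ≤ ∫ z, (κ + 2 * N ^ 3 / κ *
        ((√(1 + ‖h k z‖ ^ 2) + √(1 + ‖h l z‖ ^ 2)) / 2 -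
          √(1 + ‖(1 / 2 : ℝ) • (h k z + h l z)‖ ^ 2)) +
        N ^ (1 - p) * 3 ^ p * (1 + ‖h k z‖ ^ p + ‖h l z‖ ^ p)) ∂μ := by
      refine integral_mono ((hI k _ (hS k)).sub (hI k _ hlk)).norm ?_ fun z =>
        norm_sub_le_sqrt_gap hp hκ hN _ _
      exact ik.add (ip.const_mul _)
    have h2 : ∫ z, ((√(1 + ‖h k z‖ ^ 2) + √(1 + ‖h l z‖ ^ 2)) / 2 -
          √(1 + ‖(1 / 2 : ℝ) • (h k z + h l z)‖ ^ 2)) ∂μ ≤ A - α k + 1 / (k + 1) := by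
      have e : ∫ z, ((√(1 + ‖h k z‖ ^ 2) + √(1 + ‖h l z‖ ^ 2)) / 2 -
          √(1 + ‖(1 / 2 : ℝ) • (h k z + h l z)‖ ^ 2)) ∂μ = (J (h k) + J (h l)) / 2 -
          J (fun z => (1 / 2 : ℝ) • (h k z + h l z)) := by
        rw [integral_sub i12 i3, integral_div, integral_add i1 i2]
      rw [e]
      have b1 := hαle k _ hmem
      have b2 := hJh k
      have b3 := hJh l
      have b4 := hαA l
      have b5 := hαA k
      have b6 : 1 / ((l : ℝ) + 1) ≤ 1 / ((k : ℝ) + 1) := by gcongr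
      have b7 := hαmono hkl
      linarith
    have h3 : ∫ z, (1 + ‖h k z‖ ^ p + ‖h l z‖ ^ p) ∂μ ≤ m + 2 * B := by
      have e : ∫ z, (1 + ‖h k z‖ ^ p + ‖h l z‖ ^ p) ∂μ =
          m + ∫ z, ‖h k z‖ ^ p ∂μ + ∫ z, ‖h l z‖ ^ p ∂μ := by
        rw [integral_add ip' j2, integral_add (integrable_const _) j1]
        simp [hmdef]
      rw [e]
      have := hB k _ (hS k)
      have := hB k _ hlk
      linarith
    refine h1.trans ?_
    rw [integral_add ik (ip.const_mul _),
      integral_add (integrable_const _) (ig.const_mul _), integral_const_mul, integral_const_mul,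
      integral_const, smul_eq_mul, mul_comm (μ.real univ)]
    gcongr
  have hcauchy : ∀ ε > 0, ∃ n : ℕ, ∀ k ≥ n, ∀ l ≥ k, ∫ z, ‖h k z - h l z‖ ∂μ < ε := by
    intro ε hε
    have hB0 : 0 ≤ B := by
      obtain ⟨a, ha⟩ := hne 0
      exact (integral_nonneg fun z => by positivity).trans (hB 0 a ha)
    set κ := ε / (4 * (m + 1)) with hκ
    have hκ0 : 0 < κ := by positivity
    have hκm : κ * m < ε / 3 := by
      rw [hκ, div_mul_eq_mul_div, div_lt_iff₀ (by positivity)]; nlinarith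
    obtain ⟨N, hN0, hN⟩ : ∃ N : ℝ, 0 < N ∧ N ^ (1 - p) * 3 ^ p * (m + 2 * B) < ε / 3 := by
      have ht : Tendsto (fun N : ℝ => N ^ (1 - p) * 3 ^ p * (m + 2 * B)) atTop (𝓝 0) := by
        have := ((tendsto_rpow_neg_atTop (show 0 < p - 1 by linarith)).mul_const
          ((3 : ℝ) ^ p)).mul_const (m + 2 * B)
        simpa using this
      exact ((eventually_gt_atTop 0).and (ht.eventually_lt_const (by positivity))).exists
    have ht : Tendsto (fun k : ℕ => 2 * N ^ 3 / κ * (A - α k + 1 / ((k : ℝ) + 1))) atTop (𝓝 0) := by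
      have := ((tendsto_const_nhds (x := A)).sub hαlim).add
        (tendsto_one_div_add_atTop_nhds_zero_nat (𝕜 := ℝ))
      simpa using this.const_mul (2 * N ^ 3 / κ)
    obtain ⟨n, hn⟩ := eventually_atTop.1 (ht.eventually_lt_const (show 0 < ε / 3 by positivity))
    refine ⟨n, fun k hk l hl => ?_⟩
    have := hpair κ N hκ0 hN0 k l hl
    have := hn k hk
    linarith
  have hIh : ∀ k, Integrable (h k) μ := fun k => hI k _ (hS k)
  set T : ℕ → (X →₁[μ] F) := fun k => (hIh k).toL1 with hT
  have hTdist : ∀ k l, dist (T k) (T l) = ∫ z, ‖h k z - h l z‖ ∂μ := fun k l => by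
    rw [dist_eq_norm, hT, ← Integrable.toL1_sub, L1.norm_of_fun_eq_integral_norm]; rfl
  have hC : CauchySeq T := by
    rw [Metric.cauchySeq_iff']
    intro ε hε
    obtain ⟨n, hn⟩ := hcauchy ε hε
    refine ⟨n, fun l hl => ?_⟩
    rw [dist_comm, hTdist]; exact hn n le_rfl l hl
  obtain ⟨g, hg⟩ := cauchySeq_tendsto_of_complete hC
  have hgI : Integrable g μ := L1.integrable_coeFn g
  have hgt : Tendsto (fun k => ∫ z, ‖h k z - g z‖ ∂μ) atTop (𝓝 0) := by
    rw [tendsto_iff_dist_tendsto_zero] at hg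
    refine hg.congr fun k => ?_
    rw [dist_eq_norm, ← Integrable.toL1_coeFn g hgI, hT, ← Integrable.toL1_sub,
      L1.norm_of_fun_eq_integral_norm, Integrable.toL1_coeFn]; rfl
  have hmeasT : TendstoInMeasure μ h atTop g := by
    refine tendstoInMeasure_of_tendsto_eLpNorm (p := 1) one_ne_zero (fun k => (hIh k).1) hgI.1 ?_
    have : ∀ k, eLpNorm (h k - ⇑g) 1 μ = ENNReal.ofReal (∫ z, ‖h k z - g z‖ ∂μ) := fun k => by
      rw [eLpNorm_one_eq_lintegral_enorm]
      exact (ofReal_integral_norm_eq_lintegral_enorm ((hIh k).sub hgI)).symm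
    simp only [this]
    simpa using ENNReal.tendsto_ofReal hgt
  obtain ⟨ns, hns, hae⟩ := hmeasT.exists_seq_tendsto_ae
  -- The extracted indices satisfy ns k ≥ k, so the subsequence still has its k-th term in S k.
  exact ⟨fun k => h (ns k), g, fun k => hanti (hns.id_le k) (hS _), hgI, hae,
    hgt.comp hns.tendsto_atTop⟩

end Komlos

/-! ### Cutoffs, compact exhaustions, Fatou's lemma and localisation. -/

section Tools
open Filter Topology
open scoped Manifold ENNReal

theorem exists_contDiff_cutoff {V : Type*} [NormedAddCommGroup V] [NormedSpace ℝ V]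
    [FiniteDimensional ℝ V] {K Ω : Set V} (hK : IsCompact K) (hΩ : IsOpen Ω) (hKΩ : K ⊆ Ω) :
    ∃ η : V → ℝ, ContDiff ℝ ∞ η ∧ HasCompactSupport η ∧ tsupport η ⊆ Ω ∧
      (∀ z, η z ∈ Icc (0 : ℝ) 1) ∧ ∀ z ∈ K, η z = 1 := by
  obtain ⟨T, hT, hKT, hTΩ⟩ := exists_compact_between hK hΩ hKΩ
  obtain ⟨η, h1, h2, h3⟩ := exists_contMDiffMap_one_nhds_of_subset_interior (n := ⊤) 𝓘(ℝ, V)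
    hK.isClosed hKT
  have hs : Function.support η ⊆ T := fun z hz => by
    by_contra hcon; exact hz (h2 z hcon)
  have hts : tsupport η ⊆ T := closure_minimal hs hT.isClosed
  exact ⟨η, η.contMDiff.contDiff, HasCompactSupport.of_support_subset_isCompact hT hs,
    hts.trans hTΩ, h3, fun z hz => h1.self_of_nhdsSet z hz⟩

theorem IsOpen.exists_compact_exhaustion {V : Type*} [TopologicalSpace V] [LocallyCompactSpace V]
    [SecondCountableTopology V] {Ω : Set V} (hΩ : IsOpen Ω) :
    ∃ K : ℕ → Set V, (∀ j, IsCompact (K j)) ∧ (∀ j, K j ⊆ Ω) ∧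
      (∀ j, K j ⊆ interior (K (j + 1))) ∧ ∀ L ⊆ Ω, IsCompact L → ∃ j, L ⊆ K j := by
  have : LocallyCompactSpace Ω := hΩ.locallyCompactSpace
  let K := CompactExhaustion.choice Ω
  refine ⟨fun j => (↑) '' K j, fun j => (K.isCompact j).image continuous_subtype_val, fun j => ?_,
    fun j => ?_, fun L hL hLc => ?_⟩
  · rintro _ ⟨z, -, rfl⟩; exact z.2
  · refine (image_mono (K.subset_interior_succ j)).trans ?_
    exact hΩ.isOpenMap_subtype_val.image_interior_subset _
  · have : IsCompact ((↑) ⁻¹' L : Set Ω) := by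
      rw [Topology.IsInducing.subtypeVal.isCompact_iff, Subtype.image_preimage_coe,
        inter_eq_right.2 hL]
      exact hLc
    obtain ⟨j, hj⟩ := K.exists_superset_of_isCompact this
    exact ⟨j, fun z hz => ⟨⟨z, hL hz⟩, hj hz, rfl⟩⟩

/-- Fatou's lemma for nonnegative real-valued functions with converging bounds. -/
theorem integral_le_of_tendsto_ae {X : Type*} [MeasurableSpace X] {μ : Measure X} {F : ℕ → X → ℝ}
    {G : X → ℝ} {b : ℕ → ℝ} {b₀ : ℝ} (hF : ∀ᶠ k in atTop, Integrable (F k) μ)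
    (hF0 : ∀ k z, 0 ≤ F k z) (hlim : ∀ᵐ z ∂μ, Tendsto (fun k => F k z) atTop (𝓝 (G z)))
    (hb : ∀ᶠ k in atTop, ∫ z, F k z ∂μ ≤ b k) (hb₀ : Tendsto b atTop (𝓝 b₀)) :
    Integrable G μ ∧ ∫ z, G z ∂μ ≤ b₀ := by
  obtain ⟨n, hn⟩ := eventually_atTop.1 (hF.and hb)
  have hFi : ∀ k, Integrable (F (k + n)) μ := fun k => (hn _ (by omega)).1
  have hshift := tendsto_add_atTop_nat n
  have hlim' : ∀ᵐ z ∂μ, Tendsto (fun k => F (k + n) z) atTop (𝓝 (G z)) :=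
    hlim.mono fun z hz => hz.comp hshift
  have hGm : AEStronglyMeasurable G μ :=
    aestronglyMeasurable_of_tendsto_ae atTop (fun k => (hFi k).1) hlim'
  have hG0 : 0 ≤ᵐ[μ] G := hlim'.mono fun z hz => ge_of_tendsto' hz fun k => hF0 _ _
  have hle : ∫⁻ z, ENNReal.ofReal (G z) ∂μ ≤ ENNReal.ofReal b₀ := by
    calc ∫⁻ z, ENNReal.ofReal (G z) ∂μ
        = ∫⁻ z, liminf (fun k => ENNReal.ofReal (F (k + n) z)) atTop ∂μ := by
          refine lintegral_congr_ae (hlim'.mono fun z hz => ?_)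
          exact (ENNReal.tendsto_ofReal hz).liminf_eq.symm
      _ ≤ liminf (fun k => ∫⁻ z, ENNReal.ofReal (F (k + n) z) ∂μ) atTop :=
          lintegral_liminf_le' fun k => (hFi k).1.aemeasurable.ennreal_ofReal
      _ ≤ liminf (fun k => ENNReal.ofReal (b (k + n))) atTop := by
          refine liminf_le_liminf (Eventually.of_forall fun k => ?_)
          rw [← ofReal_integral_eq_lintegral_ofReal (hFi k) (Eventually.of_forall (hF0 _))]
          exact ENNReal.ofReal_le_ofReal (hn _ (by omega)).2
      _ = ENNReal.ofReal b₀ := (ENNReal.tendsto_ofReal (hb₀.comp hshift)).liminf_eq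
  have hb0 : 0 ≤ b₀ := ge_of_tendsto (hb₀.comp hshift) (Eventually.of_forall fun k =>
    (integral_nonneg (hF0 (k + n))).trans (hn (k + n) (Nat.le_add_left n k)).2)
  have hGi : Integrable G μ :=
    ⟨hGm, (hasFiniteIntegral_iff_ofReal hG0).2 (hle.trans_lt ENNReal.ofReal_lt_top)⟩
  refine ⟨hGi, ?_⟩
  rw [← ofReal_integral_eq_lintegral_ofReal hGi hG0] at hle
  exact (ENNReal.ofReal_le_ofReal_iff hb0).1 hle

/-- A local version of `exists_seq_tendsto_of_midpoint_mem`, with convergence on each set of a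
countable family. -/
theorem exists_seq_tendsto_on_of_midpoint_mem {F : Type*} [NormedAddCommGroup F]
    [InnerProductSpace ℝ F] [CompleteSpace F] {X : Type*} [MeasurableSpace X] {ν : Measure X}
    {K : ℕ → Set X} (hνK : ∀ j, ν (K j) ≠ ⊤) {p : ℝ} (hp : 1 < p) {M : ℕ → ℝ}
    {S : ℕ → Set (X → F)} (hanti : Antitone S) (hne : ∀ k, (S k).Nonempty)
    (hmid : ∀ k, ∀ a ∈ S k, ∀ b ∈ S k, (fun z => (1 / 2 : ℝ) • (a z + b z)) ∈ S k)
    (hmeas : ∀ k, ∀ a ∈ S k, AEStronglyMeasurable a ν)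
    (hint : ∀ k, ∀ a ∈ S k, ∀ j, IntegrableOn (fun z => ‖a z‖ ^ p) (K j) ν)
    (hM : ∀ k, ∀ a ∈ S k, ∀ j, ∫ z in K j, ‖a z‖ ^ p ∂ν ≤ M j) :
    ∃ (h : ℕ → X → F) (G : X → F), (∀ k, h k ∈ S k) ∧ ∀ j, IntegrableOn G (K j) ν ∧
      (∀ᵐ z ∂ν.restrict (K j), Tendsto (fun k => h k z) atTop (𝓝 (G z))) ∧
      Tendsto (fun k => ∫ z in K j, ‖h k z - G z‖ ∂ν) atTop (𝓝 0) := by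
  have hM0 : ∀ j, 0 ≤ M j := fun j => by
    obtain ⟨a, ha⟩ := hne 0
    exact (integral_nonneg fun z => by positivity).trans (hM 0 a ha j)
  -- The weights make the sum of the restricted measures finite and every energy at most Σ 2^(-j) =
  -- 2. The local statement thus reduces to the one for a single finite measure, whose null sets
  -- restrict to null sets of ν on each K j.
  set v : ℕ → ℝ := fun j => (1 / 2) ^ j / (1 + M j + ν.real (K j)) with hv
  have hden : ∀ j, 0 < 1 + M j + ν.real (K j) := fun j => by
    have := hM0 j; have := measureReal_nonneg (μ := ν) (s := K j); linarith
  have hv0 : ∀ j, 0 < v j := fun j => div_pos (by positivity) (hden j)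
  have hvle : ∀ j x, x ≤ 1 + M j + ν.real (K j) → v j * x ≤ (1 / 2) ^ j := fun j x hx => by
    rw [hv]; dsimp only
    rw [div_mul_eq_mul_div, div_le_iff₀ (hden j)]
    exact mul_le_mul_of_nonneg_left hx (by positivity)
  set w : ℕ → ℝ≥0∞ := fun j => ENNReal.ofReal (v j) with hw
  have hw0 : ∀ j, w j ≠ 0 := fun j => by simp [hw, hv0 j]
  have hwt : ∀ j, w j ≠ ⊤ := fun j => ENNReal.ofReal_ne_top
  have htsum : ∑' j : ℕ, ENNReal.ofReal ((1 / 2) ^ j) = ENNReal.ofReal 2 := by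
    rw [← ENNReal.ofReal_tsum_of_nonneg (fun j => by positivity) summable_geometric_two,
      tsum_geometric_two]
  set μ : Measure X := Measure.sum fun j => w j • ν.restrict (K j) with hμ
  have hμle : ∀ j, w j • ν.restrict (K j) ≤ μ := fun j => Measure.le_sum _ j
  have hμν : μ ≪ ν := Measure.absolutelyContinuous_sum_left fun j =>
    Measure.smul_absolutelyContinuous.trans Measure.absolutelyContinuous_restrict
  have hνμ : ∀ j, ν.restrict (K j) ≪ μ := fun j =>
    Measure.absolutelyContinuous_sum_right j (Measure.absolutelyContinuous_smul (hw0 j))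
  have hfin : IsFiniteMeasure μ := by
    refine ⟨?_⟩
    rw [hμ, Measure.sum_apply _ MeasurableSet.univ]
    refine lt_of_le_of_lt (ENNReal.tsum_le_tsum fun j => ?_) (htsum.trans_lt ENNReal.ofReal_lt_top)
    rw [Measure.smul_apply, Measure.restrict_apply_univ, smul_eq_mul,
      ← ENNReal.ofReal_toReal (hνK j), hw, ← ENNReal.ofReal_mul (hv0 j).le]
    exact ENNReal.ofReal_le_ofReal (hvle j _ (by have := hM0 j; simp only [Measure.real]; linarith))
  have hlint : ∀ k, ∀ a ∈ S k, ∫⁻ z, ‖‖a z‖ ^ p‖ₑ ∂μ ≤ ENNReal.ofReal 2 := fun k a ha => by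
    rw [hμ, lintegral_sum_measure, ← htsum]
    refine ENNReal.tsum_le_tsum fun j => ?_
    rw [lintegral_smul_measure, ← ofReal_integral_norm_eq_lintegral_enorm (hint k a ha j),
      smul_eq_mul, hw, ← ENNReal.ofReal_mul (hv0 j).le]
    refine ENNReal.ofReal_le_ofReal (hvle j _ ?_)
    have := hM k a ha j
    have := measureReal_nonneg (μ := ν) (s := K j)
    simp only [Real.norm_eq_abs, Real.abs_rpow_of_nonneg (norm_nonneg _), abs_norm]
    linarith
  have hmeasμ : ∀ k, ∀ a ∈ S k, AEStronglyMeasurable a μ := fun k a ha =>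
    (hmeas k a ha).mono_ac hμν
  have hintμ : ∀ k, ∀ a ∈ S k, Integrable (fun z => ‖a z‖ ^ p) μ := fun k a ha =>
    ⟨((hmeasμ k a ha).norm.aemeasurable.pow_const p).aestronglyMeasurable,
      (hlint k a ha).trans_lt ENNReal.ofReal_lt_top⟩
  obtain ⟨h, G, hS, hG, hae, hL1⟩ := exists_seq_tendsto_of_midpoint_mem hp hanti hne hmid hmeasμ
    hintμ (B := 2) fun k a ha => by
      have := hlint k a ha
      rw [← ofReal_integral_norm_eq_lintegral_enorm (hintμ k a ha),
        ENNReal.ofReal_le_ofReal_iff (by norm_num)] at this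
      simpa only [Real.norm_eq_abs, Real.abs_rpow_of_nonneg (norm_nonneg _), abs_norm] using this
  refine ⟨h, G, hS, fun j => ⟨?_, (hνμ j).ae_le hae, ?_⟩⟩
  · exact (integrable_smul_measure (hw0 j) (hwt j)).1 (hG.mono_measure (hμle j))
  · have hhi : ∀ k, Integrable (h k) μ := fun k => by
      refine Integrable.mono' ((integrable_const (1 : ℝ)).add (hintμ k _ (hS k)))
        (hmeasμ k _ (hS k)) (Eventually.of_forall fun z => ?_)
      have e1 : 0 ≤ ‖h k z‖ ^ p := by positivity
      simp only [Pi.add_apply]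
      rcases le_total ‖h k z‖ 1 with h1 | h1
      · linarith
      · have := Real.rpow_le_rpow_of_exponent_le h1 hp.le
        rw [Real.rpow_one] at this; linarith
    have hle : ∀ k, ∫ z in K j, ‖h k z - G z‖ ∂ν ≤ (v j)⁻¹ * ∫ z, ‖h k z - G z‖ ∂μ := fun k => by
      have := integral_mono_measure (hμle j) (Eventually.of_forall fun z => norm_nonneg _)
        ((hhi k).sub hG).norm
      rw [integral_smul_measure, hw, ENNReal.toReal_ofReal (hv0 j).le, smul_eq_mul] at this
      rw [inv_mul_eq_div, le_div_iff₀ (hv0 j), mul_comm]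
      exact this
    refine squeeze_zero (fun k => integral_nonneg fun z => norm_nonneg _) hle ?_
    simpa using hL1.const_mul (v j)⁻¹

end Tools

/-! ### Approximate distributional subsolutions. -/

section WeakGradient
open Filter Topology Metric
open scoped NNReal

variable {d : ℕ}

local notation "E" => EuclideanSpace ℝ (Fin d)

instance isAddHaarMeasure_volume_prod :
    (volume : Measure (ℝ × EuclideanSpace ℝ (Fin d))).IsAddHaarMeasure :=
  inferInstanceAs ((volume : Measure ℝ).prod (volume : Measure E)).IsAddHaarMeasure

/-- `H` is, up to an error `ε`, the distributional space gradient of `u`, and `u` is, up to an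
error `ε`, a distributional subsolution of `-∂ₜ u + (1/C) |H|^p ≤ f`, when tested against functions
supported in `K`. -/
def IsApproxDistribSub (p C : ℝ) (f u : ℝ × E → ℝ) (K : Set (ℝ × E)) (ε : ℝ) (H : ℝ × E → E) :
    Prop :=
  ∀ η : ℝ × E → ℝ, ContDiff ℝ ∞ η → HasCompactSupport η → tsupport η ⊆ K →
    (∀ i, |(∫ z, u z * fderiv ℝ η z (0, EuclideanSpace.single i 1)) + ∫ z, H z i * η z| ≤
      ε * ∫ z, |fderiv ℝ η z (0, EuclideanSpace.single i 1)|) ∧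
    ((∀ z, 0 ≤ η z) → (∫ z, u z * fderiv ℝ η z (1, 0)) + 1 / C * ∫ z, ‖H z‖ ^ p * η z ≤
      (∫ z, f z * η z) + ε * ((∫ z, η z) + ∫ z, |fderiv ℝ η z (1, 0)|))

theorem IsApproxDistribSub.mono {p C : ℝ} {f u : ℝ × E → ℝ} {K K' : Set (ℝ × E)} {ε ε' : ℝ}
    {H : ℝ × E → E} (h : IsApproxDistribSub p C f u K ε H) (hK : K' ⊆ K) (hε : ε ≤ ε') :
    IsApproxDistribSub p C f u K' ε' H := by
  intro η h1 h2 h3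
  obtain ⟨ha, hb⟩ := h η h1 h2 (h3.trans hK)
  refine ⟨fun i => (ha i).trans ?_, fun h0 => (hb h0).trans ?_⟩
  · exact mul_le_mul_of_nonneg_right hε (integral_nonneg fun z => abs_nonneg _)
  · gcongr
    exact add_nonneg (integral_nonneg h0) (integral_nonneg fun z => abs_nonneg _)

/-- Test functions supported in K see only the values on K. This permits truncation by an indicator
function. -/
theorem IsApproxDistribSub.congr {p C : ℝ} {f u : ℝ × E → ℝ} {K : Set (ℝ × E)} {ε : ℝ}
    {H H' : ℝ × E → E} (h : IsApproxDistribSub p C f u K ε H) (hH : EqOn H H' K) :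
    IsApproxDistribSub p C f u K ε H' := by
  intro η h1 h2 h3
  have key : ∀ z, η z = 0 ∨ H z = H' z := fun z => by
    by_cases hz : z ∈ tsupport η
    · exact Or.inr (hH (h3 hz))
    · exact Or.inl (image_eq_zero_of_notMem_tsupport hz)
  obtain ⟨ha, hb⟩ := h η h1 h2 h3
  have e1 : ∀ i, ∫ z, H' z i * η z = ∫ z, H z i * η z := fun i =>
    integral_congr_ae (Eventually.of_forall fun z => by
      rcases key z with h | h <;> simp [h])
  have e2 : ∫ z, ‖H' z‖ ^ p * η z = ∫ z, ‖H z‖ ^ p * η z :=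
    integral_congr_ae (Eventually.of_forall fun z => by
      rcases key z with h | h <;> simp [h])
  simp only [e1, e2]
  exact ⟨ha, hb⟩

theorem integrable_mul_of_integrableOn {g η : ℝ × E → ℝ} {K : Set (ℝ × E)}
    (hg : IntegrableOn g K) (hη : Continuous η) (hηc : HasCompactSupport η) (hηK : tsupport η ⊆ K) :
    Integrable fun z => g z * η z := by
  have h2 : IntegrableOn (fun z => g z * η z) (tsupport η) :=
    (hg.mono_set hηK).mul_continuousOn hη.continuousOn hηc
  rwa [integrableOn_iff_integrable_of_support_subset] at h2
  intro z hz
  by_contra hcon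
  exact hz (by simp [image_eq_zero_of_notMem_tsupport hcon])

/-- Approximate distributional subsolutions with a common error form a midpoint-convex set. -/
theorem IsApproxDistribSub.midpoint {p C : ℝ} (hC : 0 < C) {f u : ℝ × E → ℝ}
    {K : Set (ℝ × E)} {ε : ℝ} {H H' : ℝ × E → E} (h : IsApproxDistribSub p C f u K ε H)
    (h' : IsApproxDistribSub p C f u K ε H') (hH : IntegrableOn H K) (hH' : IntegrableOn H' K)
    (hHp : IntegrableOn (fun z => ‖H z‖ ^ p) K) (hHp' : IntegrableOn (fun z => ‖H' z‖ ^ p) K)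
    (hHm : IntegrableOn (fun z => ‖(1 / 2 : ℝ) • (H z + H' z)‖ ^ p) K)
    (hconv : ∀ z, ‖(1 / 2 : ℝ) • (H z + H' z)‖ ^ p ≤ (‖H z‖ ^ p + ‖H' z‖ ^ p) / 2) :
    IsApproxDistribSub p C f u K ε fun z => (1 / 2 : ℝ) • (H z + H' z) := by
  intro η h1 h2 h3
  obtain ⟨ha, hb⟩ := h η h1 h2 h3
  obtain ⟨ha', hb'⟩ := h' η h1 h2 h3
  have hη := h1.continuous
  refine ⟨fun i => ?_, fun h0 => ?_⟩
  · have i1 : Integrable fun z => H z i * η z := integrable_mul_of_integrableOn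
      ((EuclideanSpace.proj (𝕜 := ℝ) i).integrable_comp hH) hη h2 h3
    have i2 : Integrable fun z => H' z i * η z := integrable_mul_of_integrableOn
      ((EuclideanSpace.proj (𝕜 := ℝ) i).integrable_comp hH') hη h2 h3
    have e : ∫ z, ((1 / 2 : ℝ) • (H z + H' z)) i * η z =
        (1 / 2) * ((∫ z, H z i * η z) + ∫ z, H' z i * η z) := by
      rw [← integral_add i1 i2, ← integral_const_mul]
      refine integral_congr_ae (Eventually.of_forall fun z => ?_)
      simp; ring
    rw [e]
    have := abs_le.1 (ha i)
    have := abs_le.1 (ha' i)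
    rw [abs_le]; constructor <;> linarith
  · have i1 := integrable_mul_of_integrableOn hHp hη h2 h3
    have i2 := integrable_mul_of_integrableOn hHp' hη h2 h3
    have e : ∫ z, ‖(1 / 2 : ℝ) • (H z + H' z)‖ ^ p * η z ≤
        (1 / 2) * ((∫ z, ‖H z‖ ^ p * η z) + ∫ z, ‖H' z‖ ^ p * η z) := by
      rw [← integral_add i1 i2, ← integral_const_mul]
      refine integral_mono (integrable_mul_of_integrableOn hHm hη h2 h3)
        ((i1.add i2).const_mul _) fun z => ?_
      have := mul_le_mul_of_nonneg_right (hconv z) (h0 z)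
      dsimp only; linarith
    have e' := mul_le_mul_of_nonneg_left e (show 0 ≤ 1 / C by positivity)
    have := hb h0
    have := hb' h0
    linarith

theorem LipschitzWith.integral_fderiv_mul_eq {U η : ℝ × E → ℝ} {L : ℝ≥0}
    (hU : LipschitzWith L U) (hη : ContDiff ℝ ∞ η) (hηc : HasCompactSupport η) (v : ℝ × E) :
    ∫ z, fderiv ℝ U z v * η z = -∫ z, U z * fderiv ℝ η z v := by
  obtain ⟨D, hD⟩ := (hη.of_le (by simp) : ContDiff ℝ 1 η).lipschitzWith_of_hasCompactSupport hηc
    one_ne_zero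
  have h := hU.integral_lineDeriv_mul_eq (μ := volume) hD hηc v
  have e1 : ∫ z, lineDeriv ℝ U z v * η z = ∫ z, fderiv ℝ U z v * η z :=
    integral_congr_ae ((hU.ae_differentiableAt (μ := volume)).mono fun z hz => by
      dsimp only; rw [hz.lineDeriv_eq_fderiv])
  rw [← e1, h, ← integral_neg]
  refine integral_congr_ae (Eventually.of_forall fun z => ?_)
  dsimp only
  rw [(hη.differentiable (by simp) z).lineDeriv_eq_fderiv, map_neg]; ring

/-- H is the almost everywhere gradient of a sup-convolution U. Integration by parts is legitimate
for the Lipschitz function U, and replacing U by u in the tested terms costs ε times the L¹ norm of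
the derivative of the test function. -/
theorem IsViscositySub.exists_isApproxDistribSub {p C : ℝ} (hp : 0 ≤ p)
    {f u : ℝ × E → ℝ} {Ω : Set (ℝ × E)}
    (hΩ : IsOpen Ω) (hu : ContinuousOn u Ω) (hf : ContinuousOn f Ω)
    (hsub : IsViscositySub p C f Ω u) {K : Set (ℝ × E)} (hK : IsCompact K) (hKΩ : K ⊆ Ω) {ε : ℝ}
    (hε : 0 < ε) :
    ∃ (L : ℝ≥0) (H : ℝ × E → E), Measurable H ∧ (∀ z, ‖H z‖ ≤ L) ∧
      IsApproxDistribSub p C f u K ε H := by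
  obtain ⟨L, U, hU, hUu, hUsub⟩ := hsub.exists_lipschitz_approx hΩ hu hf hK hKΩ hε
  refine ⟨L, fderivSpace U, measurable_fderivSpace U, norm_fderivSpace_le hU,
    fun η hη hηc hηK => ?_⟩
  have hcont : ∀ v, Continuous fun z => fderiv ℝ η z v := fun v =>
    (hη.continuous_fderiv (by simp)).clm_apply continuous_const
  have hcs : ∀ v, HasCompactSupport fun z => fderiv ℝ η z v := fun v => hηc.fderiv_apply ℝ v
  have hts : ∀ v, tsupport (fun z => fderiv ℝ η z v) ⊆ K := fun v =>
    (tsupport_fderiv_apply_subset ℝ v).trans hηK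
  have iu : ∀ v, Integrable fun z => u z * fderiv ℝ η z v := fun v =>
    hu.integrable_mul_of_tsupport_subset hΩ (hcont v) (hcs v) ((hts v).trans hKΩ)
  have iU : ∀ v, Integrable fun z => U z * fderiv ℝ η z v := fun v =>
    (hU.continuous.mul (hcont v)).integrable_of_hasCompactSupport (hcs v).mul_left
  have ia : ∀ v, Integrable fun z => |fderiv ℝ η z v| := fun v =>
    ((hcont v).integrable_of_hasCompactSupport (hcs v)).abs
  have hdiff : ∀ v, |(∫ z, u z * fderiv ℝ η z v) - ∫ z, U z * fderiv ℝ η z v| ≤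
      ε * ∫ z, |fderiv ℝ η z v| := fun v => by
    rw [← integral_sub (iu v) (iU v), ← integral_const_mul]
    refine (abs_integral_le_integral_abs).trans
      (integral_mono ((iu v).sub (iU v)).abs ((ia v).const_mul ε) fun z => ?_)
    dsimp only
    rw [← sub_mul, abs_mul]
    by_cases hz : z ∈ K
    · gcongr; rw [abs_sub_comm]; exact hUu z hz
    · rw [image_eq_zero_of_notMem_tsupport (f := fun z => fderiv ℝ η z v) fun h => hz (hts v h)]
      simp
  have hηcont := hη.continuous
  refine ⟨fun i => ?_, fun h0 => ?_⟩
  · have := hU.integral_fderiv_mul_eq hη hηc (0, EuclideanSpace.single i 1)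
    simp only [fderivSpace_apply]
    rw [this, ← sub_eq_add_neg]
    exact hdiff _
  · have hHm := measurable_fderivSpace U
    have i1 : Integrable fun z => fderiv ℝ U z (1, 0) * η z := by
      refine ((hηcont.integrable_of_hasCompactSupport hηc).norm.const_mul
        (L * ‖((1, 0) : ℝ × E)‖)).mono'
        ((measurable_fderiv_apply_const ℝ U _).mul hηcont.measurable).aestronglyMeasurable
        (Eventually.of_forall fun z => ?_)
      rw [norm_mul]
      gcongr
      exact (ContinuousLinearMap.le_opNorm _ _).trans
        (by gcongr; exact norm_fderiv_le_of_lipschitz ℝ hU)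
    have i2 : Integrable fun z => ‖fderivSpace U z‖ ^ p * η z := by
      refine ((hηcont.integrable_of_hasCompactSupport hηc).norm.const_mul ((L : ℝ) ^ p)).mono'
        ((hHm.norm.pow_const p).mul hηcont.measurable).aestronglyMeasurable
        (Eventually.of_forall fun z => ?_)
      rw [norm_mul, Real.norm_of_nonneg (by positivity)]
      gcongr
      exact norm_fderivSpace_le hU z
    have i3 : Integrable fun z => f z * η z :=
      hf.integrable_mul_of_tsupport_subset hΩ hηcont hηc (hηK.trans hKΩ)
    have i4 := hηcont.integrable_of_hasCompactSupport (μ := volume) hηc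
    have hae : ∀ᵐ z, -(fderiv ℝ U z (1, 0) * η z) + 1 / C * (‖fderivSpace U z‖ ^ p * η z) ≤
        f z * η z + ε * η z := by
      filter_upwards [hU.ae_differentiableAt (μ := volume)] with z hz
      by_cases hzK : z ∈ K
      · have := mul_le_mul_of_nonneg_right (hUsub z hzK hz) (h0 z)
        linarith
      · rw [image_eq_zero_of_notMem_tsupport fun h => hzK (hηK h)]; simp
    have := integral_mono_ae (i1.neg.add (i2.const_mul _)) (i3.add (i4.const_mul _)) hae
    rw [integral_add' i1.neg (i2.const_mul _), integral_add' i3 (i4.const_mul _)] at this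
    simp only [Pi.neg_apply, integral_neg, integral_const_mul] at this
    rw [hU.integral_fderiv_mul_eq hη hηc] at this
    have := (abs_le.1 (hdiff (1, 0))).2
    linarith

/-- The Caccioppoli-type estimate for approximate distributional subsolutions. -/
theorem exists_isApproxDistribSub_energy_const {p C : ℝ} (hC : 0 < C) (f u : ℝ × E → ℝ)
    {K K' : Set (ℝ × E)} (hK : IsCompact K) (hKK' : K ⊆ interior K') :
    ∃ M, 0 ≤ M ∧ ∀ ε H, ε ≤ 1 → IntegrableOn (fun z => ‖H z‖ ^ p) K' →
      IsApproxDistribSub p C f u K' ε H → ∫ z in K, ‖H z‖ ^ p ≤ M := by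
  obtain ⟨η, hη, hηc, hηK, hη01, hη1⟩ := exists_contDiff_cutoff hK isOpen_interior hKK'
  have hηK' := hηK.trans interior_subset
  -- Testing with a cutoff equal to 1 on K puts the time derivative on η. The resulting bound
  -- involves u, f and η only, so it is uniform in H and in ε ≤ 1.
  set b := (∫ z, f z * η z) + ((∫ z, η z) + ∫ z, |fderiv ℝ η z (1, 0)|) -
    ∫ z, u z * fderiv ℝ η z (1, 0)
  refine ⟨max 0 (C * b), le_max_left _ _, fun ε H hε hH h => le_max_of_le_right ?_⟩
  have h1 := (h η hη hηc hηK').2 fun z => (hη01 z).1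
  have h2 : 0 ≤ (∫ z, η z) + ∫ z, |fderiv ℝ η z (1, 0)| :=
    add_nonneg (integral_nonneg fun z => (hη01 z).1) (integral_nonneg fun z => abs_nonneg _)
  have h3 : 1 / C * ∫ z, ‖H z‖ ^ p * η z ≤ b := by
    have := mul_le_mul_of_nonneg_right hε h2
    linarith
  have hi := integrable_mul_of_integrableOn hH hη.continuous hηc hηK'
  calc ∫ z in K, ‖H z‖ ^ p = ∫ z in K, ‖H z‖ ^ p * η z :=
        setIntegral_congr_fun hK.measurableSet fun z hz => by simp [hη1 z hz]
    _ ≤ ∫ z, ‖H z‖ ^ p * η z := setIntegral_le_integral hi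
        (Eventually.of_forall fun z => mul_nonneg (by positivity) (hη01 z).1)
    _ ≤ C * b := by rwa [one_div, inv_mul_le_iff₀ hC] at h3

end WeakGradient

/-! ### Existence of the distributional gradient in L^p_loc. -/

section WeakGradientExistence
open Filter Topology Metric
open scoped NNReal

variable {d : ℕ}

local notation "E" => EuclideanSpace ℝ (Fin d)

theorem norm_midpoint_rpow_le {F : Type*} [SeminormedAddCommGroup F] [NormedSpace ℝ F] {p : ℝ}
    (hp : 1 ≤ p) (a b : F) : ‖(1 / 2 : ℝ) • (a + b)‖ ^ p ≤ (‖a‖ ^ p + ‖b‖ ^ p) / 2 := by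
  have h1 : ‖(1 / 2 : ℝ) • (a + b)‖ ≤ 1 / 2 * ‖a‖ + 1 / 2 * ‖b‖ := by
    rw [norm_smul]; norm_num; linarith [norm_add_le a b]
  have h2 := (convexOn_rpow hp).2 (mem_Ici.2 (norm_nonneg a)) (mem_Ici.2 (norm_nonneg b))
    (show (0 : ℝ) ≤ 1 / 2 by norm_num) (show (0 : ℝ) ≤ 1 / 2 by norm_num) (by norm_num)
  simp only [smul_eq_mul] at h2
  calc _ ≤ (1 / 2 * ‖a‖ + 1 / 2 * ‖b‖) ^ p := by gcongr
    _ ≤ _ := h2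
    _ = _ := by ring

theorem MeasureTheory.IntegrableOn.of_rpow_norm {X F : Type*} [MeasurableSpace X] {μ : Measure X}
    [NormedAddCommGroup F] {H : X → F} {K : Set X} (hK : μ K ≠ ⊤) {p : ℝ} (hp : 1 ≤ p)
    (hm : AEStronglyMeasurable H μ) (hH : IntegrableOn (fun z => ‖H z‖ ^ p) K μ) :
    IntegrableOn H K μ := by
  refine Integrable.mono' ((integrableOn_const hK (C := (1 : ℝ))).add hH) hm.restrict
    (Eventually.of_forall fun z => ?_)
  have e1 : 0 ≤ ‖H z‖ ^ p := by positivity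
  simp only [Pi.add_apply]
  rcases le_total ‖H z‖ 1 with h1 | h1
  · linarith
  · have := Real.rpow_le_rpow_of_exponent_le h1 hp
    rw [Real.rpow_one] at this; linarith

/-- A viscosity subsolution has a distributional gradient in `L^p_loc`, for which it is a
distributional subsolution. -/
theorem IsViscositySub.exists_distribGrad {p C : ℝ} (hp : 1 < p) (hC : 0 < C)
    {f u : ℝ × E → ℝ} {Ω : Set (ℝ × E)} (hΩ : IsOpen Ω) (hu : ContinuousOn u Ω)
    (hf : ContinuousOn f Ω) (hsub : IsViscositySub p C f Ω u) :
    ∃ G : ℝ × E → E, LocallyIntegrableOn G Ω ∧ LocallyIntegrableOn (fun z => ‖G z‖ ^ p) Ω ∧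
      IsApproxDistribSub p C f u Ω 0 G := by
  have hp0 : 0 < p := by linarith
  obtain ⟨K, hKc, hKΩ, hKint, hKex⟩ := hΩ.exists_compact_exhaustion
  have hKmono : Monotone K := monotone_nat_of_le_succ fun j => (hKint j).trans interior_subset
  have hKt : ∀ j, volume (K j) ≠ ⊤ := fun j => (hKc j).measure_lt_top.ne
  choose m hm0 hm using fun j => exists_isApproxDistribSub_energy_const (p := p) hC f u (hKc j)
    (hKint j)
  -- Cumulative sums are taken because truncation to K k replaces the energy on K j by that on the
  -- smaller of the two sets, and its bound must not exceed M j.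
  set M : ℕ → ℝ := fun j => ∑ i ∈ Finset.range (j + 1), m i with hM
  have hmM : ∀ i j, i ≤ j → m i ≤ M j := fun i j hij =>
    Finset.single_le_sum (f := m) (fun i _ => hm0 i) (Finset.mem_range.2 (by omega))
  -- S k gathers the candidate gradients which are accurate up to 1/(k + 1) on K k, with energy
  -- bounds independent of k. The condition is midpoint-convex since |·|^p is convex and the other
  -- tested terms are affine in H.
  set S : ℕ → Set (ℝ × E → E) := fun k => {H | AEStronglyMeasurable H volume ∧
    (∀ j, IntegrableOn (fun z => ‖H z‖ ^ p) (K j) ∧ ∫ z in K j, ‖H z‖ ^ p ≤ M j) ∧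
    IsApproxDistribSub p C f u (K k) (1 / ((k : ℝ) + 1)) H} with hS
  have hε : ∀ k : ℕ, 1 / ((k : ℝ) + 1) ≤ 1 := fun k => by
    rw [div_le_one (by positivity)]; linarith [(Nat.cast_nonneg k : (0 : ℝ) ≤ k)]
  have hanti : Antitone S := fun k l hkl H hH =>
    ⟨hH.1, hH.2.1, hH.2.2.mono (hKmono hkl) (by gcongr)⟩
  have hne : ∀ k, (S k).Nonempty := fun k => by
    -- The approximation is made on K (k + 1), one step further than needed for membership, because
    -- the energy estimate on K k uses a cutoff supported in K (k + 1).
    obtain ⟨L, H, hHm, hHL, hH⟩ := hsub.exists_isApproxDistribSub hp0.le hΩ hu hf (hKc (k + 1))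
      (hKΩ _) (ε := 1 / ((k : ℝ) + 1)) (by positivity)
    have hind : ∀ z, ‖(K k).indicator H z‖ ^ p = (K k).indicator (fun z => ‖H z‖ ^ p) z :=
      fun z => by
        by_cases hz : z ∈ K k
        · simp [hz]
        · simp [hz, hp0.ne']
    have hHi : ∀ j, IntegrableOn (fun z => ‖H z‖ ^ p) (K j) := fun j => by
      refine (integrableOn_const (hKt j) (C := (L : ℝ) ^ p)).mono'
        (hHm.norm.pow_const p).aestronglyMeasurable (Eventually.of_forall fun z => ?_)
      rw [Real.norm_of_nonneg (by positivity)]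
      gcongr
      exact hHL z
    refine ⟨(K k).indicator H, (hHm.indicator (hKc k).measurableSet).aestronglyMeasurable,
      fun j => ?_, (hH.mono (hKmono (by omega)) le_rfl).congr fun z hz =>
        (indicator_of_mem hz H).symm⟩
    simp only [hind]
    refine ⟨(hHi j).indicator (hKc k).measurableSet, ?_⟩
    rw [setIntegral_indicator (hKc k).measurableSet]
    have hinter : K j ∩ K k = K (min j k) := by
      rcases le_total j k with h | h
      · rw [min_eq_left h, inter_eq_left.2 (hKmono h)]
      · rw [min_eq_right h, inter_eq_right.2 (hKmono h)]
    rw [hinter]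
    exact (hm (min j k) _ H (hε k) (hHi _) (hH.mono (hKmono (by omega)) le_rfl)).trans
      (hmM _ _ (min_le_left _ _))
  have hloc : ∀ k, ∀ a ∈ S k, ∀ j, IntegrableOn a (K j) := fun k a ha j =>
    .of_rpow_norm (hKt j) hp.le ha.1 (ha.2.1 j).1
  have hmid : ∀ k, ∀ a ∈ S k, ∀ b ∈ S k, (fun z => (1 / 2 : ℝ) • (a z + b z)) ∈ S k := by
    intro k a ha b hb
    have hmeas : AEStronglyMeasurable (fun z => (1 / 2 : ℝ) • (a z + b z)) :=
      (ha.1.add hb.1).const_smul (1 / 2 : ℝ)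
    have hconv : ∀ z, ‖(1 / 2 : ℝ) • (a z + b z)‖ ^ p ≤ (‖a z‖ ^ p + ‖b z‖ ^ p) / 2 := fun z =>
      norm_midpoint_rpow_le hp.le _ _
    have hi : ∀ j, IntegrableOn (fun z => (‖a z‖ ^ p + ‖b z‖ ^ p) / 2) (K j) := fun j =>
      ((ha.2.1 j).1.add (hb.2.1 j).1).div_const 2
    have hint : ∀ j, IntegrableOn (fun z => ‖(1 / 2 : ℝ) • (a z + b z)‖ ^ p) (K j) := fun j => by
      refine (hi j).mono' (hmeas.norm.aemeasurable.pow_const p).aestronglyMeasurable.restrict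
        (Eventually.of_forall fun z => ?_)
      rw [Real.norm_of_nonneg (by positivity)]
      exact hconv z
    refine ⟨hmeas, fun j => ⟨hint j, ?_⟩, ha.2.2.midpoint hC hb.2.2 (hloc k a ha k)
      (hloc k b hb k) (ha.2.1 k).1 (hb.2.1 k).1 (hint k) hconv⟩
    refine (integral_mono (hint j) (hi j) hconv).trans ?_
    rw [integral_div, integral_add (ha.2.1 j).1 (hb.2.1 j).1]
    have := (ha.2.1 j).2
    have := (hb.2.1 j).2
    linarith
  obtain ⟨h, G, hhS, hG⟩ := exists_seq_tendsto_on_of_midpoint_mem (ν := volume) hKt hp hanti hne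
    hmid (fun k a ha => ha.1) (fun k a ha j => (ha.2.1 j).1) (fun k a ha j => (ha.2.1 j).2)
  have hGp : ∀ j, IntegrableOn (fun z => ‖G z‖ ^ p) (K j) := fun j =>
    (integral_le_of_tendsto_ae (μ := volume.restrict (K j)) (F := fun k z => ‖h k z‖ ^ p)
      (b := fun _ => M j)
      (Eventually.of_forall fun k => ((hhS k).2.1 j).1) (fun k z => by positivity)
      ((hG j).2.1.mono fun z hz => hz.norm.rpow_const (Or.inr hp0.le))
      (Eventually.of_forall fun k => ((hhS k).2.1 j).2) tendsto_const_nhds).1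
  have hnhds : ∀ z ∈ Ω, ∃ j, K j ∈ 𝓝[Ω] z := fun z hz => by
    obtain ⟨j, hj⟩ := hKex {z} (singleton_subset_iff.2 hz) isCompact_singleton
    exact ⟨j + 1, mem_nhdsWithin_of_mem_nhds
      (mem_interior_iff_mem_nhds.1 (hKint j (singleton_subset_iff.1 hj)))⟩
  refine ⟨G, fun z hz => ?_, fun z hz => ?_, fun η hη hηc hηΩ => ?_⟩
  · obtain ⟨j, hj⟩ := hnhds z hz
    exact ⟨K j, hj, (hG j).1⟩
  · obtain ⟨j, hj⟩ := hnhds z hz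
    exact ⟨K j, hj, hGp j⟩
  obtain ⟨j, hj⟩ := hKex _ hηΩ hηc
  have hηK : ∀ k, j ≤ k → tsupport η ⊆ K k := fun k hk => hj.trans (hKmono hk)
  have hηcont := hη.continuous
  have htest := fun k hk => (hhS k).2.2 η hη hηc (hηK k hk)
  have h1k : Tendsto (fun k : ℕ => 1 / ((k : ℝ) + 1)) atTop (𝓝 0) :=
    tendsto_one_div_add_atTop_nhds_zero_nat
  refine ⟨fun i => ?_, fun h0 => ?_⟩
  · obtain ⟨B, hB⟩ := hηcont.bounded_above_of_compact_support hηc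
    have hB0 : 0 ≤ B := (norm_nonneg _).trans (hB 0)
    have hproj : ∀ H : ℝ × E → E, IntegrableOn H (K j) → Integrable fun z => H z i * η z :=
      fun H hH => integrable_mul_of_integrableOn
        ((EuclideanSpace.proj (𝕜 := ℝ) i).integrable_comp hH) hηcont hηc hj
    have hlim : Tendsto (fun k => ∫ z, h k z i * η z) atTop (𝓝 (∫ z, G z i * η z)) := by
      rw [tendsto_iff_dist_tendsto_zero]
      refine squeeze_zero (fun k => dist_nonneg) (fun k => ?_)
        (by simpa using ((hG j).2.2).const_mul B)
      rw [Real.dist_eq, ← integral_sub (hproj _ (hloc k _ (hhS k) j)) (hproj _ (hG j).1),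
        ← integral_const_mul]
      refine abs_integral_le_integral_abs.trans ?_
      rw [← setIntegral_eq_integral_of_forall_compl_eq_zero (s := K j) fun z hz => by
        simp [image_eq_zero_of_notMem_tsupport fun h => hz (hj h)]]
      refine integral_mono ((hproj _ (hloc k _ (hhS k) j)).sub (hproj _ (hG j).1)).abs.integrableOn
        (((hloc k _ (hhS k) j).sub (hG j).1).norm.const_mul B) fun z => ?_
      dsimp only
      rw [← sub_mul, abs_mul, mul_comm]
      gcongr
      · exact hB z
      · exact PiLp.norm_apply_le (h k z - G z) i
    rw [zero_mul]
    refine le_of_tendsto_of_tendsto (tendsto_const_nhds.add hlim).abs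
      (by simpa using h1k.mul_const (∫ z, |fderiv ℝ η z (0, EuclideanSpace.single i 1)|))
      (eventually_atTop.2 ⟨j, fun k hk => (htest k hk).1 i⟩)
  · have hint : ∀ k, Integrable fun z => ‖h k z‖ ^ p * η z := fun k =>
      integrable_mul_of_integrableOn ((hhS k).2.1 j).1 hηcont hηc hj
    set c := (∫ z, f z * η z) - ∫ z, u z * fderiv ℝ η z (1, 0) with hc
    set T := (∫ z, η z) + ∫ z, |fderiv ℝ η z (1, 0)| with hT
    have hae : ∀ᵐ z, Tendsto (fun k => ‖h k z‖ ^ p * η z) atTop (𝓝 (‖G z‖ ^ p * η z)) := by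
      have := (ae_restrict_iff' (hKc j).measurableSet).1 (hG j).2.1
      filter_upwards [this] with z hz
      by_cases hzK : z ∈ K j
      · exact ((hz hzK).norm.rpow_const (Or.inr hp0.le)).mul_const _
      · simp [image_eq_zero_of_notMem_tsupport fun h => hzK (hj h)]
    -- Only the energy term is nonlinear in the candidate gradient. It has the good sign, so almost
    -- everywhere convergence and Fatou's lemma pass the inequality to the limit.
    have := (integral_le_of_tendsto_ae (μ := volume) (F := fun k z => ‖h k z‖ ^ p * η z)
      (b := fun k => C * (c + 1 / ((k : ℝ) + 1) * T)) (b₀ := C * (c + 0 * T))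
      (Eventually.of_forall hint) (fun k z => mul_nonneg (by positivity) (h0 z)) hae
      (eventually_atTop.2 ⟨j, fun k hk => ?_⟩)
      ((tendsto_const_nhds.add (h1k.mul_const T)).const_mul C)).2
    · rw [← inv_mul_le_iff₀ hC, ← one_div] at this
      linarith
    · have := (htest k hk).2 h0
      rw [← inv_mul_le_iff₀ hC, ← one_div]
      linarith

theorem IsApproxDistribSub.isWeakSpaceGrad {p C : ℝ} {f u : ℝ × E → ℝ} {Ω : Set (ℝ × E)}
    {G : ℝ × E → E} (h : IsApproxDistribSub p C f u Ω 0 G) (hG : LocallyIntegrableOn G Ω) :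
    IsWeakSpaceGrad Ω u G := by
  refine ⟨hG, fun φ hφ hφc hφΩ i => ?_⟩
  have hd : Differentiable ℝ φ := hφ.differentiable (by simp)
  simp only [spaceGrad_apply (hd _)]
  rw [setIntegral_eq_integral_of_tsupport_subset u ((tsupport_fderiv_apply_subset ℝ _).trans hφΩ),
    setIntegral_eq_integral_of_tsupport_subset (fun z => G z i) hφΩ]
  have := (h φ hφ hφc hφΩ).1 i
  rw [zero_mul] at this
  have := abs_nonpos_iff.1 this
  linarith

end WeakGradientExistence

/-! ### Parabolic rescaling of viscosity and distributional inequalities. -/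

section Scaling
open Filter Topology Metric

variable {d : ℕ}

local notation "E" => EuclideanSpace ℝ (Fin d)

theorem fderiv_comp_affineHomeo_symm {t τ δ : ℝ} {x : E} (hτ : 0 < τ) (hδ : 0 < δ)
    {φ : ℝ × E → ℝ} {w : ℝ × E} (hφ : DifferentiableAt ℝ φ ((affineHomeo t x hτ hδ).symm w))
    (v : ℝ × E) :
    fderiv ℝ (fun w => φ ((affineHomeo t x hτ hδ).symm w)) w v =
      fderiv ℝ φ ((affineHomeo t x hτ hδ).symm w) (τ⁻¹ * v.1, δ⁻¹ • v.2) := by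
  have h1 : HasFDerivAt (fun w : ℝ × E => (affineHomeo t x hτ hδ).symm w)
      ((τ⁻¹ • ContinuousLinearMap.fst ℝ ℝ E).prod (δ⁻¹ • ContinuousLinearMap.snd ℝ ℝ E)) w := by
    refine HasFDerivAt.prodMk ?_ ?_
    · simpa [smul_eq_mul] using (hasFDerivAt_fst.sub_const t).const_mul τ⁻¹
    · exact (hasFDerivAt_snd.sub_const x).const_smul δ⁻¹
  have h2 : HasFDerivAt (fun w => φ ((affineHomeo t x hτ hδ).symm w)) _ w :=
    hφ.hasFDerivAt.comp w h1
  rw [h2.fderiv]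
  simp

theorem contDiff_affineHomeo_symm {t τ δ : ℝ} {x : E} (hτ : 0 < τ) (hδ : 0 < δ) {n : WithTop ℕ∞} :
    ContDiff ℝ n fun w => (affineHomeo t x hτ hδ).symm w := by
  have : (fun w => (affineHomeo t x hτ hδ).symm w) =
    fun w : ℝ × E => (τ⁻¹ * (w.1 - t), δ⁻¹ • (w.2 - x)) := rfl
  rw [this]
  fun_prop

variable {p lam h : ℝ}

/-- The time unit λ^(1-p) h is chosen so that the amplitude λh divided by it is λ^p. This is also
the factor gained by |Du|^p, so the equation keeps its form. -/
theorem rescaling_time_factor (hlam : 0 < lam) (hh : 0 < h) :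
    lam * h * (lam ^ (1 - p) * h)⁻¹ = lam ^ p := by
  have h1 : lam = lam ^ p * lam ^ (1 - p) := by rw [← Real.rpow_add hlam]; simp
  have h2 : lam ^ (1 - p) ≠ 0 := (Real.rpow_pos_of_pos hlam _).ne'
  field_simp
  rw [mul_comm]; exact h1

/-- The derivatives of a test function rescaled in the parabolic way. -/
theorem rescaled_test_function (hlam : 0 < lam) (hh : 0 < h) (t : ℝ) (x : E)
    (hτ : 0 < lam ^ (1 - p) * h) {φ : ℝ × E → ℝ} (hφ : ContDiff ℝ 1 φ) (z : ℝ × E) :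
    ContDiff ℝ 1 (fun w => lam * h * φ ((affineHomeo t x hτ hh).symm w)) ∧
    timeDeriv (fun w => lam * h * φ ((affineHomeo t x hτ hh).symm w)) (affineHomeo t x hτ hh z) =
      lam ^ p * timeDeriv φ z ∧
    ‖spaceGrad (fun w => lam * h * φ ((affineHomeo t x hτ hh).symm w))
      (affineHomeo t x hτ hh z)‖ ^ p = lam ^ p * ‖spaceGrad φ z‖ ^ p := by
  set S := affineHomeo t x hτ hh
  have hφ1 : ContDiff ℝ 1 (fun w => φ (S.symm w)) := hφ.comp (contDiff_affineHomeo_symm hτ hh)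
  have hψ : ContDiff ℝ 1 (fun w => lam * h * φ (S.symm w)) := contDiff_const.mul hφ1
  have hd := hφ.differentiable one_ne_zero
  have hfd : ∀ v, fderiv ℝ (fun w => lam * h * φ (S.symm w)) (S z) v =
      lam * h * fderiv ℝ φ z ((lam ^ (1 - p) * h)⁻¹ * v.1, h⁻¹ • v.2) := fun v => by
    rw [fderiv_const_mul (hφ1.differentiable one_ne_zero _)]
    have := fderiv_comp_affineHomeo_symm (t := t) (x := x) hτ hh (w := S z) (hd _) v
    rw [show (affineHomeo t x hτ hh).symm (S z) = z from S.symm_apply_apply z] at this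
    simp only [_root_.smul_apply, smul_eq_mul]
    rw [← this]
  refine ⟨hψ, ?_, ?_⟩
  · rw [timeDeriv_eq_fderiv (hψ.differentiable one_ne_zero _), timeDeriv_eq_fderiv (hd z), hfd,
      ← rescaling_time_factor (p := p) hlam hh]
    have : (((lam ^ (1 - p) * h)⁻¹ * 1, h⁻¹ • 0) : ℝ × E) =
        (lam ^ (1 - p) * h)⁻¹ • ((1, 0) : ℝ × E) := by simp
    dsimp only
    rw [this, map_smul, smul_eq_mul]; ring
  · have : spaceGrad (fun w => lam * h * φ (S.symm w)) (S z) = lam • spaceGrad φ z := by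
      refine ext_inner_right ℝ fun e => ?_
      rw [inner_spaceGrad (hψ.differentiable one_ne_zero _), hfd, inner_smul_left,
        inner_spaceGrad (hd z)]
      have : (((lam ^ (1 - p) * h)⁻¹ * 0, h⁻¹ • e) : ℝ × E) = h⁻¹ • ((0, e) : ℝ × E) := by simp
      rw [this, map_smul, smul_eq_mul]
      simp only [RCLike.conj_to_real]
      field_simp
    rw [this, norm_smul, Real.norm_of_nonneg hlam.le, Real.mul_rpow hlam.le (norm_nonneg _)]

theorem IsViscositySub.comp_affineHomeo {C : ℝ} {f u : ℝ × E → ℝ} {Ω : Set (ℝ × E)}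
    (hsub : IsViscositySub p C f Ω u) (hlam : 0 < lam) (hh : 0 < h) (t : ℝ) (x : E)
    (hτ : 0 < lam ^ (1 - p) * h) :
    IsViscositySub p C (fun z => (lam ^ p)⁻¹ * f (affineHomeo t x hτ hh z))
      (affineHomeo t x hτ hh ⁻¹' Ω) (fun z => (lam * h)⁻¹ * u (affineHomeo t x hτ hh z)) := by
  intro φ hφ z hz hmax
  obtain ⟨h1, h2, h3⟩ := rescaled_test_function hlam hh t x hτ hφ z
  set S := affineHomeo t x hτ hh
  have hmax' : IsLocalMax (fun w => u w - lam * h * φ (S.symm w)) (S z) := by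
    have ht : Tendsto S.symm (𝓝 (S z)) (𝓝 z) := by
      simpa using S.symm.continuous.tendsto (S z)
    filter_upwards [ht.eventually hmax] with w hw
    simp only [S.apply_symm_apply, S.symm_apply_apply] at hw ⊢
    have := mul_le_mul_of_nonneg_left hw (show 0 ≤ lam * h by positivity)
    have e : ∀ a b, lam * h * ((lam * h)⁻¹ * a - b) = a - lam * h * b := fun a b => by field_simp
    rwa [e, e] at this
  have := hsub _ h1 (S z) hz hmax'
  rw [h2, h3] at this
  rw [le_inv_mul_iff₀ (by positivity)]
  linarith

/-- The Hamiltonian is invariant under the scaling, but the constant on the other side is divided by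
λ^p. This is why the error e is a separate parameter in `IsViscositySuperWith`. -/
theorem IsViscositySuper.comp_affineHomeo {C : ℝ} {u : ℝ × E → ℝ} {Ω : Set (ℝ × E)}
    (hsup : IsViscositySuper p C Ω u) (hlam : 0 < lam) (hh : 0 < h) (t : ℝ) (x : E)
    (hτ : 0 < lam ^ (1 - p) * h) :
    IsViscositySuperWith p C (C * (lam ^ p)⁻¹)
      (affineHomeo t x hτ hh ⁻¹' Ω) (fun z => (lam * h)⁻¹ * u (affineHomeo t x hτ hh z)) := by
  intro φ hφ z hz hmin
  obtain ⟨h1, h2, h3⟩ := rescaled_test_function hlam hh t x hτ hφ z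
  set S := affineHomeo t x hτ hh
  have hmin' : IsLocalMin (fun w => u w - lam * h * φ (S.symm w)) (S z) := by
    have ht : Tendsto S.symm (𝓝 (S z)) (𝓝 z) := by
      simpa using S.symm.continuous.tendsto (S z)
    filter_upwards [ht.eventually hmin] with w hw
    simp only [S.apply_symm_apply, S.symm_apply_apply] at hw ⊢
    have := mul_le_mul_of_nonneg_left hw (show 0 ≤ lam * h by positivity)
    have e : ∀ a b, lam * h * ((lam * h)⁻¹ * a - b) = a - lam * h * b := fun a b => by field_simp
    rwa [e, e] at this
  have := hsup _ h1 (S z) hz hmin'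
  rw [h2, h3] at this
  have hl : 0 < lam ^ p := by positivity
  rw [← mul_neg_one, mul_right_comm, mul_neg_one, mul_inv_le_iff₀ hl]
  linarith

theorem IsApproxDistribSub.comp_affineHomeo {C : ℝ} {f u : ℝ × E → ℝ} {Ω : Set (ℝ × E)}
    {G : ℝ × E → E} (hG : IsApproxDistribSub p C f u Ω 0 G) (hlam : 0 < lam) (hh : 0 < h) (t : ℝ)
    (x : E) (hτ : 0 < lam ^ (1 - p) * h) :
    IsApproxDistribSub p C (fun z => (lam ^ p)⁻¹ * f (affineHomeo t x hτ hh z))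
      (fun z => (lam * h)⁻¹ * u (affineHomeo t x hτ hh z)) (affineHomeo t x hτ hh ⁻¹' Ω) 0
      (fun z => lam⁻¹ • G (affineHomeo t x hτ hh z)) := by
  intro η hη hηc hηΩ
  set S := affineHomeo t x hτ hh with hS
  have hψ : ContDiff ℝ ∞ fun w => η (S.symm w) := hη.comp (contDiff_affineHomeo_symm hτ hh)
  have hψc : HasCompactSupport fun w => η (S.symm w) := hηc.comp_homeomorph S.symm
  have hψΩ : tsupport (fun w => η (S.symm w)) ⊆ Ω := by
    have : tsupport (fun w => η (S.symm w)) ⊆ S.symm ⁻¹' tsupport η :=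
      closure_minimal (fun w hw => subset_tsupport η hw)
        ((isClosed_tsupport η).preimage S.symm.continuous)
    intro w hw
    simpa using hηΩ (this hw)
  obtain ⟨ha, hb⟩ := hG _ hψ hψc hψΩ
  have hd := hη.differentiable (by simp)
  have hfd : ∀ z v, fderiv ℝ (fun w => η (S.symm w)) (S z) v =
      fderiv ℝ η z ((lam ^ (1 - p) * h)⁻¹ * v.1, h⁻¹ • v.2) := fun z v => by
    have := fderiv_comp_affineHomeo_symm (t := t) (x := x) hτ hh (w := S z) (hd _) v
    rwa [show (affineHomeo t x hτ hh).symm (S z) = z from S.symm_apply_apply z] at this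
  set c := (lam ^ (1 - p) * h * h ^ d)⁻¹ with hc
  have hc0 : 0 < c := by positivity
  have hcov : ∀ F : ℝ × E → ℝ, ∫ z, F (S z) = c * ∫ z, F z := fun F =>
    integral_comp_affine F t x hτ hh
  refine ⟨fun i => ?_, fun h0 => ?_⟩
  · have hai := ha i
    rw [zero_mul] at hai ⊢
    have hai := abs_nonpos_iff.1 hai
    have e1 : ∫ z, (lam * h)⁻¹ * u (S z) * fderiv ℝ η z (0, EuclideanSpace.single i 1) =
        lam⁻¹ * (c * ∫ z, u z * fderiv ℝ (fun w => η (S.symm w)) z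
          (0, EuclideanSpace.single i 1)) := by
      rw [← hcov, ← integral_const_mul]
      refine integral_congr_ae (Eventually.of_forall fun z => ?_)
      dsimp only
      rw [hfd]
      have : (((lam ^ (1 - p) * h)⁻¹ * 0, h⁻¹ • EuclideanSpace.single i (1 : ℝ)) : ℝ × E) =
          h⁻¹ • ((0, EuclideanSpace.single i 1) : ℝ × E) := by simp
      rw [this, map_smul, smul_eq_mul, mul_inv]; ring
    have e2 : ∫ z, (lam⁻¹ • G (S z)) i * η z = lam⁻¹ * (c * ∫ z, G z i * η (S.symm z)) := by
      rw [← hcov, ← integral_const_mul]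
      refine integral_congr_ae (Eventually.of_forall fun z => ?_)
      simp; ring
    rw [e1, e2, ← mul_add, ← mul_add, hai]; simp
  · have hb := hb fun z => h0 _
    rw [zero_mul, add_zero] at hb ⊢
    have e1 : ∫ z, (lam * h)⁻¹ * u (S z) * fderiv ℝ η z (1, 0) =
        (lam ^ p)⁻¹ * (c * ∫ z, u z * fderiv ℝ (fun w => η (S.symm w)) z (1, 0)) := by
      rw [← hcov, ← integral_const_mul]
      refine integral_congr_ae (Eventually.of_forall fun z => ?_)
      dsimp only
      rw [hfd]
      have : (((lam ^ (1 - p) * h)⁻¹ * 1, h⁻¹ • 0) : ℝ × E) =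
          (lam ^ (1 - p) * h)⁻¹ • ((1, 0) : ℝ × E) := by simp
      rw [this, map_smul, smul_eq_mul, ← rescaling_time_factor (p := p) hlam hh, mul_inv (lam * h)]
      field_simp
    have e2 : ∫ z, ‖lam⁻¹ • G (S z)‖ ^ p * η z =
        (lam ^ p)⁻¹ * (c * ∫ z, ‖G z‖ ^ p * η (S.symm z)) := by
      rw [← hcov, ← integral_const_mul]
      refine integral_congr_ae (Eventually.of_forall fun z => ?_)
      dsimp only
      rw [norm_smul, Real.norm_of_nonneg (by positivity), Real.mul_rpow (by positivity)
        (norm_nonneg _), Real.inv_rpow hlam.le, S.symm_apply_apply, mul_assoc]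
    have e3 : ∫ z, (lam ^ p)⁻¹ * f (S z) * η z =
        (lam ^ p)⁻¹ * (c * ∫ z, f z * η (S.symm z)) := by
      rw [← hcov, ← integral_const_mul]
      refine integral_congr_ae (Eventually.of_forall fun z => ?_)
      simp; ring
    rw [e1, e2, e3]
    have := mul_le_mul_of_nonneg_left hb (show 0 ≤ (lam ^ p)⁻¹ * c by positivity)
    linarith

theorem integrableOn_comp_affineHomeo {F : Type*} [NormedAddCommGroup F] {f : ℝ × E → F}
    {t τ δ : ℝ} {x : E} (hτ : 0 < τ) (hδ : 0 < δ) {s : Set (ℝ × E)} (hf : IntegrableOn f s) :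
    IntegrableOn (fun z => f (affineHomeo t x hτ hδ z)) (affineHomeo t x hτ hδ ⁻¹' s) := by
  have h := (affineHomeo t x hτ hδ).measurableEmbedding.integrableOn_map_iff (f := f) (s := s)
    (μ := volume)
  refine h.1 ?_
  have h' : (affineHomeo t x hτ hδ : ℝ × E → ℝ × E) =
    fun z => (t + τ * z.1, x + δ • z.2) := rfl
  rw [h', map_affine_volume t x hτ hδ, IntegrableOn, Measure.restrict_smul]
  exact Integrable.smul_measure hf ENNReal.ofReal_ne_top

theorem setAverage_comp_affineHomeo {f : ℝ × E → ℝ} {t τ δ : ℝ} {x : E} (hτ : 0 < τ) (hδ : 0 < δ)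
    {s : Set (ℝ × E)} (hs : MeasurableSet s) :
    ⨍ z in affineHomeo t x hτ hδ ⁻¹' s, f (affineHomeo t x hτ hδ z) = ⨍ z in s, f z := by
  have h1 : ∀ f : ℝ × E → ℝ, ∫ z in affineHomeo t x hτ hδ ⁻¹' s, f (affineHomeo t x hτ hδ z) =
      (τ * δ ^ d)⁻¹ * ∫ z in s, f z := fun f => setIntegral_comp_affine f t x hτ hδ hs
  have h2 := h1 fun _ => 1
  simp only [setIntegral_const, smul_eq_mul, mul_one] at h2
  have h3 : (τ * δ ^ d)⁻¹ ≠ 0 := by positivity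
  rw [setAverage_eq, setAverage_eq, h1, h2, smul_eq_mul, smul_eq_mul, mul_inv]
  field_simp

theorem preimage_affineHomeo_cyl {c τ δ : ℝ} (hτ : 0 < τ) (hδ : 0 < δ) (z₀ : ℝ × E) :
    affineHomeo z₀.1 z₀.2 hτ hδ ⁻¹' cyl (c * τ) (c * δ) z₀ = cyl c c 0 := by
  have h1 : ∀ (a s b : ℝ), 0 < s → (a + s * b ∈ Ioo (a - c * s / 2) (a + c * s / 2) ↔
      b ∈ Ioo (0 - c / 2) (0 + c / 2)) := fun a s b hs => by
    simp only [mem_Ioo]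
    constructor <;> rintro ⟨h1, h2⟩ <;> constructor <;> nlinarith
  ext z
  change (z₀.1 + τ * z.1 ∈ _ ∧ ∀ i, (z₀.2 + δ • z.2) i ∈ _) ↔
    (z.1 ∈ Ioo ((0 : ℝ × E).1 - c / 2) ((0 : ℝ × E).1 + c / 2) ∧ ∀ i, z.2 i ∈ _)
  refine and_congr (h1 _ _ _ hτ) (forall_congr' fun i => ?_)
  exact h1 _ _ _ hδ

end Scaling

/-! ### Cylinders and the energy estimate through small oscillation. -/

section ReverseHolder
open Filter Topology Metric

variable {d : ℕ}

local notation "E" => EuclideanSpace ℝ (Fin d)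

theorem isOpen_cube (ρ : ℝ) (x : E) : IsOpen (cube ρ x) := by
  simp only [cube, ofPred_forall]
  exact isOpen_iInter_of_finite fun i =>
    isOpen_Ioo.preimage (EuclideanSpace.proj (𝕜 := ℝ) i).continuous

theorem isOpen_cyl (σ ρ : ℝ) (z : ℝ × E) : IsOpen (cyl σ ρ z) :=
  isOpen_Ioo.prod (isOpen_cube _ _)

theorem cube_mono {ρ ρ' : ℝ} (h : ρ ≤ ρ') (x : E) : cube ρ x ⊆ cube ρ' x := fun y hy i =>
  ⟨by have := (hy i).1; linarith, by have := (hy i).2; linarith⟩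

theorem cyl_mono {σ σ' ρ ρ' : ℝ} (hσ : σ ≤ σ') (hρ : ρ ≤ ρ') (z : ℝ × E) :
    cyl σ ρ z ⊆ cyl σ' ρ' z :=
  prod_mono (Ioo_subset_Ioo (by linarith) (by linarith)) (cube_mono hρ _)

theorem ball_subset_cube {ρ R : ℝ} (h : 2 * R ≤ ρ) : ball (0 : E) R ⊆ cube ρ 0 := fun y hy i => by
  have h1 := PiLp.norm_apply_le y i
  rw [mem_ball_zero_iff] at hy
  have h2 := abs_le.1 (Real.norm_eq_abs (y i) ▸ h1)
  simp only [PiLp.zero_apply, mem_Ioo]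
  constructor <;> linarith

theorem cube_subset_closedBall {ρ : ℝ} (hρ : 0 ≤ ρ) :
    cube ρ (0 : E) ⊆ closedBall 0 (√d * (ρ / 2)) := fun y hy => by
  rw [mem_closedBall_zero_iff, EuclideanSpace.norm_eq]
  have h1 : ∑ i, ‖y i‖ ^ 2 ≤ d * (ρ / 2) ^ 2 := by
    calc ∑ i, ‖y i‖ ^ 2 ≤ ∑ _i : Fin d, (ρ / 2) ^ 2 := by
          refine Finset.sum_le_sum fun i _ => ?_
          have := hy i
          simp only [PiLp.zero_apply, mem_Ioo, zero_sub, zero_add] at this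
          rw [Real.norm_eq_abs]
          exact pow_le_pow_left₀ (abs_nonneg _) (abs_le.2 ⟨this.1.le, this.2.le⟩) 2
      _ = d * (ρ / 2) ^ 2 := by simp
  calc √(∑ i, ‖y i‖ ^ 2) ≤ √(d * (ρ / 2) ^ 2) := Real.sqrt_le_sqrt h1
    _ = √d * (ρ / 2) := by rw [Real.sqrt_mul (by positivity), Real.sqrt_sq (by positivity)]

theorem isBounded_cyl (c : ℝ) : Bornology.IsBounded (cyl c c (0 : ℝ × E)) := by
  refine (isBounded_Ioo _ _).prod (isBounded_closedBall.subset
    ((cube_mono (le_abs_self c) _).trans (cube_subset_closedBall (abs_nonneg c))))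

theorem measureReal_cyl_pos {c : ℝ} (hc : 0 < c) : 0 < volume.real (cyl c c (0 : ℝ × E)) := by
  refine ENNReal.toReal_pos ((isOpen_cyl _ _ _).measure_pos volume ⟨0, ?_⟩).ne'
    (isBounded_cyl c).measure_lt_top.ne
  refine ⟨?_, fun i => ?_⟩ <;> simp only [Prod.fst_zero, Prod.snd_zero, PiLp.zero_apply, mem_Ioo] <;>
    constructor <;> linarith

/-- If the gradient is small in `L¹` on the large reference cylinder and the sources are small,
then the gradient is small in `L^p` on the unit cylinder. -/
theorem exists_energy_const [NeZero d] {p r C N θ : ℝ} (hp : 1 < p) (hC : 0 < C)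
    (hr : 1 + d / p < r) (hN : 0 ≤ N) (hθ : 0 < θ) :
    ∃ ε > 0, ∀ (u g : ℝ × E → ℝ) (G : ℝ × E → E),
      HasSmallGradient p C r (√d + 4) N ε u g G →
      IsApproxDistribSub p C g u (refCyl d (√d + 4)) 0 G →
      ∫ z in cyl 1 1 (0 : ℝ × E), ‖G z‖ ^ p ≤ θ := by
  have hr1 : 1 < r := lt_of_le_of_lt (le_add_of_nonneg_right (by positivity)) hr
  have hD := Real.sqrt_nonneg d
  -- The cutoff equals 1 on the unit cylinder and is supported where the oscillation estimate with R
  -- = √d + 2 applies, that is, in times (-1, 1) and radius √d + 1.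
  obtain ⟨η, hη, hηc, hηV, hη01, hη1⟩ := exists_contDiff_cutoff
    (K := Icc (-1 / 2 : ℝ) (1 / 2) ×ˢ closedBall (0 : E) √d)
    (Ω := Ioo (-1 : ℝ) 1 ×ˢ ball (0 : E) (√d + 1))
    (isCompact_Icc.prod (isCompact_closedBall _ _)) (isOpen_Ioo.prod isOpen_ball)
    (prod_mono (fun t ht => ⟨by linarith [ht.1], by linarith [ht.2]⟩)
      (closedBall_subset_ball (by linarith)))
  set T := ∫ z, |fderiv ℝ η z (1, 0)| with hT
  have hT0 : 0 ≤ T := integral_nonneg fun z => abs_nonneg _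
  set I := ∫ z, η z with hI
  have hI0 : 0 ≤ I := integral_nonneg fun z => (hη01 z).1
  -- The oscillation w and the threshold δ for the source are chosen so that each contributes at
  -- most θ/3. The last third is left for the integral of g^r.
  set w := θ / (3 * C * (T + 1)) with hw
  set δ := θ / (3 * C * (I + 1)) with hδ
  have hw0 : 0 < w := by positivity
  have hδ0 : 0 < δ := by positivity
  obtain ⟨ε, hε, hosc⟩ := exists_oscillation_const (d := d) hp hC hr (R := √d + 2) (by linarith)
    hN hw0
  rw [show √d + 2 + 2 = √d + 4 by ring, show √d + 2 - 1 = √d + 1 by ring] at hosc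
  refine ⟨min ε (δ ^ (r - 1) * (θ / (3 * C))), by positivity, fun u g G h hsub => ?_⟩
  have hosc := hosc u g G _ (min_le_left _ _) h
  have hVref : Ioo (-1 : ℝ) 1 ×ˢ ball (0 : E) (√d + 1) ⊆ refCyl d (√d + 4) :=
    prod_mono (Ioo_subset_Ioo (by norm_num) (by norm_num)) (ball_subset_ball (by linarith))
  have hΩ := isOpen_refCyl (d := d) (√d + 4)
  have hηref := hηV.trans hVref
  have hηcont := hη.continuous
  have hcont : Continuous fun z => fderiv ℝ η z (1, 0) :=
    (hη.continuous_fderiv (by simp)).clm_apply continuous_const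
  have hcs : HasCompactSupport fun z => fderiv ℝ η z (1, 0) := hηc.fderiv_apply ℝ _
  have hts : tsupport (fun z => fderiv ℝ η z (1, 0)) ⊆ tsupport η :=
    tsupport_fderiv_apply_subset ℝ _
  have hη0 : ∀ z, 0 ≤ η z := fun z => (hη01 z).1
  have hmain := (hsub η hη hηc hηref).2 hη0
  rw [zero_mul, add_zero] at hmain
  -- As ∂ₜη has zero mean, the constant u 0 may be subtracted from u, so that only the oscillation
  -- of u enters.
  have hzero : ∫ z, fderiv ℝ η z (1, 0) = 0 := by
    have := LipschitzWith.integral_fderiv_mul_eq (LipschitzWith.const (1 : ℝ)) hη hηc (1, 0)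
    simpa using this
  have iu : Integrable fun z => u z * fderiv ℝ η z (1, 0) :=
    h.continuousOn.integrable_mul_of_tsupport_subset hΩ hcont hcs (hts.trans hηref)
  have i0 : Integrable fun z => fderiv ℝ η z (1, 0) :=
    hcont.integrable_of_hasCompactSupport hcs
  have hu : -(w * T) ≤ ∫ z, u z * fderiv ℝ η z (1, 0) := by
    have e : ∫ z, u z * fderiv ℝ η z (1, 0) = ∫ z, (u z - u 0) * fderiv ℝ η z (1, 0) := by
      simp only [sub_mul]
      rw [integral_sub iu (i0.const_mul _), integral_const_mul, hzero, mul_zero, sub_zero]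
    rw [e, hT, ← integral_const_mul, ← integral_neg]
    have i1 : Integrable fun z => (u z - u 0) * fderiv ℝ η z (1, 0) := by
      simp only [sub_mul]; exact iu.sub (i0.const_mul _)
    refine integral_mono (i0.abs.const_mul w).neg i1 fun z => ?_
    by_cases hz : z ∈ tsupport η
    · have hzV := hηV hz
      have hz' : z ∈ Icc (-1 : ℝ) 1 ×ˢ closedBall (0 : E) (√d + 1) :=
        ⟨Ioo_subset_Icc_self hzV.1, ball_subset_closedBall hzV.2⟩
      have h0 : (0 : ℝ × E) ∈ Icc (-1 : ℝ) 1 ×ˢ closedBall (0 : E) (√d + 1) :=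
        ⟨by simp, mem_closedBall_self (by positivity)⟩
      have h1 := hosc z hz' 0 h0
      have h2 := hosc 0 h0 z hz'
      have h3 : |u z - u 0| ≤ w := abs_le.2 ⟨by linarith, by linarith⟩
      have h4 : |(u z - u 0) * fderiv ℝ η z (1, 0)| ≤ w * |fderiv ℝ η z (1, 0)| := by
        rw [abs_mul]; gcongr
      exact (abs_le.1 h4).1
    · have : fderiv ℝ η z (1, 0) = 0 :=
        image_eq_zero_of_notMem_tsupport (f := fun z => fderiv ℝ η z (1, 0)) fun h => hz (hts h)
      simp [this]
  have hg : ∫ z, g z * η z ≤ δ * I + θ / (3 * C) := by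
    have igη : Integrable fun z => g z * η z :=
      h.continuousOn_source.integrable_mul_of_tsupport_subset hΩ hηcont hηc hηref
    have igr : Integrable fun z => g z ^ r * η z :=
      integrable_mul_of_integrableOn h.integrableOn_source hηcont hηc hηref
    have iη : Integrable η := hηcont.integrable_of_hasCompactSupport hηc
    have h1 : ∫ z, g z * η z ≤ ∫ z, (δ * η z + δ ^ (1 - r) * (g z ^ r * η z)) := by
      refine integral_mono igη ((iη.const_mul _).add (igr.const_mul _)) fun z => ?_
      by_cases hz : z ∈ tsupport η
      · have := mul_le_mul_of_nonneg_right
          (le_add_rpow_mul hr1 hδ0 (h.source_nonneg z (hηref hz))) (hη0 z)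
        dsimp only; linarith
      · simp [image_eq_zero_of_notMem_tsupport hz]
    rw [integral_add (iη.const_mul _) (igr.const_mul _), integral_const_mul,
      integral_const_mul] at h1
    have h2 : ∫ z, g z ^ r * η z ≤ δ ^ (r - 1) * (θ / (3 * C)) := by
      refine le_trans ?_ (h.integral_source_le.trans (min_le_right _ _))
      rw [← setIntegral_eq_integral_of_forall_compl_eq_zero (s := refCyl d (√d + 4)) fun z hz => by
        simp [image_eq_zero_of_notMem_tsupport fun h => hz (hηref h)]]
      refine setIntegral_mono_on igr.integrableOn h.integrableOn_source hΩ.measurableSet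
        fun z hz => ?_
      exact mul_le_of_le_one_right (Real.rpow_nonneg (h.source_nonneg z hz) _) (hη01 z).2
    have h3 : δ ^ (1 - r) * (δ ^ (r - 1) * (θ / (3 * C))) = θ / (3 * C) := by
      rw [← mul_assoc, ← Real.rpow_add hδ0]; simp
    have h4 := mul_le_mul_of_nonneg_left h2 (show 0 ≤ δ ^ (1 - r) by positivity)
    linarith
  have hwT : C * (w * T) ≤ θ / 3 := by
    have : C * (w * T) = θ / 3 * (T / (T + 1)) := by rw [hw]; field_simp
    rw [this]
    exact mul_le_of_le_one_right (by positivity) ((div_le_one (by positivity)).2 (by linarith))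
  have hδI : C * (δ * I) ≤ θ / 3 := by
    have : C * (δ * I) = θ / 3 * (I / (I + 1)) := by rw [hδ]; field_simp
    rw [this]
    exact mul_le_of_le_one_right (by positivity) ((div_le_one (by positivity)).2 (by linarith))
  have hθ3 : C * (θ / (3 * C)) = θ / 3 := by field_simp
  have hGη : ∫ z, ‖G z‖ ^ p * η z ≤ θ := by
    have h1 : 1 / C * ∫ z, ‖G z‖ ^ p * η z ≤ δ * I + θ / (3 * C) + w * T := by linarith
    rw [one_div, inv_mul_le_iff₀ hC] at h1
    linarith
  have hcyl1 : ∀ z ∈ cyl 1 1 (0 : ℝ × E), η z = 1 := fun z hz => by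
    refine hη1 z ⟨?_, ?_⟩
    · have := hz.1
      simp only [Prod.fst_zero, mem_Ioo] at this
      constructor <;> linarith
    · refine closedBall_subset_closedBall ?_ (cube_subset_closedBall zero_le_one hz.2)
      nlinarith
  calc ∫ z in cyl 1 1 (0 : ℝ × E), ‖G z‖ ^ p
      = ∫ z in cyl 1 1 (0 : ℝ × E), ‖G z‖ ^ p * η z :=
        setIntegral_congr_fun (isOpen_cyl _ _ _).measurableSet fun z hz => by simp [hcyl1 z hz]
    _ ≤ ∫ z, ‖G z‖ ^ p * η z := setIntegral_le_integral
        (integrable_mul_of_integrableOn h.integrableOn_grad_rpow hηcont hηc hηref)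
        (Eventually.of_forall fun z => mul_nonneg (by positivity) (hη0 z))
    _ ≤ θ := hGη

end ReverseHolder

/-! ### The reverse Hölder inequality in rescaled variables and the conclusion. -/

section Main
open Filter Topology Metric

variable {d : ℕ}

local notation "E" => EuclideanSpace ℝ (Fin d)

theorem refCyl_subset_cyl {R c : ℝ} (hc : 6 ≤ c) (hR : 2 * R ≤ c) :
    refCyl d R ⊆ cyl c c (0 : ℝ × E) :=
  prod_mono (Ioo_subset_Ioo (by simp; linarith) (by simp; linarith)) (ball_subset_cube hR)

/-- Averages of nonnegative functions bound integrals over smaller sets. -/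
theorem setIntegral_le_measureReal_mul_setAverage {X : Type*} [MeasurableSpace X] {μ : Measure X}
    {s t : Set X} (hst : s ⊆ t) (ht : MeasurableSet t) (hμ : 0 < μ.real t) {F : X → ℝ}
    (hF : IntegrableOn F t μ) (hF0 : ∀ z ∈ t, 0 ≤ F z) :
    ∫ z in s, F z ∂μ ≤ μ.real t * ⨍ z in t, F z ∂μ := by
  rw [setAverage_eq, smul_eq_mul, mul_inv_cancel_left₀ hμ.ne']
  exact setIntegral_mono_set hF ((ae_restrict_iff' ht).2 (Eventually.of_forall hF0))
    hst.eventuallyLE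

/-- The reverse Hölder inequality in rescaled variables: a contradiction is reached as soon as the
right-hand side is small. -/
theorem exists_rescaled_const [NeZero d] {p r C c c' : ℝ} (hp : 1 < p) (hC : 0 < C)
    (hr : 1 + d / p < r) (hc : 2 * (√d + 4) ≤ c) (hcc' : c ≤ c') :
    ∃ ε > 0, ∀ (u f : ℝ × E → ℝ) (Du : ℝ × E → E) (Ω : Set (ℝ × E)) (lam h : ℝ) (z₀ : ℝ × E)
      (_ : 1 ≤ lam) (hh : 0 < h) (hτ : 0 < lam ^ (1 - p) * h), IsOpen Ω →
      ContinuousOn u Ω → ContinuousOn f Ω → (∀ z ∈ Ω, 0 ≤ f z) →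
      IsViscositySub p C f Ω u → IsViscositySuper p C Ω u →
      IsApproxDistribSub p C f u Ω 0 Du →
      cyl c' c' 0 ⊆ affineHomeo z₀.1 z₀.2 hτ hh ⁻¹' Ω →
      IntegrableOn (fun z => Du (affineHomeo z₀.1 z₀.2 hτ hh z)) (cyl c' c' 0) →
      IntegrableOn (fun z => ‖Du (affineHomeo z₀.1 z₀.2 hτ hh z)‖ ^ p) (cyl c' c' 0) →
      IntegrableOn (fun z => f (affineHomeo z₀.1 z₀.2 hτ hh z) ^ r) (cyl c' c' 0) →
      ⨍ z in cyl c' c' 0, ‖Du (affineHomeo z₀.1 z₀.2 hτ hh z)‖ ^ p ≤ lam ^ p →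
      ⨍ z in cyl c c 0, ‖Du (affineHomeo z₀.1 z₀.2 hτ hh z)‖ ≤ ε * lam →
      ⨍ z in cyl c c 0, (1 + f (affineHomeo z₀.1 z₀.2 hτ hh z) ^ r) ≤ ε * lam ^ p →
      ⨍ z in cyl 1 1 0, (‖Du (affineHomeo z₀.1 z₀.2 hτ hh z)‖ ^ p +
        f (affineHomeo z₀.1 z₀.2 hτ hh z) ^ r) < lam ^ p := by
  have hD := Real.sqrt_nonneg d
  have hr1 : 1 < r := lt_of_le_of_lt (le_add_of_nonneg_right (by positivity)) hr
  have hp0 : 0 < p := by linarith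
  set R := √d + 4 with hR
  have hc0 : 0 < c := by linarith
  have hc'0 : 0 < c' := by linarith
  set v₁ := volume.real (cyl 1 1 (0 : ℝ × E)) with hv₁
  set v := volume.real (cyl c c (0 : ℝ × E)) with hv
  set v' := volume.real (cyl c' c' (0 : ℝ × E)) with hv'
  have hv₁0 : 0 < v₁ := measureReal_cyl_pos one_pos
  have hv0 : 0 < v := measureReal_cyl_pos hc0
  have hv'0 : 0 < v' := measureReal_cyl_pos hc'0
  have hm : ∀ a : ℝ, MeasurableSet (cyl a a (0 : ℝ × E)) := fun a => (isOpen_cyl _ _ _).measurableSet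
  have hfin : ∀ a : ℝ, volume (cyl a a (0 : ℝ × E)) ≠ ⊤ := fun a =>
    (isBounded_cyl a).measure_lt_top.ne
  obtain ⟨ε₀, hε₀, hcore⟩ := exists_energy_const (d := d) hp hC hr hv'0.le
    (show 0 < v₁ / 4 by positivity)
  -- The three requirements serve, in order, the supersolution error, the integrals of the gradient
  -- and of the source over the reference cylinder, and the share of the source in the final
  -- average.
  set ε := min (min ε₀ (ε₀ / v)) (v₁ / (4 * v)) with hε
  have hε1 : ε ≤ ε₀ := (min_le_left _ _).trans (min_le_left _ _)
  have hε2 : v * ε ≤ ε₀ := by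
    rw [mul_comm, ← le_div_iff₀ hv0]; exact (min_le_left _ _).trans (min_le_right _ _)
  have hε3 : v * ε ≤ v₁ / 4 := by
    calc v * ε ≤ v * (v₁ / (4 * v)) := by gcongr; exact min_le_right _ _
      _ = v₁ / 4 := by field_simp
  refine ⟨ε, by positivity, fun u f Du Ω lam h z₀ hlam1 hh hτ hΩ hu hf hf0 hsub hsup hdist hΩ' iDu
    iDup ifr hA' hA hB => ?_⟩
  set S := affineHomeo z₀.1 z₀.2 hτ hh with hS
  have hlam : 0 < lam := by linarith
  have hlp : 0 < lam ^ p := by positivity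
  have hlp1 : 1 ≤ lam ^ p := Real.one_le_rpow hlam1 hp0.le
  have hcc : cyl c c (0 : ℝ × E) ⊆ cyl c' c' 0 := cyl_mono hcc' hcc' _
  have h1c : cyl 1 1 (0 : ℝ × E) ⊆ cyl c c 0 := cyl_mono (by linarith) (by linarith) _
  have hrc : refCyl d R ⊆ cyl c c (0 : ℝ × E) := refCyl_subset_cyl (by linarith) hc
  have hrΩ : refCyl d R ⊆ S ⁻¹' Ω := (hrc.trans hcc).trans hΩ'
  have hfS : ∀ z ∈ cyl c' c' (0 : ℝ × E), 0 ≤ f (S z) := fun z hz => hf0 _ (hΩ' hz)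
  have hmaps : MapsTo S (refCyl d R) Ω := hrΩ
  have hfr0 : ∀ z ∈ cyl c' c' (0 : ℝ × E), 0 ≤ f (S z) ^ r := fun z hz =>
    Real.rpow_nonneg (hfS z hz) _
  have i1fr : IntegrableOn (fun z => 1 + f (S z) ^ r) (cyl c c 0) :=
    (integrableOn_const (hfin c)).add (ifr.mono_set hcc)
  have hfrint : ∀ s ⊆ cyl c c (0 : ℝ × E), ∫ z in s, f (S z) ^ r ≤ v * (ε * lam ^ p) := by
    intro s hs
    calc ∫ z in s, f (S z) ^ r ≤ v * ⨍ z in cyl c c 0, f (S z) ^ r :=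
          setIntegral_le_measureReal_mul_setAverage hs (hm c) hv0 (ifr.mono_set hcc)
            fun z hz => hfr0 z (hcc hz)
      _ ≤ v * ⨍ z in cyl c c 0, (1 + f (S z) ^ r) := by
          gcongr v * ?_
          rw [setAverage_eq, setAverage_eq]
          refine smul_le_smul_of_nonneg_left ?_ (inv_nonneg.2 hv0.le)
          exact integral_mono (ifr.mono_set hcc) i1fr fun z => by dsimp only; linarith
      _ ≤ v * (ε * lam ^ p) := by gcongr
  -- The summand 1 in 1 + f^r makes the average at least 1, so its bound by ελ^p forces λ^(-p) ≤ ε.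
  -- This makes the rescaled supersolution error Cλ^(-p) small.
  have hlampε : (lam ^ p)⁻¹ ≤ ε := by
    have h1 : (1 : ℝ) ≤ ⨍ z in cyl c c 0, (1 + f (S z) ^ r) := by
      have ic : IntegrableOn (fun _ : ℝ × E => (1 : ℝ)) (cyl c c 0) := integrableOn_const (hfin c)
      rw [setAverage_eq, integral_add ic (ifr.mono_set hcc),
        setIntegral_const, smul_eq_mul, smul_eq_mul, mul_one, mul_add, ← hv,
        inv_mul_cancel₀ hv0.ne']
      have : 0 ≤ ∫ z in cyl c c 0, f (S z) ^ r := setIntegral_nonneg (hm c) fun z hz =>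
        hfr0 z (hcc hz)
      have : 0 ≤ v⁻¹ * ∫ z in cyl c c 0, f (S z) ^ r := by positivity
      linarith
    rw [inv_le_iff_one_le_mul₀ hlp]
    linarith
  set G : ℝ × E → E := fun z => lam⁻¹ • Du (S z) with hG
  have hGn : ∀ z, ‖G z‖ = lam⁻¹ * ‖Du (S z)‖ := fun z => by
    rw [hG, norm_smul, Real.norm_of_nonneg (by positivity)]
  have hGp : ∀ z, ‖G z‖ ^ p = (lam ^ p)⁻¹ * ‖Du (S z)‖ ^ p := fun z => by
    rw [hGn, Real.mul_rpow (by positivity) (norm_nonneg _), Real.inv_rpow hlam.le]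
  have hGi : IntegrableOn G (cyl c' c' 0) := iDu.smul lam⁻¹
  -- The rescaled source has its power r multiplied by λ^(-pr), which is at most λ^(-p) because λ ≥
  -- 1 and r > 1.
  have hgr : ∀ z ∈ cyl c' c' (0 : ℝ × E), ((lam ^ p)⁻¹ * f (S z)) ^ r ≤ (lam ^ p)⁻¹ * f (S z) ^ r := by
    intro z hz
    rw [Real.mul_rpow (by positivity) (hfS z hz)]
    gcongr
    · exact hfr0 z hz
    · calc (lam ^ p)⁻¹ ^ r ≤ (lam ^ p)⁻¹ ^ (1 : ℝ) :=
          Real.rpow_le_rpow_of_exponent_ge (by positivity) (inv_le_one_of_one_le₀ hlp1) hr1.le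
        _ = _ := Real.rpow_one _
  have hgreq : EqOn (fun z => ((lam ^ p)⁻¹ * f (S z)) ^ r)
      (fun z => (lam ^ p)⁻¹ ^ r * f (S z) ^ r) (cyl c' c' 0) := fun z hz =>
    Real.mul_rpow (by positivity) (hfS z hz)
  have igr : IntegrableOn (fun z => ((lam ^ p)⁻¹ * f (S z)) ^ r) (cyl c' c' 0) :=
    (integrableOn_congr_fun hgreq (hm c')).2 (ifr.const_mul _)
  have hdist' := (hdist.comp_affineHomeo hlam hh z₀.1 z₀.2 hτ).mono hrΩ le_rfl
  have href : MeasurableSet (refCyl d R) := (isOpen_refCyl R).measurableSet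
  have hsmall : HasSmallGradient p C r R v' ε₀ (fun z => (lam * h)⁻¹ * u (S z))
      (fun z => (lam ^ p)⁻¹ * f (S z)) G :=
    { continuousOn := continuousOn_const.mul (hu.comp S.continuous.continuousOn hmaps)
      continuousOn_source := continuousOn_const.mul (hf.comp S.continuous.continuousOn hmaps)
      source_nonneg := fun z hz => mul_nonneg (by positivity) (hf0 _ (hmaps hz))
      sub := fun φ hφ z hz hmax =>
        hsub.comp_affineHomeo hlam hh z₀.1 z₀.2 hτ φ hφ z (hrΩ hz) hmax
      super := fun φ hφ z hz hmin => by
        refine le_trans ?_ (hsup.comp_affineHomeo hlam hh z₀.1 z₀.2 hτ φ hφ z (hrΩ hz) hmin)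
        have := mul_le_mul_of_nonneg_left (hlampε.trans hε1) hC.le
        linarith
      weakGrad := hdist'.isWeakSpaceGrad
        (hGi.mono_set (hrc.trans hcc)).locallyIntegrableOn
      integrableOn_grad := hGi.mono_set (hrc.trans hcc)
      integrableOn_grad_rpow := by
        simp only [hGp]
        exact (iDup.mono_set (hrc.trans hcc)).const_mul _
      integrableOn_source := igr.mono_set (hrc.trans hcc)
      integral_grad_le := by
        simp only [hGn]
        rw [integral_const_mul, inv_mul_le_iff₀ hlam]
        calc ∫ z in refCyl d R, ‖Du (S z)‖ ≤ v * ⨍ z in cyl c c 0, ‖Du (S z)‖ :=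
              setIntegral_le_measureReal_mul_setAverage hrc (hm c) hv0 (iDu.mono_set hcc).norm
                fun z _ => norm_nonneg _
          _ ≤ v * (ε * lam) := by gcongr
          _ = (v * ε) * lam := by ring
          _ ≤ ε₀ * lam := by gcongr
          _ = lam * ε₀ := mul_comm _ _
      integral_grad_rpow_le := by
        simp only [hGp]
        rw [integral_const_mul, inv_mul_le_iff₀ hlp]
        calc ∫ z in refCyl d R, ‖Du (S z)‖ ^ p ≤ v' * ⨍ z in cyl c' c' 0, ‖Du (S z)‖ ^ p :=
              setIntegral_le_measureReal_mul_setAverage (hrc.trans hcc) (hm c') hv'0 iDup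
                fun z _ => by positivity
          _ ≤ v' * lam ^ p := by gcongr
          _ = lam ^ p * v' := mul_comm _ _
      integral_source_le := by
        calc ∫ z in refCyl d R, ((lam ^ p)⁻¹ * f (S z)) ^ r
            ≤ ∫ z in refCyl d R, (lam ^ p)⁻¹ * f (S z) ^ r :=
              setIntegral_mono_on (igr.mono_set (hrc.trans hcc))
                ((ifr.mono_set (hrc.trans hcc)).const_mul _) href
                fun z hz => hgr z (hcc (hrc hz))
          _ = (lam ^ p)⁻¹ * ∫ z in refCyl d R, f (S z) ^ r := integral_const_mul _ _
          _ ≤ (lam ^ p)⁻¹ * (v * (ε * lam ^ p)) := by gcongr; exact hfrint _ hrc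
          _ = v * ε := by field_simp
          _ ≤ ε₀ := hε2 }
  have h1 := hcore _ _ G hsmall hdist'
  simp only [hGp] at h1
  rw [integral_const_mul, inv_mul_le_iff₀ hlp] at h1
  have h2 := hfrint _ h1c
  have h3 := mul_le_mul_of_nonneg_right hε3 hlp.le
  -- The gradient and the source each contribute at most a quarter of the measure of the unit
  -- cylinder times λ^p, so the average is at most λ^p / 2.
  rw [setAverage_eq, integral_add (iDup.mono_set (h1c.trans hcc)) (ifr.mono_set (h1c.trans hcc)),
    smul_eq_mul, inv_mul_lt_iff₀ hv₁0]
  have := mul_pos hv₁0 hlp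
  linarith

end Main

theorem proposition3p1 (d : ℕ) (hd : 1 ≤ d) (p r r₁ C : ℝ) (hp : 1 < p)
    (hr : 1 + d / p < r) (hr₁ : r₁ ∈ Ioo (1 + d / p) r) (hC : 0 < C) :
    ∃ lam₀ κ c₁ c₂ K : ℝ, 1 ≤ lam₀ ∧ 1 ≤ κ ∧ 2 ≤ c₁ ∧ 5 * c₁ ≤ c₂ ∧ 0 < K ∧
      ∀ u f : ℝ × EuclideanSpace ℝ (Fin d) → ℝ,
        ContinuousOn u (Icc (-1 / 2) (1 / 2) ×ˢ cube 1 0) →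
        ContinuousOn f (Icc (-1 / 2) (1 / 2) ×ˢ cube 1 0) →
        (∀ z ∈ (Icc (-1 / 2) (1 / 2) : Set ℝ) ×ˢ cube (d := d) 1 0, 0 ≤ f z) →
        IsViscositySub p C f (cyl 1 1 0) u →
        IsViscositySuper p C (cyl 1 1 0) u →
        ∃ Du : ℝ × EuclideanSpace ℝ (Fin d) → EuclideanSpace ℝ (Fin d),
          IsWeakSpaceGrad (cyl 1 1 0) u Du ∧
          LocallyIntegrableOn (fun z => ‖Du z‖ ^ p) (cyl 1 1 0) ∧
          ∀ (lam h σ : ℝ) (z₀ : ℝ × EuclideanSpace ℝ (Fin d)),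
            lam₀ ≤ lam → 0 < h → σ = κ * lam ^ (1 - p) →
            cyl (c₂ * σ * h) (c₂ * h) z₀ ⊆ cyl 1 1 0 →
            lam ^ p ≤ (⨍ z in cyl (σ * h) h z₀, (‖Du z‖ ^ p + f z ^ r₁)) →
            (⨍ z in cyl (σ * h) h z₀, (‖Du z‖ ^ p + f z ^ r₁)) ≤
              c₂ ^ (d + 1) * (⨍ z in cyl (c₂ * σ * h) (c₂ * h) z₀, (‖Du z‖ ^ p + f z ^ r₁)) →
            c₂ ^ (d + 1) * (⨍ z in cyl (c₂ * σ * h) (c₂ * h) z₀, (‖Du z‖ ^ p + f z ^ r₁)) ≤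
              c₂ ^ (d + 1) * lam ^ p →
            (⨍ z in cyl (c₂ * σ * h) (c₂ * h) z₀, ‖Du z‖ ^ p) ≤
              K * (⨍ z in cyl (c₁ * σ * h) (c₁ * h) z₀, ‖Du z‖) ^ p +
              K * (⨍ z in cyl (c₁ * σ * h) (c₁ * h) z₀, (1 + f z ^ r₁)) := by
  have : NeZero d := ⟨by omega⟩
  have hD := Real.sqrt_nonneg d
  have hp0 : 0 < p := by linarith
  -- With this edge the rescaled cylinder Q' contains the reference cylinder of radius √d + 4.
  set c₁ := 2 * (√d + 4) with hc₁
  set c₂ := 5 * c₁ with hc₂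
  have hc₁0 : 0 < c₁ := by positivity
  have hc₂0 : 0 < c₂ := by positivity
  obtain ⟨ε, hε, hmain⟩ := exists_rescaled_const (d := d) (c := c₁) (c' := c₂) hp hC hr₁.1 le_rfl
    (by linarith)
  -- Taking λ₀ = κ = 1 is enough: large values of λ are not imposed, since λ^(-p) ≤ ε follows from
  -- the failure of the inequality. K is chosen so that this failure gives both smallness
  -- conditions.
  refine ⟨1, 1, c₁, c₂, max (ε ^ p)⁻¹ ε⁻¹, le_rfl, le_rfl, by linarith, le_rfl, by positivity,
    fun u f hu hf hf0 hsub hsup => ?_⟩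
  set K := max (ε ^ p)⁻¹ ε⁻¹ with hK
  set Ω := cyl 1 1 (0 : ℝ × EuclideanSpace ℝ (Fin d)) with hΩdef
  have hΩ : IsOpen Ω := isOpen_cyl _ _ _
  have hΩsub : Ω ⊆ Icc (-1 / 2) (1 / 2) ×ˢ cube 1 0 := fun z hz => by
    refine ⟨?_, hz.2⟩
    have := hz.1
    simp only [Prod.fst_zero, mem_Ioo] at this
    constructor <;> linarith
  replace hu := hu.mono hΩsub
  replace hf := hf.mono hΩsub
  replace hf0 : ∀ z ∈ Ω, 0 ≤ f z := fun z hz => hf0 z (hΩsub hz)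
  obtain ⟨Du, hDu, hDup, hdist⟩ := hsub.exists_distribGrad hp hC hΩ hu hf
  refine ⟨Du, hdist.isWeakSpaceGrad hDu, hDup, fun lam h σ z₀ hlam1 hh hσ hcyl hA hAB hB => ?_⟩
  have hlam : 0 < lam := by linarith
  have hlp : 0 < lam ^ p := by positivity
  rw [one_mul] at hσ
  have hτ : 0 < lam ^ (1 - p) * h := by positivity
  subst hσ
  rw [mul_assoc c₂] at *
  rw [mul_assoc c₁]
  set τ := lam ^ (1 - p) * h with hτdef
  have hmeas : ∀ c : ℝ, MeasurableSet (cyl (c * τ) (c * h) z₀) := fun c =>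
    (isOpen_cyl _ _ _).measurableSet
  have havg : ∀ (c : ℝ) (F : ℝ × EuclideanSpace ℝ (Fin d) → ℝ),
      ⨍ z in cyl (c * τ) (c * h) z₀, F z =
        ⨍ z in cyl c c 0, F (affineHomeo z₀.1 z₀.2 hτ hh z) := fun c F => by
    rw [← setAverage_comp_affineHomeo hτ hh (hmeas c), preimage_affineHomeo_cyl]
  have hB' := le_of_mul_le_mul_left hB (by positivity)
  -- The integral of a nonintegrable function is 0 by convention, and the average over Q'' would
  -- then vanish. This contradicts the positive lower bound λ^p.
  have hint : IntegrableOn (fun z => ‖Du z‖ ^ p + f z ^ r₁) (cyl (c₂ * τ) (c₂ * h) z₀) := by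
    by_contra hcon
    rw [setAverage_eq (f := fun z => ‖Du z‖ ^ p + f z ^ r₁) (s := cyl (c₂ * τ) (c₂ * h) z₀),
      integral_undef hcon, smul_zero, mul_zero] at hAB
    linarith
  have hDum : AEStronglyMeasurable Du (volume.restrict (cyl (c₂ * τ) (c₂ * h) z₀)) :=
    hDu.aestronglyMeasurable.mono_measure (Measure.restrict_mono_set _ hcyl)
  have hfr0 : ∀ z ∈ cyl (c₂ * τ) (c₂ * h) z₀, 0 ≤ f z ^ r₁ := fun z hz =>
    Real.rpow_nonneg (hf0 z (hcyl hz)) _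
  have iDup : IntegrableOn (fun z => ‖Du z‖ ^ p) (cyl (c₂ * τ) (c₂ * h) z₀) := by
    refine hint.mono' (hDum.norm.aemeasurable.pow_const p).aestronglyMeasurable
      ((ae_restrict_iff' (hmeas _)).2 (Filter.Eventually.of_forall fun z hz => ?_))
    rw [Real.norm_of_nonneg (by positivity)]
    linarith [hfr0 z hz]
  have ifr : IntegrableOn (fun z => f z ^ r₁) (cyl (c₂ * τ) (c₂ * h) z₀) := by
    have := hint.sub iDup
    refine this.congr (Filter.Eventually.of_forall fun z => ?_)
    simp
  have hfin : volume (cyl (c₂ * τ) (c₂ * h) z₀) ≠ ⊤ :=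
    ((isBounded_cyl 1).subset hcyl).measure_lt_top.ne
  have iDu : IntegrableOn Du (cyl (c₂ * τ) (c₂ * h) z₀) := by
    refine Integrable.mono' ((integrableOn_const hfin (C := (1 : ℝ))).add iDup) hDum
      (Filter.Eventually.of_forall fun z => ?_)
    have e1 : 0 ≤ ‖Du z‖ ^ p := by positivity
    simp only [Pi.add_apply]
    rcases le_total ‖Du z‖ 1 with h1 | h1
    · linarith
    · have := Real.rpow_le_rpow_of_exponent_le h1 hp.le
      rw [Real.rpow_one] at this; linarith
  have hpre := preimage_affineHomeo_cyl (c := c₂) hτ hh z₀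
  have jDu := integrableOn_comp_affineHomeo (t := z₀.1) (x := z₀.2) hτ hh iDu
  have jDup := integrableOn_comp_affineHomeo (t := z₀.1) (x := z₀.2) hτ hh iDup
  have jfr := integrableOn_comp_affineHomeo (t := z₀.1) (x := z₀.2) hτ hh ifr
  have hsubΩ : cyl c₂ c₂ 0 ⊆ affineHomeo z₀.1 z₀.2 hτ hh ⁻¹' Ω := by
    rw [← hpre]; exact preimage_mono hcyl
  rw [hpre] at jDu jDup jfr
  have hle : ⨍ z in cyl (c₂ * τ) (c₂ * h) z₀, ‖Du z‖ ^ p ≤ lam ^ p := by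
    refine le_trans ?_ hB'
    rw [setAverage_eq, setAverage_eq]
    refine smul_le_smul_of_nonneg_left ?_ (by positivity)
    refine setIntegral_mono_on iDup hint (hmeas _) fun z hz => ?_
    linarith [hfr0 z hz]
  have h1 := havg 1 fun z => ‖Du z‖ ^ p + f z ^ r₁
  rw [one_mul, one_mul] at h1
  -- Failure of the inequality together with the bound λ^p over Q'' makes each of the two
  -- nonnegative terms on the right at most λ^p. The choice of K turns this into the two hypotheses
  -- with ε, and the rescaled statement contradicts the lower bound over Q.
  by_contra! hcon
  have hA0 : 0 ≤ ⨍ z in cyl (c₁ * τ) (c₁ * h) z₀, ‖Du z‖ := by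
    rw [setAverage_eq]
    exact smul_nonneg (by positivity) (integral_nonneg fun z => norm_nonneg _)
  have hB0 : 0 ≤ ⨍ z in cyl (c₁ * τ) (c₁ * h) z₀, (1 + f z ^ r₁) := by
    rw [setAverage_eq]
    refine smul_nonneg (by positivity) (setIntegral_nonneg (hmeas _) fun z hz => ?_)
    have := hfr0 z (cyl_mono (by gcongr; linarith) (by gcongr; linarith) _ hz)
    linarith
  set A := ⨍ z in cyl (c₁ * τ) (c₁ * h) z₀, ‖Du z‖ with hAdef
  set B := ⨍ z in cyl (c₁ * τ) (c₁ * h) z₀, (1 + f z ^ r₁) with hBdef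
  have hsum := hcon.trans_le hle
  have hK1 : (ε ^ p)⁻¹ * A ^ p ≤ K * A ^ p := by gcongr; exact le_max_left _ _
  have hK2 : ε⁻¹ * B ≤ K * B := by gcongr; exact le_max_right _ _
  have hA1 : 0 ≤ K * A ^ p := by positivity
  have hB1 : 0 ≤ K * B := by positivity
  have hAε : A ≤ ε * lam := by
    have : A ^ p ≤ (ε * lam) ^ p := by
      rw [Real.mul_rpow hε.le hlam.le, ← inv_mul_le_iff₀ (by positivity)]
      linarith
    exact (Real.rpow_le_rpow_iff hA0 (by positivity) hp0).1 this
  have hBε : B ≤ ε * lam ^ p := by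
    rw [← inv_mul_le_iff₀ hε]; linarith
  rw [hAdef, havg] at hAε
  rw [hBdef, havg] at hBε
  rw [havg] at hle
  have := hmain u f Du Ω lam h z₀ hlam1 hh hτ hΩ hu hf hf0 hsub hsup hdist hsubΩ jDu jDup jfr hle
    hAε hBε
  rw [← h1] at this
  linarith
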